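/- **Conventions.** For a doubly periodic map $X(t,\theta)$ into $\mathbb R^3$, viewed as a map of the torus $\mathbb T=\mathbb R^2/(P\mathbb Z\times 2\pi\mathbb Z)$, let $\mu$ be the area measure of the pull-back metric, $n=\frac{X_t\times X_\theta}{|X_t\times X_\theta|}$ the Gauss map, $H$ the arithmetic mean of the two principal curvatures with respect to $n$, and $$\mathcal W(X)=\int_{\mathbb T} H^2\,d\mu,\qquad \operatorname{area}(X)=\int_{\mathbb T}1\,d\mu,\qquad \operatorname{vol}(X)=\frac13\int_{\mathbb T} n\cdot X\,d\mu,\qquad \operatorname{iso}(X)=\frac{\operatorname{area}(X)}{\operatorname{vol}(X)^{2/3}} .$$ **Unduloids.** For $a>y>0$ and $b=\sqrt{a^2-y^2}$, one period $0\le t\le 2\pi$ of the unduloid (the roulette of a focus of the ellipse with foci $\pm y$, width $2a$, height $2b$), from minimum to minimum, has the profile curve $$f_{\rm u}(t)=b\,\frac{a-y\cos t}{\sqrt{a^2-y^2\cos^2t}},\qquad g_{\rm u}(t)=\int_0^t\sqrt{a^2-y^2\cos^2x}\,dx-y\sin t\,\frac{a-y\cos t}{\sqrt{a^2-y^2\cos^2t}},$$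 where $f$ is the distance to the axis and $g$ the coordinate along the axis. **Nodoids.** For $c>1$ and $b=\sqrt{c^2-1}$, one period $0\le t\le 2\pi$ of the nodoid (the patched roulettes of the two foci $\pm c$ of the hyperbola $x^2-y^2/b^2=1$), from minimum to minimum, has the profile curve $$f_{\rm n}(t)=b\,\frac{c-\cos t}{\sqrt{c^2-\cos^2t}},\qquad g_{\rm n}(t)=-\int_0^t\frac{\sin^2x\,dx}{\sqrt{\sin^2x+b^2}}+\sin t\,\sqrt{\frac{c-\cos t}{c+\cos t}} .$$ **Delaunay tori.** Given $c>1$, one looks for $a>y>0$ such that the two arcs fit together, i.e. their minima and their extrinsic lengths agree: $$a-y=c-1,\qquad g_{\rm u}(2\pi)-g_{\rm u}(0)=g_{\rm n}(0)-g_{\rm n}(2\pi).$$ The Delaunay torus $\mathbb T_{\mathrm D,c}$ is then the surface of revolution $X(t,\theta)=(f(t)\cos\theta,f(t)\sin\theta,g(t))$ whose closed profile curve $(f,g)$ is the unduloid arc $(f_{\rm u},g_{\rm u})$ followed by the nodoid arc $(f_{\rm n},g_{\rm u}(2\pi)+g_{\rm n})$, the latter run through with a constant factor in the parameter so that the speeds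 agree at the two patching points. **Theorem.** There is $c_0>1$ such that for every $1<c<c_0$ there is exactly one such pair $a=a(c)$, $y=y(c)$, and $\mathbb T_{\mathrm D,c}$ is an embedded $C^{1,1}$ torus, with constant mean curvature $H=\frac1{2a}>0$ on the open unduloid part and $H=-\frac12<0$ on the open nodoid part. Moreover, there is $\delta>0$ with $1+\delta\le c_0$ such that $$\mathcal W(\mathbb T_{\mathrm D,c})<8\pi\qquad\text{whenever }1<c<1+\delta,$$ and $$\lim_{c\to1+}\operatorname{iso}(\mathbb T_{\mathrm D,c})=\infty .$$ -/

import Mathlib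

open Real Set Filter Topology MeasureTheory

noncomputable section

namespace DelaunayTori

/-- Euclidean 3-space. -/
abbrev E3 := EuclideanSpace ℝ (Fin 3)

/-! ### Geometry of parametrised surfaces `X(t, θ)` in Euclidean 3-space -/

/-- The cross product on Euclidean 3-space. -/
def cross (u v : E3) : E3 := WithLp.toLp 2 (crossProduct u.ofLp v.ofLp)

/-- The partial derivative with respect to the first parameter. -/
def partialFst (X : ℝ × ℝ → E3) (p : ℝ × ℝ) : E3 := deriv (fun s => X (s, p.2)) p.1

/-- The partial derivative with respect to the second parameter. -/
def partialSnd (X : ℝ × ℝ → E3) (p : ℝ × ℝ) : E3 := deriv (fun s => X (p.1, s)) p.2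

/-- The Gauss map `n = X_t × X_θ / |X_t × X_θ|`. -/
def gaussMap (X : ℝ × ℝ → E3) (p : ℝ × ℝ) : E3 :=
  ‖cross (partialFst X p) (partialSnd X p)‖⁻¹ • cross (partialFst X p) (partialSnd X p)

/-- First fundamental form, `E = X_t · X_t`. -/
def firstE (X : ℝ × ℝ → E3) (p : ℝ × ℝ) : ℝ := inner ℝ (partialFst X p) (partialFst X p)

/-- First fundamental form, `F = X_t · X_θ`. -/
def firstF (X : ℝ × ℝ → E3) (p : ℝ × ℝ) : ℝ := inner ℝ (partialFst X p) (partialSnd X p)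

/-- First fundamental form, `G = X_θ · X_θ`. -/
def firstG (X : ℝ × ℝ → E3) (p : ℝ × ℝ) : ℝ := inner ℝ (partialSnd X p) (partialSnd X p)

/-- Second fundamental form, `L = X_tt · n`. -/
def secondL (X : ℝ × ℝ → E3) (p : ℝ × ℝ) : ℝ :=
  inner ℝ (partialFst (partialFst X) p) (gaussMap X p)

/-- Second fundamental form, `M = X_tθ · n`. -/
def secondM (X : ℝ × ℝ → E3) (p : ℝ × ℝ) : ℝ :=
  inner ℝ (partialSnd (partialFst X) p) (gaussMap X p)

/-- Second fundamental form, `N = X_θθ · n`. -/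
def secondN (X : ℝ × ℝ → E3) (p : ℝ × ℝ) : ℝ :=
  inner ℝ (partialSnd (partialSnd X) p) (gaussMap X p)

/-- The density of the area measure of the pull-back metric. -/
def areaDensity (X : ℝ × ℝ → E3) (p : ℝ × ℝ) : ℝ :=
  √(firstE X p * firstG X p - firstF X p ^ 2)

/-- The mean curvature: the arithmetic mean of the two principal curvatures, that is, half the
trace of the second fundamental form with respect to the first. -/
def meanCurvature (X : ℝ × ℝ → E3) (p : ℝ × ℝ) : ℝ :=
  (firstE X p * secondN X p - 2 * firstF X p * secondM X p + firstG X p * secondL X p) /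
    (2 * (firstE X p * firstG X p - firstF X p ^ 2))

/-- A fundamental domain of the torus `ℝ² / (P ℤ × Q ℤ)`. -/
def fundDomain (P Q : ℝ) : Set (ℝ × ℝ) := Ioc 0 P ×ˢ Ioc 0 Q

/-- The integrand `H²` times the area density. -/
def willmoreDensity (X : ℝ × ℝ → E3) (p : ℝ × ℝ) : ℝ :=
  meanCurvature X p ^ 2 * areaDensity X p

/-- The Willmore energy `∫ H² dμ` of the torus given by the `(P, Q)`-periodic map `X`. -/
def willmore (X : ℝ × ℝ → E3) (P Q : ℝ) : ℝ :=
  ∫ p in fundDomain P Q, willmoreDensity X p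

/-- The area `∫ 1 dμ`. -/
def area (X : ℝ × ℝ → E3) (P Q : ℝ) : ℝ :=
  ∫ p in fundDomain P Q, areaDensity X p

/-- The enclosed volume `(1/3) ∫ n · X dμ`. -/
def enclosedVolume (X : ℝ × ℝ → E3) (P Q : ℝ) : ℝ :=
  1 / 3 * ∫ p in fundDomain P Q, inner ℝ (gaussMap X p) (X p) * areaDensity X p

/-- The isoperimetric ratio `area / vol ^ (2/3)`. -/
def isoRatio (X : ℝ × ℝ → E3) (P Q : ℝ) : ℝ :=
  area X P Q / enclosedVolume X P Q ^ (2 / 3 : ℝ)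

/-- `X` descends to a `C^{1,1}` embedding of the torus `ℝ² / (P ℤ × Q ℤ)` into Euclidean 3-space:
a doubly periodic immersion of class `C¹` with Lipschitz derivative that is injective modulo the
period lattice. -/
structure IsEmbeddedC11Torus (X : ℝ × ℝ → E3) (P Q : ℝ) : Prop where
  period_fst_pos : 0 < P
  period_snd_pos : 0 < Q
  periodic_fst : ∀ t θ : ℝ, X (t + P, θ) = X (t, θ)
  periodic_snd : ∀ t θ : ℝ, X (t, θ + Q) = X (t, θ)
  contDiff : ContDiff ℝ 1 X
  lipschitz : ∃ K : NNReal, LipschitzWith K (fderiv ℝ X)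
  immersion : ∀ p, Function.Injective (fderiv ℝ X p)
  injective : ∀ p q, X p = X q → ∃ m n : ℤ, q = (p.1 + m * P, p.2 + n * Q)

/-- The surface of revolution (around the third axis) with profile curve `(f, g)`. -/
def revolution (f g : ℝ → ℝ) (p : ℝ × ℝ) : E3 :=
  !₂[f p.1 * cos p.2, f p.1 * sin p.2, g p.1]

/-! ### Unduloids and nodoids -/

/-- Distance to the axis for the unduloid, the roulette of a focus of the ellipse with width `2a`,
foci `± c` and height `2b`, `b = √(a² - c²)` (for `0 < c < a`). It is `2π`-periodic, with its
minimum `a - c` at `0` and its maximum `a + c` at `π`. -/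
def unduloidF (a c t : ℝ) : ℝ :=
  √(a ^ 2 - c ^ 2) * (a - c * cos t) / √(a ^ 2 - c ^ 2 * cos t ^ 2)

/-- Coordinate along the axis for the unduloid. -/
def unduloidG (a c t : ℝ) : ℝ :=
  (∫ x in (0 : ℝ)..t, √(a ^ 2 - c ^ 2 * cos x ^ 2)) -
    c * sin t * (a - c * cos t) / √(a ^ 2 - c ^ 2 * cos t ^ 2)

/-- Distance to the axis for the nodoid, the patched roulettes of the two foci of the hyperbola
`x²/a² - y²/b² = 1` with foci `± c`, `b = √(c² - a²)` (for `0 < a < c`). It is `2π`-periodic, with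
its minimum `c - a` at `0` and its maximum `c + a` at `π`. The roulette of the focus `c` is the part
`-π/2 < t < π/2` and (up to translation along the axis) the reflected roulette of the focus `-c` is
the part `π/2 < t < 3π/2`; the roulettes are usually written in the parameter `s` with
`sinh s = tan t`, respectively `sinh s = tan (t - π)`. -/
def nodoidF (a c t : ℝ) : ℝ :=
  √(c ^ 2 - a ^ 2) * (c - a * cos t) / √(c ^ 2 - a ^ 2 * cos t ^ 2)

/-- Coordinate along the axis for the nodoid. -/
def nodoidG (a c t : ℝ) : ℝ :=
  -a * (∫ x in (0 : ℝ)..t, sin x ^ 2 / √(sin x ^ 2 + (c ^ 2 - a ^ 2) / a ^ 2)) +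
    a * sin t * √((c - a * cos t) / (c + a * cos t))

/-! ### Delaunay tori -/

/-- One period of the unduloid with parameters `0 < y < a`, from minimum to minimum, fits into one
period of the nodoid with parameters `1 < c`, from minimum to minimum: after a translation along the
axis, the starting point of the nodoid arc is the end point of the unduloid arc and vice versa. -/
structure Fits (c a y : ℝ) : Prop where
  y_pos : 0 < y
  y_lt : y < a
  match_left : unduloidF a y 0 = nodoidF 1 c (2 * π)
  match_right : unduloidF a y (2 * π) = nodoidF 1 c 0
  length_eq : unduloidG a y (2 * π) - unduloidG a y 0 = nodoidG 1 c 0 - nodoidG 1 c (2 * π)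

/-- The constant factor by which the nodoid has to be run through faster, so that at the patching
points (where the speeds are `a √((a - y)/(a + y))` and `√((c - 1)/(c + 1))`, with
`a - y = c - 1`) its speed agrees with that of the unduloid. -/
def speedFactor (c a y : ℝ) : ℝ := a * √((c + 1) / (a + y))

/-- The period of the closed profile curve: `2π` for the unduloid arc, `2π / speedFactor` for the
nodoid arc. -/
def period (c a y : ℝ) : ℝ := 2 * π + 2 * π / speedFactor c a y

/-- The representative modulo the period in the interval from `0` to the period. -/
def baseParam (c a y t : ℝ) : ℝ := period c a y * Int.fract (t / period c a y)

/-- Distance to the axis for the profile curve of the Delaunay torus: first one period of the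
unduloid, then one period of the nodoid, repeated periodically. -/
def profileF (c a y t : ℝ) : ℝ :=
  if baseParam c a y t ≤ 2 * π then unduloidF a y (baseParam c a y t)
  else nodoidF 1 c (speedFactor c a y * (baseParam c a y t - 2 * π))

/-- Coordinate along the axis for the profile curve of the Delaunay torus; the nodoid is translated
so that it starts where the unduloid ends. -/
def profileG (c a y t : ℝ) : ℝ :=
  if baseParam c a y t ≤ 2 * π then unduloidG a y (baseParam c a y t)
  else unduloidG a y (2 * π) + nodoidG 1 c (speedFactor c a y * (baseParam c a y t - 2 * π))

/-- The Delaunay torus patched from the nodoid with parameters `1 < c` and the unduloid with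
parameters `y < a`, as a doubly periodic map, with periods `period c a y` and `2π`. -/
def torus (c a y : ℝ) : ℝ × ℝ → E3 := revolution (profileF c a y) (profileG c a y)

end DelaunayTori

end

noncomputable section

namespace DelaunayTori

/-! ### Calculus of the Delaunay profile curves -/

/-! Write e = c - 1 and l = -log e. Both arcs obey one radius law (`unduloidF_sq`), with parameters
(a, y) for the unduloid and (c, 1) for the nodoid (`nodoidF_one`), and the two components of each
velocity share the factor `tangentScale`. The constant mean curvatures then follow from an explicit
computation. The matching of values and first derivatives at the seams gives class C^{1,1}.

Fitting: since a = y + e, one equation for y remains. The unduloid length is strictly increasing in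
y, so `exists_unduloidLength_eq` and `fits_unique` follow from the intermediate value theorem and
monotonicity. Elliptic-type integrals in this equation give the decisive logarithm 1 - y ≥ e (l - 4)
(`le_one_sub_y`), hence also a ≤ 1.

Embeddedness: each arc is injective by itself. The arcs meet only at their ends, because at equal
radius their slopes can be compared by means of the first integrals of the two curves
(`slope_compare`); this is where a ≤ 1 enters.

Energy: let σ be the angle growing at `angleRate`. Then the squared radius is (a - y)^2 + 4 a y
sin^2 (σ/2), and the area element is a constant multiple of the radius times dσ dθ. With R =
`radiusIntegral`, the Willmore energy is (π/2) (R(a, y)/a + R(c, 1)) (`willmore_torus`). Now R(a, y)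
≤ 4 (a + y) + (4/3) e^2 (l + 7), and likewise for (c, 1) (`radiusIntegral_le`). The main terms add
up to 16 - 4 e (1/a - 1), a gain of about 4 e^2 l over 16, while the two errors cost only about
(8/3) e^2 l. So the energy is below 8π once l is large.

Isoperimetric ratio: the area stays above 1. The volume is a difference of nearly equal cubic
integrals, positive by the same logarithm (`enclosedVolume_torus_pos`) and tending to 0 since y
tends to 1 (`enclosedVolume_torus_le`). -/

/-- The common factor of the two components of the velocity of the Delaunay profile curves. -/
def tangentScale (a y t : ℝ) : ℝ :=
  (a ^ 2 - y ^ 2) / ((a + y * cos t) ^ 2 * unduloidF a y t)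

section

variable {a y : ℝ}

lemma add_mul_cos_pos (hy : 0 < y) (hya : y < a) (t : ℝ) : 0 < a + y * cos t := by
  nlinarith [neg_one_le_cos t]

lemma sub_mul_cos_pos (hy : 0 < y) (hya : y < a) (t : ℝ) : 0 < a - y * cos t := by
  nlinarith [cos_le_one t]

lemma sq_sub_sq_pos (hy : 0 < y) (hya : y < a) : 0 < a ^ 2 - y ^ 2 := by nlinarith

lemma sq_sub_mul_cos_sq_pos (hy : 0 < y) (hya : y < a) (t : ℝ) :
    0 < a ^ 2 - y ^ 2 * cos t ^ 2 := by
  have := mul_pos (add_mul_cos_pos hy hya t) (sub_mul_cos_pos hy hya t)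
  nlinarith

lemma unduloidF_pos (hy : 0 < y) (hya : y < a) (t : ℝ) : 0 < unduloidF a y t := by
  have h1 := sqrt_pos.2 (sq_sub_sq_pos hy hya)
  have h2 := sqrt_pos.2 (sq_sub_mul_cos_sq_pos hy hya t)
  have h3 := sub_mul_cos_pos hy hya t
  unfold unduloidF
  positivity

/-- The factor a - y cos t cancels against the radicand of the denominator, leaving a rational
function of cos t. Nearly all later algebra rests on this form. -/
lemma unduloidF_sq (hy : 0 < y) (hya : y < a) (t : ℝ) :
    unduloidF a y t ^ 2 = (a ^ 2 - y ^ 2) * (a - y * cos t) / (a + y * cos t) := by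
  have h1 := sq_sub_sq_pos hy hya
  have h2 := sq_sub_mul_cos_sq_pos hy hya t
  have h3 := add_mul_cos_pos hy hya t
  unfold unduloidF
  rw [div_pow, mul_pow, sq_sqrt h1.le, sq_sqrt h2.le, div_eq_div_iff h2.ne' h3.ne']
  ring

lemma unduloidF_eq_sqrt (hy : 0 < y) (hya : y < a) (t : ℝ) :
    unduloidF a y t = √((a ^ 2 - y ^ 2) * (a - y * cos t) / (a + y * cos t)) := by
  rw [← unduloidF_sq hy hya, sqrt_sq (unduloidF_pos hy hya t).le]

lemma tangentScale_pos (hy : 0 < y) (hya : y < a) (t : ℝ) : 0 < tangentScale a y t := by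
  have h1 := sq_sub_sq_pos hy hya
  have h2 := add_mul_cos_pos hy hya t
  have h3 := unduloidF_pos hy hya t
  unfold tangentScale
  positivity

lemma sqrt_sq_sub_mul_cos_sq (hy : 0 < y) (hya : y < a) (t : ℝ) :
    √(a ^ 2 - y ^ 2 * cos t ^ 2) = (a + y * cos t) * unduloidF a y t / √(a ^ 2 - y ^ 2) := by
  have h1 := sqrt_pos.2 (sq_sub_sq_pos hy hya)
  have h2 := sqrt_pos.2 (sq_sub_mul_cos_sq_pos hy hya t)
  have h4 := sq_sqrt (sq_sub_mul_cos_sq_pos hy hya t).le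
  unfold unduloidF
  field_simp
  rw [h4]
  ring

lemma hasDerivAt_unduloidF (hy : 0 < y) (hya : y < a) (t : ℝ) :
    HasDerivAt (unduloidF a y) (a * y * sin t * tangentScale a y t) t := by
  have h1 := sq_sub_sq_pos hy hya
  have h2 := add_mul_cos_pos hy hya t
  have h3 := sub_mul_cos_pos hy hya t
  have h4 := unduloidF_pos hy hya t
  have hF := unduloidF_eq_sqrt hy hya
  have hn : HasDerivAt (fun t => (a ^ 2 - y ^ 2) * (a - y * cos t))
      ((a ^ 2 - y ^ 2) * (y * sin t)) t := by
    have := (((hasDerivAt_cos t).const_mul y).const_sub a).const_mul (a ^ 2 - y ^ 2)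
    exact this.congr_deriv (by ring)
  have hd : HasDerivAt (fun t => a + y * cos t) (-(y * sin t)) t := by
    have := ((hasDerivAt_cos t).const_mul y).const_add a
    exact this.congr_deriv (by ring)
  have := (hn.div hd h2.ne').sqrt (by simp only [Pi.div_apply]; positivity)
  have hfun : unduloidF a y = fun t => √((a ^ 2 - y ^ 2) * (a - y * cos t) / (a + y * cos t)) :=
    funext hF
  rw [hfun]
  refine this.congr_deriv ?_
  simp only [Pi.div_apply]
  rw [← hF, tangentScale]
  field_simp
  ring

lemma continuous_unduloidF (hy : 0 < y) (hya : y < a) : Continuous (unduloidF a y) :=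
  continuous_iff_continuousAt.2 fun t => (hasDerivAt_unduloidF hy hya t).continuousAt

lemma contDiff_unduloidF (hy : 0 < y) (hya : y < a) {n : WithTop ℕ∞} :
    ContDiff ℝ n (unduloidF a y) := by
  unfold unduloidF
  refine ContDiff.div (by fun_prop) (ContDiff.sqrt (by fun_prop) ?_) ?_
  · exact fun t => (sq_sub_mul_cos_sq_pos hy hya t).ne'
  · exact fun t => (sqrt_pos.2 (sq_sub_mul_cos_sq_pos hy hya t)).ne'

lemma contDiff_tangentScale (hy : 0 < y) (hya : y < a) {n : WithTop ℕ∞} :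
    ContDiff ℝ n (tangentScale a y) := by
  unfold tangentScale
  refine ContDiff.div contDiff_const (ContDiff.mul (by fun_prop) (contDiff_unduloidF hy hya)) ?_
  intro t
  have h2 := add_mul_cos_pos hy hya t
  have h3 := unduloidF_pos hy hya t
  positivity

/-- Expressing the oscillating term through the radius lets its derivative come from
`hasDerivAt_unduloidF`. -/
lemma unduloidG_eq (hy : 0 < y) (hya : y < a) (t : ℝ) :
    unduloidG a y t = (∫ x in (0 : ℝ)..t, √(a ^ 2 - y ^ 2 * cos x ^ 2)) -
      y / √(a ^ 2 - y ^ 2) * (sin t * unduloidF a y t) := by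
  have h1 := sqrt_pos.2 (sq_sub_sq_pos hy hya)
  unfold unduloidG unduloidF
  field_simp

/-- By the radius law the integrand and the oscillating term combine so that only a positive
constant multiplies `tangentScale`; in particular the unduloid is a graph over the axis. -/
lemma hasDerivAt_unduloidG (hy : 0 < y) (hya : y < a) (t : ℝ) :
    HasDerivAt (unduloidG a y) (a * √(a ^ 2 - y ^ 2) * tangentScale a y t) t := by
  have h1 := sqrt_pos.2 (sq_sub_sq_pos hy hya)
  have h2 := add_mul_cos_pos hy hya t
  have h4 := unduloidF_pos hy hya t
  have hsq := sq_sqrt (sq_sub_sq_pos hy hya).le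
  have hF := unduloidF_sq hy hya t
  have hcont : Continuous fun x : ℝ => √(a ^ 2 - y ^ 2 * cos x ^ 2) := by fun_prop
  have hI := (hcont.integral_hasStrictDerivAt 0 t).hasDerivAt
  have hS := ((hasDerivAt_sin t).mul (hasDerivAt_unduloidF hy hya t)).const_mul
    (y / √(a ^ 2 - y ^ 2))
  rw [show unduloidG a y = _ from funext (unduloidG_eq hy hya)]
  refine (hI.sub hS).congr_deriv ?_
  rw [sqrt_sq_sub_mul_cos_sq hy hya, tangentScale]
  rw [eq_div_iff h2.ne'] at hF
  set b := √(a ^ 2 - y ^ 2)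
  set F := unduloidF a y t
  rw [← hsq] at hF ⊢
  have hsc := sin_sq_add_cos_sq t
  field_simp
  have : b ^ 2 = a ^ 2 - y ^ 2 := hsq
  linear_combination ((a + y * cos t) * a) * hF - (a * b ^ 2) * this - (a * b ^ 2 * y ^ 2) * hsc

end

/-! ### The nodoid arc in the notation of the unduloid. -/

lemma nodoidF_one (c t : ℝ) : nodoidF 1 c t = unduloidF c 1 t := by
  simp [nodoidF, unduloidF]

lemma nodoidG_eq {c : ℝ} (hc : 1 < c) (t : ℝ) :
    nodoidG 1 c t = -(∫ x in (0 : ℝ)..t, sin x ^ 2 / √(c ^ 2 - 1 ^ 2 * cos x ^ 2)) +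
      1 / √(c ^ 2 - 1 ^ 2) * (sin t * unduloidF c 1 t) := by
  have h1 := sqrt_pos.2 (sq_sub_sq_pos one_pos hc)
  have h2 := add_mul_cos_pos one_pos hc t
  have h3 := sub_mul_cos_pos one_pos hc t
  have e1 : ∀ x, sin x ^ 2 + (c ^ 2 - 1 ^ 2) / 1 ^ 2 = c ^ 2 - 1 ^ 2 * cos x ^ 2 := by
    intro x; rw [sin_sq]; ring
  have e2 : √((c - 1 * cos t) / (c + 1 * cos t)) = 1 / √(c ^ 2 - 1 ^ 2) * unduloidF c 1 t := by
    rw [unduloidF_eq_sqrt one_pos hc, mul_div_assoc, sqrt_mul (sq_sub_sq_pos one_pos hc).le,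
      ← mul_assoc, one_div_mul_cancel h1.ne']
    simp only [one_mul]
  unfold nodoidG
  simp only [e1, e2]
  ring

/-- The mechanism is that of `hasDerivAt_unduloidG`, but here a factor cos t survives: the nodoid
turns back along the axis at π/2 and 3π/2. -/
lemma hasDerivAt_nodoidG {c : ℝ} (hc : 1 < c) (t : ℝ) :
    HasDerivAt (nodoidG 1 c) (√(c ^ 2 - 1 ^ 2) * cos t * tangentScale c 1 t) t := by
  have h1 := sqrt_pos.2 (sq_sub_sq_pos one_pos hc)
  have h2 := add_mul_cos_pos one_pos hc t
  have h4 := unduloidF_pos one_pos hc t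
  have hsq := sq_sqrt (sq_sub_sq_pos one_pos hc).le
  have hF := unduloidF_sq one_pos hc t
  have hcont : Continuous fun x : ℝ => sin x ^ 2 / √(c ^ 2 - 1 ^ 2 * cos x ^ 2) :=
    Continuous.div (by fun_prop) (by fun_prop)
      fun x => (sqrt_pos.2 (sq_sub_mul_cos_sq_pos one_pos hc x)).ne'
  have hI := (hcont.integral_hasStrictDerivAt 0 t).hasDerivAt
  have hS := ((hasDerivAt_sin t).mul (hasDerivAt_unduloidF one_pos hc t)).const_mul
    (1 / √(c ^ 2 - 1 ^ 2))
  rw [show nodoidG 1 c = _ from funext (nodoidG_eq hc)]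
  refine (hI.neg.add hS).congr_deriv ?_
  rw [sqrt_sq_sub_mul_cos_sq one_pos hc, tangentScale]
  rw [eq_div_iff h2.ne'] at hF
  set b := √(c ^ 2 - 1 ^ 2)
  set F := unduloidF c 1 t
  rw [← hsq] at hF ⊢
  have hsc := sin_sq_add_cos_sq t
  have this : b ^ 2 = c ^ 2 - 1 ^ 2 := hsq
  obtain ⟨w, hw⟩ : ∃ w, w = c + 1 * cos t := ⟨_, rfl⟩
  rw [← hw] at h2 hF ⊢
  field_simp
  rw [hw] at hF ⊢
  linear_combination ((c + 1 * cos t) * cos t) * hF - (cos t * b ^ 2) * this -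
    (cos t * b ^ 2) * hsc

/-! ### Periodic patching of two arcs -/

/-- The function of period `A + B` given by `u` on `[0, A]` and by `v (· - A)` on `(A, A + B)`. -/
def patch (A B : ℝ) (u v : ℝ → ℝ) (t : ℝ) : ℝ :=
  if (A + B) * Int.fract (t / (A + B)) ≤ A then u ((A + B) * Int.fract (t / (A + B)))
  else v ((A + B) * Int.fract (t / (A + B)) - A)

section

variable {A B : ℝ} {u v : ℝ → ℝ}

lemma mul_fract_div {P : ℝ} (hP : 0 < P) {x : ℝ} {n : ℤ} (hx : x - n * P ∈ Ico 0 P) :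
    P * Int.fract (x / P) = x - n * P := by
  have : Int.fract (x / P) = (x - n * P) / P := by
    rw [Int.fract_eq_iff]
    refine ⟨div_nonneg hx.1 hP.le, (div_lt_one hP).2 hx.2, n, ?_⟩
    field_simp
    ring
  rw [this]
  field_simp

lemma patch_add_period (hA : 0 < A) (hB : 0 < B) (t : ℝ) :
    patch A B u v (t + (A + B)) = patch A B u v t := by
  have : (t + (A + B)) / (A + B) = t / (A + B) + 1 := by field_simp
  simp only [patch, this, Int.fract_add_one]

lemma patch_eq_fst (hA : 0 < A) (hB : 0 < B) {x : ℝ} (n : ℤ) (hx : x - n * (A + B) ∈ Icc 0 A) :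
    patch A B u v x = u (x - n * (A + B)) := by
  have := mul_fract_div (add_pos hA hB) (x := x) (n := n) ⟨hx.1, by linarith [hx.2]⟩
  simp only [patch, this, if_pos hx.2]

/-- At both seams the definition evaluates `u`; the two matching conditions are what extend the
formula for `v` to the closed interval. -/
lemma patch_eq_snd (hA : 0 < A) (hB : 0 < B) (h₁ : u A = v 0) (h₂ : v B = u 0) {x : ℝ} (n : ℤ)
    (hx : x - (n * (A + B) + A) ∈ Icc 0 B) :
    patch A B u v x = v (x - (n * (A + B) + A)) := by
  rcases hx.2.lt_or_eq with h | h
  · have := mul_fract_div (add_pos hA hB) (x := x) (n := n)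
      ⟨by linarith [hx.1], by linarith⟩
    rcases hx.1.lt_or_eq with h' | h'
    · simp only [patch, this]
      rw [if_neg (by linarith)]
      congr 1
      ring
    · have e : x - n * (A + B) = A := by linarith
      simp only [patch, this, e, le_refl, if_true, h₁]
      rw [← h']
  · have e : x - ((n + 1 : ℤ) : ℝ) * (A + B) = 0 := by push_cast; linarith
    rw [patch_eq_fst hA hB (n + 1) (by rw [e]; exact ⟨le_rfl, hA.le⟩), e, h, h₂]

/-- Left-closed pieces leave room to the right of every point, as right derivatives require; the
`Ioc` variant serves left derivatives. -/
lemma exists_mem_patch_Ico (hA : 0 < A) (hB : 0 < B) (t : ℝ) :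
    ∃ n : ℤ, t - n * (A + B) ∈ Ico 0 A ∨ t - (n * (A + B) + A) ∈ Ico 0 B := by
  have hP := add_pos hA hB
  have h1 := Int.floor_le (t / (A + B))
  have h2 := Int.lt_floor_add_one (t / (A + B))
  rw [le_div_iff₀ hP] at h1
  rw [div_lt_iff₀ hP] at h2
  refine ⟨⌊t / (A + B)⌋, ?_⟩
  rcases lt_or_ge (t - ⌊t / (A + B)⌋ * (A + B)) A with h | h
  · exact Or.inl ⟨by linarith, h⟩
  · exact Or.inr ⟨by linarith, by linarith⟩

lemma exists_mem_patch_Ioc (hA : 0 < A) (hB : 0 < B) (t : ℝ) :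
    ∃ n : ℤ, t - n * (A + B) ∈ Ioc 0 A ∨ t - (n * (A + B) + A) ∈ Ioc 0 B := by
  have hP := add_pos hA hB
  have h1 := Int.le_ceil (t / (A + B))
  have h2 := Int.ceil_lt_add_one (t / (A + B))
  rw [div_le_iff₀ hP] at h1
  rw [← sub_lt_iff_lt_add, lt_div_iff₀ hP] at h2
  refine ⟨⌈t / (A + B)⌉ - 1, ?_⟩
  push_cast
  rcases le_or_gt (t - (⌈t / (A + B)⌉ - 1) * (A + B)) A with h | h
  · exact Or.inl ⟨by linarith, h⟩
  · exact Or.inr ⟨by linarith, by linarith⟩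

lemma hasDerivWithinAt_Ici_patch (hA : 0 < A) (hB : 0 < B) (h₁ : u A = v 0) (h₂ : v B = u 0)
    {u' v' : ℝ → ℝ} (hu : ∀ t, HasDerivAt u (u' t) t) (hv : ∀ t, HasDerivAt v (v' t) t)
    (t : ℝ) : ∃ n : ℤ,
      (t - n * (A + B) ∈ Ico 0 A ∧
        HasDerivWithinAt (patch A B u v) (u' (t - n * (A + B))) (Ici t) t) ∨
      (t - (n * (A + B) + A) ∈ Ico 0 B ∧
        HasDerivWithinAt (patch A B u v) (v' (t - (n * (A + B) + A))) (Ici t) t) := by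
  obtain ⟨n, hn | hn⟩ := exists_mem_patch_Ico hA hB t
  · refine ⟨n, Or.inl ⟨hn, ?_⟩⟩
    refine ((hu _).comp_sub_const t _).hasDerivWithinAt.congr_of_eventuallyEq_of_mem ?_
      self_mem_Ici
    filter_upwards [Icc_mem_nhdsGE (show t < n * (A + B) + A by linarith [hn.2])] with x hx
    exact patch_eq_fst hA hB n ⟨by linarith [hx.1, hn.1], by linarith [hx.2]⟩
  · refine ⟨n, Or.inr ⟨hn, ?_⟩⟩
    refine ((hv _).comp_sub_const t _).hasDerivWithinAt.congr_of_eventuallyEq_of_mem ?_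
      self_mem_Ici
    filter_upwards [Icc_mem_nhdsGE (show t < n * (A + B) + A + B by linarith [hn.2])] with x hx
    exact patch_eq_snd hA hB h₁ h₂ n ⟨by linarith [hx.1, hn.1], by linarith [hx.2]⟩

lemma hasDerivWithinAt_Iic_patch (hA : 0 < A) (hB : 0 < B) (h₁ : u A = v 0) (h₂ : v B = u 0)
    {u' v' : ℝ → ℝ} (hu : ∀ t, HasDerivAt u (u' t) t) (hv : ∀ t, HasDerivAt v (v' t) t)
    (t : ℝ) : ∃ n : ℤ,
      (t - n * (A + B) ∈ Ioc 0 A ∧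
        HasDerivWithinAt (patch A B u v) (u' (t - n * (A + B))) (Iic t) t) ∨
      (t - (n * (A + B) + A) ∈ Ioc 0 B ∧
        HasDerivWithinAt (patch A B u v) (v' (t - (n * (A + B) + A))) (Iic t) t) := by
  obtain ⟨n, hn | hn⟩ := exists_mem_patch_Ioc hA hB t
  · refine ⟨n, Or.inl ⟨hn, ?_⟩⟩
    refine ((hu _).comp_sub_const t _).hasDerivWithinAt.congr_of_eventuallyEq_of_mem ?_
      self_mem_Iic
    filter_upwards [Icc_mem_nhdsLE (show n * (A + B) < t by linarith [hn.1])] with x hx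
    exact patch_eq_fst hA hB n ⟨by linarith [hx.1], by linarith [hx.2, hn.2]⟩
  · refine ⟨n, Or.inr ⟨hn, ?_⟩⟩
    refine ((hv _).comp_sub_const t _).hasDerivWithinAt.congr_of_eventuallyEq_of_mem ?_
      self_mem_Iic
    filter_upwards [Icc_mem_nhdsLE (show n * (A + B) + A < t by linarith [hn.1])] with x hx
    exact patch_eq_snd hA hB h₁ h₂ n ⟨by linarith [hx.1], by linarith [hx.2, hn.2]⟩

/-- At a seam the left and right derivatives come from different arcs; since the derivatives match
as well, both equal the patched derivative. -/
lemma hasDerivAt_patch (hA : 0 < A) (hB : 0 < B) (h₁ : u A = v 0) (h₂ : v B = u 0)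
    {u' v' : ℝ → ℝ} (hu : ∀ t, HasDerivAt u (u' t) t) (hv : ∀ t, HasDerivAt v (v' t) t)
    (h₁' : u' A = v' 0) (h₂' : v' B = u' 0) (t : ℝ) :
    HasDerivAt (patch A B u v) (patch A B u' v' t) t := by
  have hr : HasDerivWithinAt (patch A B u v) (patch A B u' v' t) (Ici t) t := by
    obtain ⟨n, ⟨hn, h⟩ | ⟨hn, h⟩⟩ := hasDerivWithinAt_Ici_patch hA hB h₁ h₂ hu hv t
    · rwa [patch_eq_fst hA hB n (Ico_subset_Icc_self hn)]
    · rwa [patch_eq_snd hA hB h₁' h₂' n (Ico_subset_Icc_self hn)]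
  have hl : HasDerivWithinAt (patch A B u v) (patch A B u' v' t) (Iic t) t := by
    obtain ⟨n, ⟨hn, h⟩ | ⟨hn, h⟩⟩ := hasDerivWithinAt_Iic_patch hA hB h₁ h₂ hu hv t
    · rwa [patch_eq_fst hA hB n (Ioc_subset_Icc_self hn)]
    · rwa [patch_eq_snd hA hB h₁' h₂' n (Ioc_subset_Icc_self hn)]
  have := hl.union hr
  rwa [Iic_union_Ici, hasDerivWithinAt_univ] at this

lemma continuous_patch (hA : 0 < A) (hB : 0 < B) (h₁ : u A = v 0) (h₂ : v B = u 0)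
    {u' v' : ℝ → ℝ} (hu : ∀ t, HasDerivAt u (u' t) t) (hv : ∀ t, HasDerivAt v (v' t) t) :
    Continuous (patch A B u v) := by
  refine continuous_iff_continuousAt.2 fun t => ?_
  have hr : ContinuousWithinAt (patch A B u v) (Ici t) t := by
    obtain ⟨n, ⟨hn, h⟩ | ⟨hn, h⟩⟩ := hasDerivWithinAt_Ici_patch hA hB h₁ h₂ hu hv t <;>
    exact h.continuousWithinAt
  have hl : ContinuousWithinAt (patch A B u v) (Iic t) t := by
    obtain ⟨n, ⟨hn, h⟩ | ⟨hn, h⟩⟩ := hasDerivWithinAt_Iic_patch hA hB h₁ h₂ hu hv t <;>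
    exact h.continuousWithinAt
  have := hl.union hr
  rwa [Iic_union_Ici, continuousWithinAt_univ] at this

lemma exists_abs_patch_le (hA : 0 < A) (hB : 0 < B) (h₁ : u A = v 0) (h₂ : v B = u 0)
    (hu : Continuous u) (hv : Continuous v) : ∃ K, 0 ≤ K ∧ ∀ t, |patch A B u v t| ≤ K := by
  obtain ⟨K₁, hK₁⟩ := (isCompact_Icc (a := 0) (b := A)).exists_bound_of_continuousOn hu.continuousOn
  obtain ⟨K₂, hK₂⟩ := (isCompact_Icc (a := 0) (b := B)).exists_bound_of_continuousOn hv.continuousOn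
  refine ⟨max K₁ K₂, le_max_of_le_left ((norm_nonneg _).trans (hK₁ 0 ⟨le_rfl, hA.le⟩)),
    fun t => ?_⟩
  obtain ⟨n, hn | hn⟩ := exists_mem_patch_Ico hA hB t
  · rw [patch_eq_fst hA hB n (Ico_subset_Icc_self hn)]
    exact (hK₁ _ (Ico_subset_Icc_self hn)).trans (le_max_left _ _)
  · rw [patch_eq_snd hA hB h₁ h₂ n (Ico_subset_Icc_self hn)]
    exact (hK₂ _ (Ico_subset_Icc_self hn)).trans (le_max_right _ _)

/-- Continuity and a bounded right derivative suffice for the mean value inequality, so `u'` and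
`v'` may disagree at the seams. Applied to the velocity of the profile, this tolerates the jump of
the second derivative. -/
lemma exists_lipschitzWith_patch (hA : 0 < A) (hB : 0 < B) (h₁ : u A = v 0) (h₂ : v B = u 0)
    {u' v' : ℝ → ℝ} (hu : ∀ t, HasDerivAt u (u' t) t) (hv : ∀ t, HasDerivAt v (v' t) t)
    (hu' : Continuous u') (hv' : Continuous v') : ∃ K, LipschitzWith K (patch A B u v) := by
  obtain ⟨K₁, hK₁⟩ :=
    (isCompact_Icc (a := 0) (b := A)).exists_bound_of_continuousOn hu'.continuousOn
  obtain ⟨K₂, hK₂⟩ :=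
    (isCompact_Icc (a := 0) (b := B)).exists_bound_of_continuousOn hv'.continuousOn
  have key : ∀ t, ∃ d, HasDerivWithinAt (patch A B u v) d (Ici t) t ∧ ‖d‖ ≤ max K₁ K₂ := by
    intro t
    obtain ⟨n, ⟨hn, h⟩ | ⟨hn, h⟩⟩ := hasDerivWithinAt_Ici_patch hA hB h₁ h₂ hu hv t
    · exact ⟨_, h, (hK₁ _ (Ico_subset_Icc_self hn)).trans (le_max_left _ _)⟩
    · exact ⟨_, h, (hK₂ _ (Ico_subset_Icc_self hn)).trans (le_max_right _ _)⟩
  choose d hd hdK using key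
  have hcont := continuous_patch hA hB h₁ h₂ hu hv
  have hle : ∀ x y, x ≤ y → dist (patch A B u v x) (patch A B u v y) ≤ max K₁ K₂ * dist x y := by
    intro x y hxy
    have := norm_image_sub_le_of_norm_deriv_right_le_segment hcont.continuousOn
      (fun z _ => hd z) (fun z _ => hdK z) y ⟨hxy, le_rfl⟩
    rw [dist_comm, dist_comm x y, dist_eq_norm, Real.dist_eq, abs_of_nonneg (sub_nonneg.2 hxy)]
    exact this
  refine ⟨Real.toNNReal (max K₁ K₂), LipschitzWith.of_dist_le' fun x y => ?_⟩
  rcases le_total x y with h | h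
  · exact hle x y h
  · rw [dist_comm, dist_comm x y]
    exact hle y x h

end

/-! ### Surfaces of revolution -/

lemma hasDerivAt_vec3 {x y z : ℝ → ℝ} {x' y' z' t : ℝ} (hx : HasDerivAt x x' t)
    (hy : HasDerivAt y y' t) (hz : HasDerivAt z z' t) :
    HasDerivAt (fun s => (!₂[x s, y s, z s] : E3)) !₂[x', y', z'] t := by
  have h : HasDerivAt (fun s => ![x s, y s, z s]) ![x', y', z'] t := by
    rw [hasDerivAt_pi]
    intro i
    fin_cases i <;> simpa
  exact (PiLp.continuousLinearEquiv 2 ℝ (fun _ : Fin 3 => ℝ)).symm.hasFDerivAt.comp_hasDerivAt t h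

lemma inner_vec3 (x y z x' y' z' : ℝ) :
    inner ℝ (!₂[x, y, z] : E3) !₂[x', y', z'] = x * x' + y * y' + z * z' := by
  simp [PiLp.inner_apply, Fin.sum_univ_three, mul_comm]

lemma cross_vec3 (x y z x' y' z' : ℝ) :
    cross (!₂[x, y, z] : E3) !₂[x', y', z'] =
      !₂[y * z' - z * y', z * x' - x * z', x * y' - y * x'] := by
  simp [cross, cross_apply]

lemma norm_vec3 (x y z : ℝ) : ‖(!₂[x, y, z] : E3)‖ = √(x ^ 2 + y ^ 2 + z ^ 2) := by
  simp [EuclideanSpace.norm_eq, Fin.sum_univ_three]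

section

variable {f g : ℝ → ℝ} {f' g' t : ℝ}

lemma partialFst_revolution (hf : HasDerivAt f f' t) (hg : HasDerivAt g g' t) (θ : ℝ) :
    partialFst (revolution f g) (t, θ) = !₂[f' * cos θ, f' * sin θ, g'] :=
  (hasDerivAt_vec3 (hf.mul_const (cos θ)) (hf.mul_const (sin θ)) hg).deriv

lemma partialSnd_revolution (f g : ℝ → ℝ) (t θ : ℝ) :
    partialSnd (revolution f g) (t, θ) = !₂[-(f t * sin θ), f t * cos θ, 0] := by
  refine (hasDerivAt_vec3 (((hasDerivAt_cos θ).const_mul (f t)).congr_deriv ?_)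
    ((hasDerivAt_sin θ).const_mul (f t)) (hasDerivAt_const θ (g t))).deriv
  ring

lemma cross_revolution (hf : HasDerivAt f f' t) (hg : HasDerivAt g g' t) (θ : ℝ) :
    cross (partialFst (revolution f g) (t, θ)) (partialSnd (revolution f g) (t, θ)) =
      !₂[-(f t * g' * cos θ), -(f t * g' * sin θ), f t * f'] := by
  rw [partialFst_revolution hf hg, partialSnd_revolution, cross_vec3]
  have h : f' * cos θ * (f t * cos θ) - f' * sin θ * -(f t * sin θ) = f t * f' := by
    linear_combination f t * f' * sin_sq_add_cos_sq θ
  rw [h]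
  congr 2
  · ring
  · congr 1
    ring

lemma norm_cross_revolution (hf : HasDerivAt f f' t) (hg : HasDerivAt g g' t) (hft : 0 ≤ f t)
    (θ : ℝ) :
    ‖cross (partialFst (revolution f g) (t, θ)) (partialSnd (revolution f g) (t, θ))‖ =
      f t * √(f' ^ 2 + g' ^ 2) := by
  rw [cross_revolution hf hg, norm_vec3]
  have h : (-(f t * g' * cos θ)) ^ 2 + (-(f t * g' * sin θ)) ^ 2 + (f t * f') ^ 2 =
      f t ^ 2 * (f' ^ 2 + g' ^ 2) := by
    linear_combination f t ^ 2 * g' ^ 2 * sin_sq_add_cos_sq θ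
  rw [h, sqrt_mul (sq_nonneg _), sqrt_sq hft]

lemma firstE_revolution (hf : HasDerivAt f f' t) (hg : HasDerivAt g g' t) (θ : ℝ) :
    firstE (revolution f g) (t, θ) = f' ^ 2 + g' ^ 2 := by
  rw [firstE, partialFst_revolution hf hg, inner_vec3]
  linear_combination f' ^ 2 * sin_sq_add_cos_sq θ

lemma firstF_revolution (hf : HasDerivAt f f' t) (hg : HasDerivAt g g' t) (θ : ℝ) :
    firstF (revolution f g) (t, θ) = 0 := by
  rw [firstF, partialFst_revolution hf hg, partialSnd_revolution, inner_vec3]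
  ring

lemma firstG_revolution (f g : ℝ → ℝ) (t θ : ℝ) :
    firstG (revolution f g) (t, θ) = f t ^ 2 := by
  rw [firstG, partialSnd_revolution, inner_vec3]
  linear_combination f t ^ 2 * sin_sq_add_cos_sq θ

lemma areaDensity_revolution (hf : HasDerivAt f f' t) (hg : HasDerivAt g g' t) (hft : 0 ≤ f t)
    (θ : ℝ) : areaDensity (revolution f g) (t, θ) = f t * √(f' ^ 2 + g' ^ 2) := by
  rw [areaDensity, firstE_revolution hf hg, firstF_revolution hf hg, firstG_revolution,
    zero_pow two_ne_zero, sub_zero, mul_comm, sqrt_mul (sq_nonneg _), sqrt_sq hft]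

lemma volumeDensity_revolution (hf : HasDerivAt f f' t) (hg : HasDerivAt g g' t) (hft : 0 < f t)
    (h : 0 < f' ^ 2 + g' ^ 2) (θ : ℝ) :
    inner ℝ (gaussMap (revolution f g) (t, θ)) (revolution f g (t, θ)) *
      areaDensity (revolution f g) (t, θ) = f t * (f' * g t - f t * g') := by
  rw [gaussMap, areaDensity_revolution hf hg hft.le, norm_cross_revolution hf hg hft.le,
    cross_revolution hf hg, real_inner_smul_left, revolution, inner_vec3]
  have := sqrt_pos.2 h
  field_simp
  linear_combination - g' * f t * sin_sq_add_cos_sq θ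

/-- Factoring the velocity as p (α, β) keeps p' out of the result: the part of the acceleration
containing p' is tangential. The two summands are the principal curvatures of the parallel and of
the profile. -/
lemma meanCurvature_revolution {α β p : ℝ → ℝ} {α' β' p' v : ℝ}
    (hf : ∀ᶠ s in 𝓝 t, HasDerivAt f (α s * p s) s) (hg : ∀ᶠ s in 𝓝 t, HasDerivAt g (β s * p s) s)
    (hα : HasDerivAt α α' t) (hβ : HasDerivAt β β' t) (hp : HasDerivAt p p' t)
    (hft : 0 < f t) (hv : 0 < v) (hspeed : (α t ^ 2 + β t ^ 2) * p t ^ 2 = v ^ 2) (θ : ℝ) :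
    meanCurvature (revolution f g) (t, θ) =
      (β t * p t / (f t * v) + p t ^ 2 * (α t * β' - α' * β t) / v ^ 3) / 2 := by
  have hf0 := hf.self_of_nhds
  have hg0 := hg.self_of_nhds
  have hE : (α t * p t) ^ 2 + (β t * p t) ^ 2 = v ^ 2 := by rw [← hspeed]; ring
  have hn : gaussMap (revolution f g) (t, θ) = (f t * v)⁻¹ •
      !₂[-(f t * (β t * p t) * cos θ), -(f t * (β t * p t) * sin θ), f t * (α t * p t)] := by
    rw [gaussMap, norm_cross_revolution hf0 hg0 hft.le, cross_revolution hf0 hg0, hE, sqrt_sq hv.le]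
  have htt : partialFst (partialFst (revolution f g)) (t, θ) =
      !₂[(α' * p t + α t * p') * cos θ, (α' * p t + α t * p') * sin θ,
        β' * p t + β t * p'] := by
    have h : (fun s => partialFst (revolution f g) (s, θ)) =ᶠ[𝓝 t]
        fun s => !₂[α s * p s * cos θ, α s * p s * sin θ, β s * p s] := by
      filter_upwards [hf, hg] with s hs hs'
      exact partialFst_revolution hs hs' θ
    rw [partialFst, h.deriv_eq]
    exact (hasDerivAt_vec3 ((hα.mul hp).mul_const _) ((hα.mul hp).mul_const _) (hβ.mul hp)).deriv
  have htθ : partialSnd (partialFst (revolution f g)) (t, θ) =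
      !₂[-(α t * p t * sin θ), α t * p t * cos θ, 0] := by
    have h : (fun s => partialFst (revolution f g) (t, s)) =
        fun s => !₂[α t * p t * cos s, α t * p t * sin s, β t * p t] :=
      funext fun s => partialFst_revolution hf0 hg0 s
    rw [partialSnd, h]
    refine (hasDerivAt_vec3 (((hasDerivAt_cos θ).const_mul _).congr_deriv ?_)
      ((hasDerivAt_sin θ).const_mul _) (hasDerivAt_const θ _)).deriv
    ring
  have hθθ : partialSnd (partialSnd (revolution f g)) (t, θ) =
      !₂[-(f t * cos θ), -(f t * sin θ), 0] := by
    have h : (fun s => partialSnd (revolution f g) (t, s)) =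
        fun s => !₂[-(f t * sin s), f t * cos s, 0] :=
      funext fun s => partialSnd_revolution f g t s
    rw [partialSnd, h]
    refine (hasDerivAt_vec3 ((hasDerivAt_sin θ).const_mul _).neg
      (((hasDerivAt_cos θ).const_mul _).congr_deriv ?_) (hasDerivAt_const θ _)).deriv
    ring
  have hL : secondL (revolution f g) (t, θ) = p t ^ 2 * (α t * β' - α' * β t) / v := by
    rw [secondL, htt, hn, real_inner_smul_right, inner_vec3]
    field_simp
    linear_combination (-(α' * p t + α t * p') * β t * p t) * sin_sq_add_cos_sq θ
  have hM : secondM (revolution f g) (t, θ) = 0 := by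
    rw [secondM, htθ, hn, real_inner_smul_right, inner_vec3]
    ring
  have hN : secondN (revolution f g) (t, θ) = f t * (β t * p t) / v := by
    rw [secondN, hθθ, hn, real_inner_smul_right, inner_vec3]
    field_simp
    linear_combination (f t * β t * p t) * sin_sq_add_cos_sq θ
  rw [meanCurvature, firstE_revolution hf0 hg0, firstF_revolution hf0 hg0, firstG_revolution,
    hL, hM, hN, hE]
  field_simp
  ring

end

/-! ### Regularity and embeddedness of surfaces of revolution. -/

section

variable {f g f' g' : ℝ → ℝ}

/-- The derivative of a surface of revolution in terms of the derivatives of its profile curve. -/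
def revolutionDeriv (f f' g' : ℝ → ℝ) (p : ℝ × ℝ) : ℝ × ℝ →L[ℝ] E3 :=
  (f' p.1 * cos p.2) • (ContinuousLinearMap.fst ℝ ℝ ℝ).smulRight (!₂[1, 0, 0] : E3) +
  (f p.1 * sin p.2) • (-ContinuousLinearMap.snd ℝ ℝ ℝ).smulRight (!₂[1, 0, 0] : E3) +
  (f' p.1 * sin p.2) • (ContinuousLinearMap.fst ℝ ℝ ℝ).smulRight (!₂[0, 1, 0] : E3) +
  (f p.1 * cos p.2) • (ContinuousLinearMap.snd ℝ ℝ ℝ).smulRight (!₂[0, 1, 0] : E3) +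
  g' p.1 • (ContinuousLinearMap.fst ℝ ℝ ℝ).smulRight (!₂[0, 0, 1] : E3)

lemma hasFDerivAt_revolution (hf : ∀ t, HasDerivAt f (f' t) t) (hg : ∀ t, HasDerivAt g (g' t) t)
    (p : ℝ × ℝ) : HasFDerivAt (revolution f g) (revolutionDeriv f f' g' p) p := by
  have hX : revolution f g = fun p => (f p.1 * cos p.2) • (!₂[1, 0, 0] : E3) +
      (f p.1 * sin p.2) • (!₂[0, 1, 0] : E3) + g p.1 • (!₂[0, 0, 1] : E3) := by
    funext p
    ext i
    fin_cases i <;> simp [revolution]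
  have d1 : HasFDerivAt (Prod.fst : ℝ × ℝ → ℝ) (ContinuousLinearMap.fst ℝ ℝ ℝ) p := hasFDerivAt_fst
  have d2 : HasFDerivAt (Prod.snd : ℝ × ℝ → ℝ) (ContinuousLinearMap.snd ℝ ℝ ℝ) p := hasFDerivAt_snd
  have h1 : HasFDerivAt (fun p : ℝ × ℝ => f p.1) _ p :=
    (hf p.1).comp_hasFDerivAt p d1
  have h2 : HasFDerivAt (fun p : ℝ × ℝ => g p.1) _ p :=
    (hg p.1).comp_hasFDerivAt p d1
  have h3 : HasFDerivAt (fun p : ℝ × ℝ => cos p.2) _ p :=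
    (hasDerivAt_cos p.2).comp_hasFDerivAt p d2
  have h4 : HasFDerivAt (fun p : ℝ × ℝ => sin p.2) _ p :=
    (hasDerivAt_sin p.2).comp_hasFDerivAt p d2
  have := (((h1.mul h3).smul_const (!₂[1, 0, 0] : E3)).add
    ((h1.mul h4).smul_const (!₂[0, 1, 0] : E3))).add (h2.smul_const (!₂[0, 0, 1] : E3))
  rw [hX]
  refine HasFDerivAt.congr_fderiv this ?_
  refine ContinuousLinearMap.ext fun q => ?_
  ext i
  fin_cases i <;> simp [revolutionDeriv] <;> ring

lemma lipschitzWith_mul_of_bounded {E : Type*} [PseudoMetricSpace E] {u v : E → ℝ} {K L : NNReal}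
    {M N : ℝ} (hu : LipschitzWith K u) (hv : LipschitzWith L v) (hM : ∀ x, |u x| ≤ M)
    (hN : ∀ x, |v x| ≤ N) : ∃ R, LipschitzWith R fun x => u x * v x := by
  refine ⟨_, LipschitzWith.of_dist_le' (K := M * L + N * K) fun x y => ?_⟩
  have h1 := hu.dist_le_mul x y
  have h2 := hv.dist_le_mul x y
  rw [Real.dist_eq] at h1 h2 ⊢
  have e : u x * v x - u y * v y = u x * (v x - v y) + v y * (u x - u y) := by ring
  rw [e]
  refine (abs_add_le _ _).trans ?_
  rw [abs_mul, abs_mul]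
  have hM0 := (abs_nonneg _).trans (hM x)
  have hN0 := (abs_nonneg _).trans (hN x)
  have := mul_le_mul (hM x) h2 (abs_nonneg _) hM0
  have := mul_le_mul (hN y) h1 (abs_nonneg _) hN0
  nlinarith

lemma lipschitzWith_smul_const {E F : Type*} [PseudoMetricSpace E] [NormedAddCommGroup F]
    [NormedSpace ℝ F] {u : E → ℝ} {K : NNReal} (hu : LipschitzWith K u) (A : F) :
    ∃ R, LipschitzWith R fun x => u x • A := by
  refine ⟨_, LipschitzWith.of_dist_le' (K := K * ‖A‖) fun x y => ?_⟩
  rw [dist_eq_norm, ← sub_smul, norm_smul, ← dist_eq_norm]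
  have := mul_le_mul_of_nonneg_right (hu.dist_le_mul x y) (norm_nonneg A)
  linarith

/-- The coefficients of the fixed linear maps in `revolutionDeriv` are products of bounded Lipschitz
functions. No bound on g' is assumed because g' occurs alone. -/
lemma exists_lipschitzWith_revolutionDeriv {K₀ K₁ K₂ : NNReal} {M₀ M₁ : ℝ}
    (hf : LipschitzWith K₀ f) (hf' : LipschitzWith K₁ f') (hg' : LipschitzWith K₂ g')
    (hM₀ : ∀ t, |f t| ≤ M₀) (hM₁ : ∀ t, |f' t| ≤ M₁) :
    ∃ K, LipschitzWith K (revolutionDeriv f f' g') := by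
  have hcos : LipschitzWith (1 * 1) fun p : ℝ × ℝ => cos p.2 :=
    Real.lipschitzWith_cos.comp LipschitzWith.prod_snd
  have hsin : LipschitzWith (1 * 1) fun p : ℝ × ℝ => sin p.2 :=
    Real.lipschitzWith_sin.comp LipschitzWith.prod_snd
  have hf₁ := hf.comp (LipschitzWith.prod_fst (α := ℝ) (β := ℝ))
  have hf₁' := hf'.comp (LipschitzWith.prod_fst (α := ℝ) (β := ℝ))
  have hg₁' := hg'.comp (LipschitzWith.prod_fst (α := ℝ) (β := ℝ))
  obtain ⟨_, h1⟩ := lipschitzWith_mul_of_bounded hf₁' hcos (fun p => hM₁ p.1)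
    (fun p => abs_cos_le_one p.2)
  obtain ⟨_, h2⟩ := lipschitzWith_mul_of_bounded hf₁ hsin (fun p => hM₀ p.1)
    (fun p => abs_sin_le_one p.2)
  obtain ⟨_, h3⟩ := lipschitzWith_mul_of_bounded hf₁' hsin (fun p => hM₁ p.1)
    (fun p => abs_sin_le_one p.2)
  obtain ⟨_, h4⟩ := lipschitzWith_mul_of_bounded hf₁ hcos (fun p => hM₀ p.1)
    (fun p => abs_cos_le_one p.2)
  obtain ⟨_, h1⟩ := lipschitzWith_smul_const h1
    ((ContinuousLinearMap.fst ℝ ℝ ℝ).smulRight (!₂[1, 0, 0] : E3))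
  obtain ⟨_, h2⟩ := lipschitzWith_smul_const h2
    ((-ContinuousLinearMap.snd ℝ ℝ ℝ).smulRight (!₂[1, 0, 0] : E3))
  obtain ⟨_, h3⟩ := lipschitzWith_smul_const h3
    ((ContinuousLinearMap.fst ℝ ℝ ℝ).smulRight (!₂[0, 1, 0] : E3))
  obtain ⟨_, h4⟩ := lipschitzWith_smul_const h4
    ((ContinuousLinearMap.snd ℝ ℝ ℝ).smulRight (!₂[0, 1, 0] : E3))
  obtain ⟨_, h5⟩ := lipschitzWith_smul_const hg₁'
    ((ContinuousLinearMap.fst ℝ ℝ ℝ).smulRight (!₂[0, 0, 1] : E3))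
  exact ⟨_, (((h1.add h2).add h3).add h4).add h5⟩

lemma revolutionDeriv_injective {p : ℝ × ℝ} (hf : f p.1 ≠ 0)
    (hspeed : 0 < f' p.1 ^ 2 + g' p.1 ^ 2) : Function.Injective (revolutionDeriv f f' g' p) := by
  refine (injective_iff_map_eq_zero _).2 fun q hq => ?_
  have h0 := congrArg (fun v : E3 => v 0) hq
  have h1 := congrArg (fun v : E3 => v 1) hq
  have h2 := congrArg (fun v : E3 => v 2) hq
  simp [revolutionDeriv] at h0 h1 h2
  have hsc := sin_sq_add_cos_sq p.2
  have e1 : f' p.1 * q.1 = 0 := by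
    linear_combination cos p.2 * h0 + sin p.2 * h1 - f' p.1 * q.1 * hsc
  have e2 : f p.1 * q.2 = 0 := by
    linear_combination cos p.2 * h1 - sin p.2 * h0 - f p.1 * q.2 * hsc
  have e3 : q.2 = 0 := (mul_eq_zero.1 e2).resolve_left hf
  have e4 : q.1 = 0 := by
    have : (f' p.1 ^ 2 + g' p.1 ^ 2) * q.1 = 0 := by
      rcases h2 with h2 | h2
      · linear_combination f' p.1 * e1 + g' p.1 * q.1 * h2
      · rw [h2, mul_zero]
    exact (mul_eq_zero.1 this).resolve_left hspeed.ne'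
  exact Prod.ext e4 e3

lemma isEmbeddedC11Torus_revolution {P : ℝ} (hP : 0 < P)
    (hf : ∀ t, HasDerivAt f (f' t) t) (hg : ∀ t, HasDerivAt g (g' t) t)
    {K₀ K₁ K₂ : NNReal} {M₀ M₁ : ℝ} (hfL : LipschitzWith K₀ f) (hfL' : LipschitzWith K₁ f')
    (hgL' : LipschitzWith K₂ g') (hM₀ : ∀ t, |f t| ≤ M₀) (hM₁ : ∀ t, |f' t| ≤ M₁)
    (hpos : ∀ t, 0 < f t) (hspeed : ∀ t, 0 < f' t ^ 2 + g' t ^ 2)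
    (hfP : ∀ t, f (t + P) = f t) (hgP : ∀ t, g (t + P) = g t)
    (hinj : ∀ s t, f s = f t → g s = g t → ∃ m : ℤ, t = s + m * P) :
    IsEmbeddedC11Torus (revolution f g) P (2 * π) := by
  have hfd : fderiv ℝ (revolution f g) = revolutionDeriv f f' g' :=
    funext fun p => (hasFDerivAt_revolution hf hg p).fderiv
  obtain ⟨K, hK⟩ := exists_lipschitzWith_revolutionDeriv hfL hfL' hgL' hM₀ hM₁
  refine ⟨hP, two_pi_pos, ?_, ?_, ?_, ⟨K, hfd ▸ hK⟩, ?_, ?_⟩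
  · intro t θ
    simp [revolution, hfP, hgP]
  · intro t θ
    simp [revolution]
  · rw [contDiff_one_iff_fderiv]
    exact ⟨fun p => (hasFDerivAt_revolution hf hg p).differentiableAt, hfd ▸ hK.continuous⟩
  · intro p
    rw [hfd]
    exact revolutionDeriv_injective (hpos _).ne' (hspeed _)
  · rintro ⟨s, θ⟩ ⟨t, φ⟩ h
    have h0 := congrArg (fun v : E3 => v 0) h
    have h1 := congrArg (fun v : E3 => v 1) h
    have h2 := congrArg (fun v : E3 => v 2) h
    simp [revolution] at h0 h1 h2
    -- The first two coordinates determine the distance to the axis; with equal radii they then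
    -- determine the angle modulo 2π.
    have hsq : f s ^ 2 = f t ^ 2 := by
      linear_combination (f s * cos θ + f t * cos φ) * h0 + (f s * sin θ + f t * sin φ) * h1 -
        f s ^ 2 * sin_sq_add_cos_sq θ + f t ^ 2 * sin_sq_add_cos_sq φ
    have hst : f s = f t := (pow_left_inj₀ (hpos s).le (hpos t).le two_ne_zero).1 hsq
    obtain ⟨m, hm⟩ := hinj s t hst h2
    rw [hst] at h0 h1
    have hc := mul_left_cancel₀ (hpos t).ne' h0
    have hs := mul_left_cancel₀ (hpos t).ne' h1
    have hang := Real.Angle.cos_sin_inj hc hs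
    obtain ⟨n, hn⟩ := Real.Angle.angle_eq_iff_two_pi_dvd_sub.1 hang
    refine ⟨m, -n, Prod.ext hm ?_⟩
    push_cast
    linarith

end

/-! ### Integrals over a Delaunay profile curve -/

/-- The rate at which the angle `σ` with
`unduloidF a y ^ 2 = (a - y) ^ 2 + 4 * a * y * sin (σ / 2) ^ 2` grows. -/
def angleRate (a y t : ℝ) : ℝ := √(a ^ 2 - y ^ 2) / (a + y * cos t)

/-- The sine of half the angle growing at `angleRate a y`. -/
def sinHalfAngle (a y t : ℝ) : ℝ := √(a - y) * sin (t / 2) / √(a + y * cos t)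

/-- The cosine of half the angle growing at `angleRate a y`. -/
def cosHalfAngle (a y t : ℝ) : ℝ := √(a + y) * cos (t / 2) / √(a + y * cos t)

/-- The integral of the radius with respect to the angle growing at `angleRate a y`. -/
def radiusIntegral (a y : ℝ) : ℝ := ∫ t in (0 : ℝ)..2 * π, unduloidF a y t * angleRate a y t

/-- The integral of the cubed radius with respect to the angle growing at `angleRate a y`. -/
def radiusCubeIntegral (a y : ℝ) : ℝ :=
  ∫ t in (0 : ℝ)..2 * π, unduloidF a y t ^ 3 * angleRate a y t

section

variable {a y : ℝ}

lemma angleRate_pos (hy : 0 < y) (hya : y < a) (t : ℝ) : 0 < angleRate a y t :=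
  div_pos (sqrt_pos.2 (sq_sub_sq_pos hy hya)) (add_mul_cos_pos hy hya t)

lemma continuous_angleRate (hy : 0 < y) (hya : y < a) : Continuous (angleRate a y) :=
  Continuous.div (by fun_prop) (by fun_prop) fun t => (add_mul_cos_pos hy hya t).ne'

/-- This shows that the angle is arc length up to a constant: the unduloid has speed a times the
rate, and the nodoid, before its change of parameter, has speed equal to the rate. -/
lemma angleRate_sq (hy : 0 < y) (hya : y < a) (t : ℝ) :
    angleRate a y t ^ 2 = (y ^ 2 * sin t ^ 2 + (a ^ 2 - y ^ 2)) * tangentScale a y t ^ 2 := by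
  have h1 := sq_sub_sq_pos hy hya
  have h2 := add_mul_cos_pos hy hya t
  have h3 := sub_mul_cos_pos hy hya t
  have h4 := unduloidF_pos hy hya t
  rw [angleRate, tangentScale, div_pow, div_pow, mul_pow, sq_sqrt h1.le, unduloidF_sq hy hya, sin_sq]
  field_simp
  ring

lemma hasDerivAt_sqrt_add_mul_cos (hy : 0 < y) (hya : y < a) (t : ℝ) :
    HasDerivAt (fun t => √(a + y * cos t)) (-(y * sin t) / (2 * √(a + y * cos t))) t := by
  have h2 := add_mul_cos_pos hy hya t
  have hd : HasDerivAt (fun t => a + y * cos t) (-(y * sin t)) t := by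
    have := ((hasDerivAt_cos t).const_mul y).const_add a
    exact this.congr_deriv (by ring)
  exact hd.sqrt h2.ne'

lemma sqrt_sq_sub_sq (hya : y < a) : √(a ^ 2 - y ^ 2) = √(a - y) * √(a + y) := by
  rw [← sqrt_mul (by linarith)]
  congr 1
  ring

lemma hasDerivAt_sinHalfAngle (hy : 0 < y) (hya : y < a) (t : ℝ) :
    HasDerivAt (sinHalfAngle a y) (cosHalfAngle a y t * angleRate a y t / 2) t := by
  have h2 := sqrt_pos.2 (add_mul_cos_pos hy hya t)
  have hs : HasDerivAt (fun t => √(a - y) * sin (t / 2)) (√(a - y) * (cos (t / 2) * (1 / 2))) t :=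
    (((hasDerivAt_id t).div_const 2).sin).const_mul _
  refine (hs.div (hasDerivAt_sqrt_add_mul_cos hy hya t) h2.ne').congr_deriv ?_
  have e1 : sin t = 2 * sin (t / 2) * cos (t / 2) := by rw [← sin_two_mul]; ring_nf
  have e2 : cos t = 2 * cos (t / 2) ^ 2 - 1 := by rw [← cos_two_mul]; ring_nf
  have e3 := sq_sqrt (add_mul_cos_pos hy hya t).le
  have e4 := sq_sqrt (show 0 ≤ a + y by linarith)
  have hsc := sin_sq_add_cos_sq (t / 2)
  rw [cosHalfAngle, angleRate, sqrt_sq_sub_sq hya, ← e3]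
  generalize √(a + y * cos t) = q at *
  rw [sqrt_sq h2.le]
  field_simp
  linear_combination √(a - y) * (cos (t / 2) * e3 + y * sin (t / 2) * e1 +
    cos (t / 2) * y * e2 - cos (t / 2) * e4 + 2 * y * cos (t / 2) * hsc)

lemma hasDerivAt_cosHalfAngle (hy : 0 < y) (hya : y < a) (t : ℝ) :
    HasDerivAt (cosHalfAngle a y) (-(sinHalfAngle a y t * angleRate a y t / 2)) t := by
  have h2 := sqrt_pos.2 (add_mul_cos_pos hy hya t)
  have hs : HasDerivAt (fun t => √(a + y) * cos (t / 2))
      (√(a + y) * (-sin (t / 2) * (1 / 2))) t :=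
    (((hasDerivAt_id t).div_const 2).cos).const_mul _
  refine (hs.div (hasDerivAt_sqrt_add_mul_cos hy hya t) h2.ne').congr_deriv ?_
  have e1 : sin t = 2 * sin (t / 2) * cos (t / 2) := by rw [← sin_two_mul]; ring_nf
  have e2 : cos t = 2 * cos (t / 2) ^ 2 - 1 := by rw [← cos_two_mul]; ring_nf
  have e3 := sq_sqrt (add_mul_cos_pos hy hya t).le
  have e4 := sq_sqrt (show 0 ≤ a - y by linarith)
  rw [sinHalfAngle, angleRate, sqrt_sq_sub_sq hya, ← e3]
  generalize √(a + y * cos t) = q at *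
  rw [sqrt_sq h2.le]
  field_simp
  linear_combination √(a + y) * (-sin (t / 2) * e3 + y * cos (t / 2) * e1 -
    sin (t / 2) * y * e2 + sin (t / 2) * e4)

lemma continuous_sinHalfAngle (hy : 0 < y) (hya : y < a) : Continuous (sinHalfAngle a y) :=
  continuous_iff_continuousAt.2 fun t => (hasDerivAt_sinHalfAngle hy hya t).continuousAt

lemma continuous_cosHalfAngle (hy : 0 < y) (hya : y < a) : Continuous (cosHalfAngle a y) :=
  continuous_iff_continuousAt.2 fun t => (hasDerivAt_cosHalfAngle hy hya t).continuousAt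

lemma sinHalfAngle_sq_add_cosHalfAngle_sq (hy : 0 < y) (hya : y < a) (t : ℝ) :
    sinHalfAngle a y t ^ 2 + cosHalfAngle a y t ^ 2 = 1 := by
  have h2 := add_mul_cos_pos hy hya t
  rw [sinHalfAngle, cosHalfAngle, div_pow, div_pow, mul_pow, mul_pow, sq_sqrt h2.le,
    sq_sqrt (show 0 ≤ a - y by linarith), sq_sqrt (show 0 ≤ a + y by linarith)]
  have e2 : cos t = 2 * cos (t / 2) ^ 2 - 1 := by rw [← cos_two_mul]; ring_nf
  rw [← add_div, div_eq_one_iff_eq h2.ne', sin_sq, e2]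
  ring

/-- For small a - y the radius is a perturbation of 2 √(a y) sin (σ/2), which makes its integrals
elliptic integrals near a degenerate case. -/
lemma unduloidF_sq_eq_add (hy : 0 < y) (hya : y < a) (t : ℝ) :
    unduloidF a y t ^ 2 = (a - y) ^ 2 + (2 * √(a * y)) ^ 2 * sinHalfAngle a y t ^ 2 := by
  have h2 := add_mul_cos_pos hy hya t
  rw [unduloidF_sq hy hya, sinHalfAngle, div_pow, mul_pow, mul_pow, sq_sqrt h2.le,
    sq_sqrt (show 0 ≤ a - y by linarith), sq_sqrt (show 0 ≤ a * y by nlinarith)]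
  have e2 : cos t = 1 - 2 * sin (t / 2) ^ 2 := by
    have := cos_two_mul (t / 2)
    rw [cos_sq'] at this
    ring_nf at this ⊢
    exact this
  field_simp
  rw [e2]
  ring

lemma sinHalfAngle_nonneg {t : ℝ} (ht : t ∈ Icc 0 (2 * π)) : 0 ≤ sinHalfAngle a y t := by
  have := sin_nonneg_of_nonneg_of_le_pi (x := t / 2) (by linarith [ht.1]) (by linarith [ht.2])
  unfold sinHalfAngle
  positivity

lemma cosHalfAngle_nonneg {t : ℝ} (ht : t ∈ Icc 0 π) : 0 ≤ cosHalfAngle a y t := by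
  have := cos_nonneg_of_neg_pi_div_two_le_of_le (x := t / 2) (by linarith [ht.1, pi_pos])
    (by linarith [ht.2])
  unfold cosHalfAngle
  positivity

lemma cosHalfAngle_zero (hy : 0 < y) (hya : y < a) : cosHalfAngle a y 0 = 1 := by
  have : √(a + y) ≠ 0 := (sqrt_pos.2 (by linarith)).ne'
  simp [cosHalfAngle, this]

lemma cosHalfAngle_two_pi (hy : 0 < y) (hya : y < a) : cosHalfAngle a y (2 * π) = -1 := by
  have : √(a + y) ≠ 0 := (sqrt_pos.2 (by linarith)).ne'
  simp [cosHalfAngle, this]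

lemma cosHalfAngle_pi : cosHalfAngle a y π = 0 := by
  simp [cosHalfAngle]

lemma sinHalfAngle_zero : sinHalfAngle a y 0 = 0 := by
  simp [sinHalfAngle]

lemma sinHalfAngle_pi (hya : y < a) : sinHalfAngle a y π = 1 := by
  have : √(a - y) ≠ 0 := (sqrt_pos.2 (by linarith)).ne'
  simp [sinHalfAngle, ← sub_eq_add_neg, this]

lemma integral_sinHalfAngle (hy : 0 < y) (hya : y < a) :
    ∫ t in (0 : ℝ)..2 * π, sinHalfAngle a y t * angleRate a y t = 4 := by
  have hd : ∀ t ∈ uIcc 0 (2 * π), HasDerivAt (fun t => -2 * cosHalfAngle a y t)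
      (sinHalfAngle a y t * angleRate a y t) t := fun t _ =>
    ((hasDerivAt_cosHalfAngle hy hya t).const_mul (-2)).congr_deriv (by ring)
  rw [intervalIntegral.integral_eq_sub_of_hasDerivAt hd
    (((continuous_sinHalfAngle hy hya).mul (continuous_angleRate hy hya)).intervalIntegrable _ _),
    cosHalfAngle_zero hy hya, cosHalfAngle_two_pi hy hya]
  norm_num

lemma integral_sinHalfAngle_cube (hy : 0 < y) (hya : y < a) :
    ∫ t in (0 : ℝ)..2 * π, sinHalfAngle a y t ^ 3 * angleRate a y t = 8 / 3 := by
  have hd : ∀ t ∈ uIcc 0 (2 * π), HasDerivAt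
      (fun t => -2 * cosHalfAngle a y t + 2 / 3 * cosHalfAngle a y t ^ 3)
      (sinHalfAngle a y t ^ 3 * angleRate a y t) t := fun t _ => by
    have h := hasDerivAt_cosHalfAngle hy hya t
    refine ((h.const_mul (-2)).add ((h.pow 3).const_mul (2 / 3))).congr_deriv ?_
    have := sinHalfAngle_sq_add_cosHalfAngle_sq hy hya t
    simp only [Nat.cast_ofNat, Nat.add_one_sub_one]
    linear_combination (-(sinHalfAngle a y t * angleRate a y t)) * this
  rw [intervalIntegral.integral_eq_sub_of_hasDerivAt hd
    ((((continuous_sinHalfAngle hy hya).pow 3).mul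
      (continuous_angleRate hy hya)).intervalIntegrable _ _),
    cosHalfAngle_zero hy hya, cosHalfAngle_two_pi hy hya]
  norm_num

/-! ### Bounds for the radius integrals. -/

lemma mul_sinHalfAngle_le_unduloidF (hy : 0 < y) (hya : y < a) (t : ℝ) :
    2 * √(a * y) * sinHalfAngle a y t ≤ unduloidF a y t := by
  refine le_of_sq_le_sq ?_ (unduloidF_pos hy hya t).le
  rw [unduloidF_sq_eq_add hy hya, mul_pow]
  nlinarith [sq_nonneg (a - y)]

lemma intervalIntegrable_unduloidF_mul (hy : 0 < y) (hya : y < a) (u v : ℝ) :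
    IntervalIntegrable (fun t => unduloidF a y t * angleRate a y t) volume u v :=
  ((continuous_unduloidF hy hya).mul (continuous_angleRate hy hya)).intervalIntegrable _ _

lemma intervalIntegrable_unduloidF_cube_mul (hy : 0 < y) (hya : y < a) (u v : ℝ) :
    IntervalIntegrable (fun t => unduloidF a y t ^ 3 * angleRate a y t) volume u v :=
  (((continuous_unduloidF hy hya).pow 3).mul (continuous_angleRate hy hya)).intervalIntegrable _ _

lemma intervalIntegrable_sinHalfAngle_mul (hy : 0 < y) (hya : y < a) (u v : ℝ) :
    IntervalIntegrable (fun t => sinHalfAngle a y t * angleRate a y t) volume u v :=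
  ((continuous_sinHalfAngle hy hya).mul (continuous_angleRate hy hya)).intervalIntegrable _ _

lemma intervalIntegrable_sinHalfAngle_cube_mul (hy : 0 < y) (hya : y < a) (u v : ℝ) :
    IntervalIntegrable (fun t => sinHalfAngle a y t ^ 3 * angleRate a y t) volume u v :=
  (((continuous_sinHalfAngle hy hya).pow 3).mul
    (continuous_angleRate hy hya)).intervalIntegrable _ _

/-- Dropping (a - y)^2 from the squared radius leaves a sine, whose integral in the angle is exactly
4. -/
lemma le_radiusIntegral (hy : 0 < y) (hya : y < a) : 8 * √(a * y) ≤ radiusIntegral a y := by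
  have h : ∫ t in (0 : ℝ)..2 * π, 2 * √(a * y) * (sinHalfAngle a y t * angleRate a y t) ≤
      radiusIntegral a y := by
    refine intervalIntegral.integral_mono_on two_pi_pos.le
      ((intervalIntegrable_sinHalfAngle_mul hy hya _ _).const_mul _)
      (intervalIntegrable_unduloidF_mul hy hya _ _) fun t _ => ?_
    rw [← mul_assoc]
    exact mul_le_mul_of_nonneg_right (mul_sinHalfAngle_le_unduloidF hy hya t)
      (angleRate_pos hy hya t).le
  rw [intervalIntegral.integral_const_mul, integral_sinHalfAngle hy hya] at h
  linarith

lemma le_radiusCubeIntegral (hy : 0 < y) (hya : y < a) :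
    8 / 3 * (2 * √(a * y)) ^ 3 ≤ radiusCubeIntegral a y := by
  have h : ∫ t in (0 : ℝ)..2 * π,
      (2 * √(a * y)) ^ 3 * (sinHalfAngle a y t ^ 3 * angleRate a y t) ≤
      radiusCubeIntegral a y := by
    refine intervalIntegral.integral_mono_on two_pi_pos.le
      ((intervalIntegrable_sinHalfAngle_cube_mul hy hya _ _).const_mul _)
      (intervalIntegrable_unduloidF_cube_mul hy hya _ _) fun t ht => ?_
    rw [← mul_assoc, ← mul_pow]
    have := sinHalfAngle_nonneg (a := a) (y := y) ht
    exact mul_le_mul_of_nonneg_right (pow_le_pow_left₀ (by positivity)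
      (mul_sinHalfAngle_le_unduloidF hy hya t) 3) (angleRate_pos hy hya t).le
  rw [intervalIntegral.integral_const_mul, integral_sinHalfAngle_cube hy hya] at h
  linarith

lemma radiusCubeIntegral_le (hy : 0 < y) (hya : y < a) :
    radiusCubeIntegral a y ≤ (a - y) ^ 2 * radiusIntegral a y + 8 / 3 * (2 * √(a * y)) ^ 3 +
      4 * (2 * √(a * y)) * (a - y) ^ 2 := by
  set m := 2 * √(a * y) with hm
  have hm0 : 0 < m := by
    have := sqrt_pos.2 (mul_pos (hy.trans hya) hy)
    positivity
  have h : radiusCubeIntegral a y ≤ ∫ t in (0 : ℝ)..2 * π,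
      ((a - y) ^ 2 * (unduloidF a y t * angleRate a y t) +
        m ^ 3 * (sinHalfAngle a y t ^ 3 * angleRate a y t) +
        m * (a - y) ^ 2 * (sinHalfAngle a y t * angleRate a y t)) := by
    refine intervalIntegral.integral_mono_on two_pi_pos.le
      (intervalIntegrable_unduloidF_cube_mul hy hya _ _)
      ((((intervalIntegrable_unduloidF_mul hy hya _ _).const_mul _).add
        ((intervalIntegrable_sinHalfAngle_cube_mul hy hya _ _).const_mul _)).add
        ((intervalIntegrable_sinHalfAngle_mul hy hya _ _).const_mul _)) fun t ht => ?_
    have hs := sinHalfAngle_nonneg (a := a) (y := y) ht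
    have hF := unduloidF_pos hy hya t
    have hF2 := unduloidF_sq_eq_add hy hya t
    rw [← hm] at hF2
    have hr := angleRate_pos hy hya t
    set s := sinHalfAngle a y t
    set F := unduloidF a y t
    set e := a - y
    -- With F^2 = e^2 + m^2 s^2, splitting F^3 as e^2 F + m s (m F s) leaves only this product to
    -- estimate.
    have h1 : m * (F * s) ≤ m ^ 2 * s ^ 2 + e ^ 2 := by
      refine le_of_sq_le_sq ?_ (by positivity)
      have : (m * (F * s)) ^ 2 = m ^ 2 * s ^ 2 * (e ^ 2 + m ^ 2 * s ^ 2) := by rw [← hF2]; ring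
      rw [this]
      nlinarith [mul_nonneg (mul_nonneg (sq_nonneg m) (sq_nonneg s)) (sq_nonneg e), sq_nonneg (e ^ 2)]
    have h2 : F ^ 3 ≤ e ^ 2 * F + m ^ 3 * s ^ 3 + m * e ^ 2 * s := by
      have h3 : F ^ 3 = e ^ 2 * F + m * s * (m * (F * s)) := by
        rw [pow_succ, hF2]; ring
      rw [h3]
      have := mul_le_mul_of_nonneg_left h1 (mul_nonneg hm0.le hs)
      linarith
    have := mul_le_mul_of_nonneg_right h2 hr.le
    linarith
  rw [intervalIntegral.integral_add, intervalIntegral.integral_add,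
    intervalIntegral.integral_const_mul, intervalIntegral.integral_const_mul,
    intervalIntegral.integral_const_mul, integral_sinHalfAngle_cube hy hya,
    integral_sinHalfAngle hy hya] at h
  · rw [radiusIntegral]
    linarith
  · exact (intervalIntegrable_unduloidF_mul hy hya _ _).const_mul _
  · exact (intervalIntegrable_sinHalfAngle_cube_mul hy hya _ _).const_mul _
  · exact ((intervalIntegrable_unduloidF_mul hy hya _ _).const_mul _).add
        ((intervalIntegrable_sinHalfAngle_cube_mul hy hya _ _).const_mul _)
  · exact (intervalIntegrable_sinHalfAngle_mul hy hya _ _).const_mul _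

lemma unduloidF_two_pi_sub (a y t : ℝ) : unduloidF a y (2 * π - t) = unduloidF a y t := by
  simp [unduloidF, cos_two_pi_sub]

lemma angleRate_two_pi_sub (a y t : ℝ) : angleRate a y (2 * π - t) = angleRate a y t := by
  simp [angleRate, cos_two_pi_sub]

lemma radiusIntegral_eq_two_mul (hy : 0 < y) (hya : y < a) :
    radiusIntegral a y = 2 * ∫ t in (0 : ℝ)..π, unduloidF a y t * angleRate a y t := by
  have h := intervalIntegral.integral_comp_sub_left (a := 0) (b := π)
    (fun t => unduloidF a y t * angleRate a y t) (2 * π)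
  simp only [unduloidF_two_pi_sub, angleRate_two_pi_sub, sub_zero,
    show 2 * π - π = π by ring] at h
  rw [radiusIntegral, ← intervalIntegral.integral_add_adjacent_intervals
    (intervalIntegrable_unduloidF_mul hy hya 0 π)
    (intervalIntegrable_unduloidF_mul hy hya π (2 * π)), ← h]
  ring

/-- The excess of the radius F over m s is e^2 / (F + m s), with s the sine of the half angle. A
linear lower bound for F + m s, together with a cosine inserted in the numerator, turns it into an
exact logarithmic derivative. The coefficient 4/3 must stay below 2: two such errors are later set
against a gain with coefficient 4. -/
lemma radiusIntegral_le (hy : 0 < y) (hya : y < a) (hm : 5 / 3 ≤ 2 * √(a * y))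
    (h1 : a - y ≤ 1) :
    radiusIntegral a y ≤ 8 * √(a * y) + 4 / 3 * (a - y) ^ 2 * (log 7 - log (a - y) + 1) := by
  set m := 2 * √(a * y) with hmdef
  set e := a - y with he
  have he0 : 0 < e := by simp only [he]; linarith
  have hden : ∀ t ∈ Icc 0 π, 0 < e / 2 + 3 * sinHalfAngle a y t := fun t ht => by
    have := sinHalfAngle_nonneg (a := a) (y := y) ⟨ht.1, ht.2.trans (by linarith [pi_pos])⟩
    positivity
  have hd : ∀ t ∈ uIcc 0 π, HasDerivAt (fun t => -2 * m * cosHalfAngle a y t +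
      2 / 3 * e ^ 2 * log (e / 2 + 3 * sinHalfAngle a y t) - 2 / 3 * e ^ 2 * cosHalfAngle a y t)
      (m * (sinHalfAngle a y t * angleRate a y t) +
        e ^ 2 * (cosHalfAngle a y t * angleRate a y t / (e / 2 + 3 * sinHalfAngle a y t)) +
        1 / 3 * e ^ 2 * (sinHalfAngle a y t * angleRate a y t)) t := fun t ht => by
    rw [uIcc_of_le pi_pos.le] at ht
    have hc := hasDerivAt_cosHalfAngle hy hya t
    have hl := (((hasDerivAt_sinHalfAngle hy hya t).const_mul 3).const_add (e / 2)).log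
      (hden t ht).ne'
    refine (((hc.const_mul (-2 * m)).add (hl.const_mul (2 / 3 * e ^ 2))).sub
      (hc.const_mul (2 / 3 * e ^ 2))).congr_deriv ?_
    have := (hden t ht).ne'
    field_simp
    ring
  have hcont : ContinuousOn (fun t => m * (sinHalfAngle a y t * angleRate a y t) +
        e ^ 2 * (cosHalfAngle a y t * angleRate a y t / (e / 2 + 3 * sinHalfAngle a y t)) +
        1 / 3 * e ^ 2 * (sinHalfAngle a y t * angleRate a y t)) (uIcc 0 π) := by
    rw [uIcc_of_le pi_pos.le]
    have cs := (continuous_sinHalfAngle hy hya).continuousOn (s := Icc 0 π)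
    have cc := (continuous_cosHalfAngle hy hya).continuousOn (s := Icc 0 π)
    have cr := (continuous_angleRate hy hya).continuousOn (s := Icc 0 π)
    exact ((continuousOn_const.mul (cs.mul cr)).add (continuousOn_const.mul ((cc.mul cr).div
      (continuousOn_const.add (continuousOn_const.mul cs)) fun t ht => (hden t ht).ne'))).add
      (continuousOn_const.mul (cs.mul cr))
  have hle : ∫ t in (0 : ℝ)..π, unduloidF a y t * angleRate a y t ≤
      ∫ t in (0 : ℝ)..π, (m * (sinHalfAngle a y t * angleRate a y t) +
        e ^ 2 * (cosHalfAngle a y t * angleRate a y t / (e / 2 + 3 * sinHalfAngle a y t)) +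
        1 / 3 * e ^ 2 * (sinHalfAngle a y t * angleRate a y t)) := by
    refine intervalIntegral.integral_mono_on pi_pos.le
      (intervalIntegrable_unduloidF_mul hy hya _ _) hcont.intervalIntegrable fun t ht => ?_
    have hs := sinHalfAngle_nonneg (a := a) (y := y) ⟨ht.1, ht.2.trans (by linarith [pi_pos])⟩
    have hc := cosHalfAngle_nonneg (a := a) (y := y) ht
    have hF := unduloidF_pos hy hya t
    have hF2 := unduloidF_sq_eq_add hy hya t
    have hsc := sinHalfAngle_sq_add_cosHalfAngle_sq hy hya t
    have hD := hden t ht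
    rw [← hmdef, ← he] at hF2
    have hr := angleRate_pos hy hya t
    set s := sinHalfAngle a y t
    set k := cosHalfAngle a y t
    set F := unduloidF a y t
    -- Cauchy–Schwarz with the unit vector (3/5, 4/5). Then F + m s ≥ (3/5) e + (9/5) m s ≥ e/2 + 3
    -- s, using m ≥ 5/3.
    have hF3 : 3 / 5 * e + 4 / 5 * (m * s) ≤ F := by
      refine le_of_sq_le_sq ?_ hF.le
      rw [hF2]
      nlinarith [sq_nonneg (4 * e - 3 * (m * s))]
    have hms : 5 / 3 * s ≤ m * s := mul_le_mul_of_nonneg_right hm hs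
    have hF4 : (F - m * s) * (e / 2 + 3 * s) ≤ e ^ 2 := by
      have h5 : 0 ≤ F - m * s := by
        rw [sub_nonneg]
        refine le_of_sq_le_sq ?_ hF.le
        nlinarith [sq_nonneg e]
      calc (F - m * s) * (e / 2 + 3 * s) ≤ (F - m * s) * (F + m * s) :=
            mul_le_mul_of_nonneg_left (by linarith) h5
        _ = e ^ 2 := by linear_combination hF2
    -- This replaces 1 by the cosine k, needed for the logarithm, at the cost of s^2; divided by e/2
    -- + 3 s that cost is at most s/3.
    have hk1 : 1 ≤ k + s ^ 2 := by
      have : k ≤ 1 := by nlinarith [sq_nonneg s]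
      nlinarith
    have hF6 : F ≤ m * s + e ^ 2 * (k / (e / 2 + 3 * s)) + 1 / 3 * e ^ 2 * s := by
      have h6 : F - m * s ≤ e ^ 2 / (e / 2 + 3 * s) := (le_div_iff₀ hD).2 hF4
      have h7 : e ^ 2 / (e / 2 + 3 * s) ≤
          e ^ 2 * (k / (e / 2 + 3 * s)) + 1 / 3 * e ^ 2 * s := by
        rw [div_le_iff₀ hD]
        have : (e ^ 2 * (k / (e / 2 + 3 * s)) + 1 / 3 * e ^ 2 * s) * (e / 2 + 3 * s) =
            e ^ 2 * (k + s ^ 2) + e ^ 3 * s / 6 := by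
          field_simp
          ring
        rw [this]
        have : 0 ≤ e ^ 3 * s / 6 := by positivity
        nlinarith [mul_le_mul_of_nonneg_left hk1 (sq_nonneg e)]
      linarith
    have h8 := mul_le_mul_of_nonneg_right hF6 hr.le
    calc F * angleRate a y t ≤ _ := h8
      _ = _ := by ring
  rw [intervalIntegral.integral_eq_sub_of_hasDerivAt hd hcont.intervalIntegrable,
    cosHalfAngle_zero hy hya, cosHalfAngle_pi, sinHalfAngle_zero, sinHalfAngle_pi hya] at hle
  rw [radiusIntegral_eq_two_mul hy hya]
  -- The quotient of the arguments is (6 + e)/e, at most 7/e because e ≤ 1.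
  have hl : log (e / 2 + 3 * 1) - log (e / 2 + 3 * 0) ≤ log 7 - log e := by
    rw [← log_div (by positivity) (by positivity), ← log_div (by positivity) (by positivity)]
    refine log_le_log (by positivity) ?_
    rw [div_le_div_iff₀ (by positivity) (by positivity)]
    nlinarith
  have := mul_le_mul_of_nonneg_left hl (show 0 ≤ 4 / 3 * e ^ 2 by positivity)
  simp only [hmdef] at hle
  linarith

end

/-! ### The fitting condition -/

/-- The extrinsic length of one period of the unduloid whose minimum is `c - 1`. -/
def unduloidLength (c y : ℝ) : ℝ :=
  ∫ x in (0 : ℝ)..2 * π, √((y + (c - 1)) ^ 2 - y ^ 2 * cos x ^ 2)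

/-- The extrinsic length of one period of the nodoid. -/
def nodoidLength (c : ℝ) : ℝ :=
  ∫ x in (0 : ℝ)..2 * π, sin x ^ 2 / √(c ^ 2 - 1 ^ 2 * cos x ^ 2)

lemma unduloidF_zero {a y : ℝ} (hy : 0 < y) (hya : y < a) : unduloidF a y 0 = a - y := by
  have h1 := sqrt_pos.2 (sq_sub_sq_pos hy hya)
  simp only [unduloidF, cos_zero]
  field_simp

lemma unduloidF_two_pi {a y : ℝ} (hy : 0 < y) (hya : y < a) : unduloidF a y (2 * π) = a - y := by
  rw [← unduloidF_zero hy hya]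
  simp [unduloidF]

lemma unduloidG_zero (a y : ℝ) : unduloidG a y 0 = 0 := by
  simp [unduloidG]

lemma unduloidG_two_pi (a y : ℝ) :
    unduloidG a y (2 * π) = ∫ x in (0 : ℝ)..2 * π, √(a ^ 2 - y ^ 2 * cos x ^ 2) := by
  simp [unduloidG]

lemma nodoidG_zero (a c : ℝ) : nodoidG a c 0 = 0 := by
  simp [nodoidG]

lemma nodoidG_two_pi {c : ℝ} (hc : 1 < c) : nodoidG 1 c (2 * π) = -nodoidLength c := by
  rw [nodoidG_eq hc, sin_two_pi, nodoidLength]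
  ring

/-- Both endpoint conditions say that the minima agree, which eliminates a and leaves one equation
for y. -/
lemma fits_iff {c a y : ℝ} (hc : 1 < c) :
    Fits c a y ↔ 0 < y ∧ a = y + (c - 1) ∧ unduloidLength c y = nodoidLength c := by
  constructor
  · rintro ⟨hy, hya, hl, -, hlen⟩
    rw [unduloidF_zero hy hya, nodoidF_one, unduloidF_two_pi one_pos hc] at hl
    have ha : a = y + (c - 1) := by linarith
    refine ⟨hy, ha, ?_⟩
    rw [unduloidG_zero, unduloidG_two_pi, nodoidG_zero, nodoidG_two_pi hc, ha] at hlen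
    rw [unduloidLength]
    linarith
  · rintro ⟨hy, ha, hlen⟩
    have hya : y < a := by linarith
    refine ⟨hy, hya, ?_, ?_, ?_⟩
    · rw [unduloidF_zero hy hya, nodoidF_one, unduloidF_two_pi one_pos hc]
      linarith
    · rw [unduloidF_two_pi hy hya, nodoidF_one, unduloidF_zero one_pos hc]
      linarith
    · rw [unduloidG_zero, unduloidG_two_pi, nodoidG_zero, nodoidG_two_pi hc, ha, ← hlen,
        unduloidLength]
      ring

lemma continuous_unduloidLength (c : ℝ) : Continuous (unduloidLength c) := by
  unfold unduloidLength
  refine intervalIntegral.continuous_parametric_intervalIntegral_of_continuous' ?_ _ _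
  fun_prop

lemma continuous_nodoidLength_integrand {c : ℝ} (hc : 1 < c) :
    Continuous fun x : ℝ => sin x ^ 2 / √(c ^ 2 - 1 ^ 2 * cos x ^ 2) :=
  Continuous.div (by fun_prop) (by fun_prop)
    fun x => (sqrt_pos.2 (sq_sub_mul_cos_sq_pos one_pos hc x)).ne'

/-- The radicand is y^2 sin^2 x + 2 y (c - 1) + (c - 1)^2, strictly increasing in y ≥ 0 at every x.
-/
lemma strictMonoOn_unduloidLength {c : ℝ} (hc : 1 < c) :
    StrictMonoOn (unduloidLength c) (Ici 0) := by
  intro y hy z hz hyz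
  rw [mem_Ici] at hy hz
  have key : ∀ x, √((y + (c - 1)) ^ 2 - y ^ 2 * cos x ^ 2) <
      √((z + (c - 1)) ^ 2 - z ^ 2 * cos x ^ 2) := fun x => by
    have h1 : cos x ^ 2 ≤ 1 := cos_sq_le_one x
    have h3 := sq_nonneg (cos x)
    refine sqrt_lt_sqrt ?_ ?_
    · nlinarith [mul_le_mul_of_nonneg_left h1 (sq_nonneg y)]
    · have h2 : 0 ≤ (z ^ 2 - y ^ 2) * (1 - cos x ^ 2) :=
        mul_nonneg (by nlinarith) (by linarith)
      nlinarith
  refine intervalIntegral.integral_lt_integral_of_continuousOn_of_le_of_exists_lt two_pi_pos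
    (by fun_prop) (by fun_prop) (fun x _ => (key x).le) ⟨0, ⟨le_rfl, two_pi_pos.le⟩, key 0⟩

lemma pi_div_le_nodoidLength {c : ℝ} (hc : 1 < c) : π / c ≤ nodoidLength c := by
  have : ∫ x in (0 : ℝ)..2 * π, sin x ^ 2 / c = π / c := by
    rw [intervalIntegral.integral_div, integral_sin_sq]
    simp
  rw [← this]
  refine intervalIntegral.integral_mono_on two_pi_pos.le
    (Continuous.intervalIntegrable (by fun_prop) _ _)
    ((continuous_nodoidLength_integrand hc).intervalIntegrable _ _) fun x _ => ?_
  refine div_le_div_of_nonneg_left (sq_nonneg _)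
    (sqrt_pos.2 (sq_sub_mul_cos_sq_pos one_pos hc x)) ?_
  rw [sqrt_le_left (by linarith)]
  nlinarith [sq_nonneg (cos x)]

/-- At y = 0 the unduloid degenerates to length 2π (c - 1), which is below π/c as soon as 2 c (c -
1) < 1. -/
lemma unduloidLength_zero_lt {c : ℝ} (hc : 1 < c) (hc' : c ≤ 13 / 10) :
    unduloidLength c 0 < nodoidLength c := by
  have h1 : unduloidLength c 0 = 2 * π * (c - 1) := by
    have : √((c - 1) ^ 2) = c - 1 := sqrt_sq (by linarith)
    simp only [unduloidLength, zero_add, this, zero_pow two_ne_zero, zero_mul, sub_zero,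
      intervalIntegral.integral_const, smul_eq_mul]
  rw [h1]
  refine lt_of_lt_of_le ?_ (pi_div_le_nodoidLength hc)
  rw [lt_div_iff₀ (by linarith)]
  have : 2 * (c - 1) * c < 1 := by nlinarith
  nlinarith [pi_pos]

/-- At y = 1 both integrands involve the same root √D with D = c^2 - cos^2 x, and sin^2 x < D. -/
lemma nodoidLength_lt {c : ℝ} (hc : 1 < c) : nodoidLength c < unduloidLength c 1 := by
  have key : ∀ x, sin x ^ 2 / √(c ^ 2 - 1 ^ 2 * cos x ^ 2) <
      √((1 + (c - 1)) ^ 2 - 1 ^ 2 * cos x ^ 2) := fun x => by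
    have h := sq_sub_mul_cos_sq_pos one_pos hc x
    rw [show 1 + (c - 1) = c by ring, div_lt_iff₀ (sqrt_pos.2 h), mul_self_sqrt h.le, sin_sq]
    nlinarith
  refine intervalIntegral.integral_lt_integral_of_continuousOn_of_le_of_exists_lt two_pi_pos
    (continuous_nodoidLength_integrand hc).continuousOn (by fun_prop)
    (fun x _ => (key x).le) ⟨0, ⟨le_rfl, two_pi_pos.le⟩, key 0⟩

lemma exists_unduloidLength_eq {c : ℝ} (hc : 1 < c) (hc' : c ≤ 13 / 10) :
    ∃ y, 0 < y ∧ y < 1 ∧ unduloidLength c y = nodoidLength c := by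
  obtain ⟨y, hy, h⟩ := intermediate_value_Ioo zero_le_one
    (continuous_unduloidLength c).continuousOn ⟨unduloidLength_zero_lt hc hc', nodoidLength_lt hc⟩
  exact ⟨y, hy.1, hy.2, h⟩

lemma lt_one_of_unduloidLength_eq {c y : ℝ} (hc : 1 < c) (hy : 0 < y)
    (h : unduloidLength c y = nodoidLength c) : y < 1 := by
  refine (strictMonoOn_unduloidLength hc).lt_iff_lt (mem_Ici.2 hy.le) (mem_Ici.2 zero_le_one) |>.1 ?_
  rw [h]
  exact nodoidLength_lt hc

/-! ### Asymptotics of the fitting parameter. -/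

lemma integral_eq_four_mul_of_sin_sq {φ : ℝ → ℝ} (hφ : Continuous fun x => φ (sin x ^ 2)) :
    ∫ x in (0 : ℝ)..2 * π, φ (sin x ^ 2) = 4 * ∫ x in (0 : ℝ)..π / 2, φ (sin x ^ 2) := by
  have hi := fun u v : ℝ => hφ.intervalIntegrable (μ := volume) u v
  have h1 : ∫ x in π / 2..π, φ (sin x ^ 2) = ∫ x in (0 : ℝ)..π / 2, φ (sin x ^ 2) := by
    have := intervalIntegral.integral_comp_sub_left (a := 0) (b := π / 2)
      (fun x => φ (sin x ^ 2)) π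
    simp only [sin_pi_sub, sub_zero, show π - π / 2 = π / 2 by ring] at this
    exact this.symm
  have h2 : ∫ x in π..2 * π, φ (sin x ^ 2) = ∫ x in (0 : ℝ)..π, φ (sin x ^ 2) := by
    have := intervalIntegral.integral_comp_sub_left (a := 0) (b := π)
      (fun x => φ (sin x ^ 2)) (2 * π)
    simp only [sin_two_pi_sub, neg_sq, sub_zero, show 2 * π - π = π by ring] at this
    exact this.symm
  rw [← intervalIntegral.integral_add_adjacent_intervals (hi 0 π) (hi π (2 * π)), h2,
    ← intervalIntegral.integral_add_adjacent_intervals (hi 0 (π / 2)) (hi (π / 2) π), h1]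
  ring

lemma unduloidLength_eq_four_mul (c y : ℝ) : unduloidLength c y =
    4 * ∫ x in (0 : ℝ)..π / 2, √(y ^ 2 * sin x ^ 2 + (c - 1) * (2 * y + (c - 1))) := by
  rw [← integral_eq_four_mul_of_sin_sq
    (φ := fun s => √(y ^ 2 * s + (c - 1) * (2 * y + (c - 1)))) (by fun_prop), unduloidLength]
  congr 1
  funext x
  rw [cos_sq']
  ring_nf

lemma nodoidLength_eq_four_mul {c : ℝ} (hc : 1 < c) : nodoidLength c =
    4 * ∫ x in (0 : ℝ)..π / 2, sin x ^ 2 / √(sin x ^ 2 + (c ^ 2 - 1)) := by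
  have e : ∀ x, c ^ 2 - 1 ^ 2 * cos x ^ 2 = sin x ^ 2 + (c ^ 2 - 1) := fun x => by
    rw [cos_sq']; ring
  have := continuous_nodoidLength_integrand hc
  simp only [e] at this
  rw [← integral_eq_four_mul_of_sin_sq (φ := fun s => s / √(s + (c ^ 2 - 1))) this, nodoidLength]
  simp only [e]

lemma integral_sin_quarter : ∫ x in (0 : ℝ)..π / 2, sin x = 1 := by
  simp [integral_sin]

section

variable {b : ℝ}

lemma continuous_sin_sq_div (hb : 0 < b) : Continuous fun x : ℝ => sin x ^ 2 / √(sin x ^ 2 + b ^ 2) :=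
  Continuous.div (by fun_prop) (by fun_prop) fun x => (sqrt_pos.2 (by positivity)).ne'

lemma sin_nonneg_of_mem_quarter {x : ℝ} (hx : x ∈ Icc 0 (π / 2)) : 0 ≤ sin x :=
  sin_nonneg_of_nonneg_of_le_pi hx.1 (by linarith [hx.2, pi_pos])

lemma cos_nonneg_of_mem_quarter {x : ℝ} (hx : x ∈ Icc 0 (π / 2)) : 0 ≤ cos x :=
  cos_nonneg_of_neg_pi_div_two_le_of_le (by linarith [hx.1, pi_pos]) hx.2

/-- Comparing with the integral of sin x, the pointwise deficit s (q - s)/q with q = √(s^2 + b^2)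
never exceeds b. This crude rate is enough to force y to 1. -/
lemma one_sub_integral_sin_sq_div_le (hb : 0 < b) :
    1 - ∫ x in (0 : ℝ)..π / 2, sin x ^ 2 / √(sin x ^ 2 + b ^ 2) ≤ π / 2 * b := by
  have hi := (continuous_sin_sq_div hb).intervalIntegrable (μ := volume) 0 (π / 2)
  have h : ∫ x in (0 : ℝ)..π / 2, (sin x - sin x ^ 2 / √(sin x ^ 2 + b ^ 2)) ≤
      ∫ _ in (0 : ℝ)..π / 2, b := by
    refine intervalIntegral.integral_mono_on (by positivity)
      ((continuous_sin.intervalIntegrable _ _).sub hi) intervalIntegrable_const fun x hx => ?_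
    have hs := sin_nonneg_of_mem_quarter hx
    set s := sin x
    have hq : 0 < √(s ^ 2 + b ^ 2) := sqrt_pos.2 (by positivity)
    have hq2 := sq_sqrt (show 0 ≤ s ^ 2 + b ^ 2 by positivity)
    have hqb : b ≤ √(s ^ 2 + b ^ 2) := le_sqrt_of_sq_le (by nlinarith)
    have hqs : s ≤ √(s ^ 2 + b ^ 2) := le_sqrt_of_sq_le (by nlinarith)
    set q := √(s ^ 2 + b ^ 2)
    rw [sub_le_iff_le_add, ← sub_le_iff_le_add', le_div_iff₀ hq]
    nlinarith
  rw [intervalIntegral.integral_sub (continuous_sin.intervalIntegrable _ _) hi,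
    integral_sin_quarter] at h
  simp only [intervalIntegral.integral_const, smul_eq_mul, sub_zero] at h
  exact h

/-- The deficit equals s b^2 / (q (q + s)) with q = √(s^2 + b^2) ≤ s + b. Multiplying by cos x ≤ 1
and splitting into partial fractions gives an explicit logarithmic antiderivative. -/
lemma le_one_sub_integral_sin_sq_div (hb : 0 < b) :
    b ^ 2 * (log (1 + b) - log b - (log (2 + b) - log b) / 2) ≤
      1 - ∫ x in (0 : ℝ)..π / 2, sin x ^ 2 / √(sin x ^ 2 + b ^ 2) := by
  have hi := (continuous_sin_sq_div hb).intervalIntegrable (μ := volume) 0 (π / 2)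
  have hpos : ∀ x ∈ Icc 0 (π / 2), 0 < sin x + b ∧ 0 < 2 * sin x + b := fun x hx => by
    have := sin_nonneg_of_mem_quarter hx
    constructor <;> positivity
  have hd : ∀ x ∈ uIcc 0 (π / 2), HasDerivAt
      (fun x => b ^ 2 * (log (sin x + b) - log (2 * sin x + b) / 2))
      (b ^ 2 * (cos x / (sin x + b) - 2 * cos x / (2 * sin x + b) / 2)) x := fun x hx => by
    rw [uIcc_of_le (by positivity)] at hx
    obtain ⟨h1, h2⟩ := hpos x hx
    exact ((((hasDerivAt_sin x).add_const b).log h1.ne').sub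
      (((((hasDerivAt_sin x).const_mul 2).add_const b).log h2.ne').div_const 2)).const_mul _
  have hcont : ContinuousOn
      (fun x => b ^ 2 * (cos x / (sin x + b) - 2 * cos x / (2 * sin x + b) / 2))
      (uIcc 0 (π / 2)) := by
    rw [uIcc_of_le (by positivity)]
    refine continuousOn_const.mul (ContinuousOn.sub (ContinuousOn.div (by fun_prop) (by fun_prop)
      fun x hx => (hpos x hx).1.ne') (ContinuousOn.div_const (ContinuousOn.div (by fun_prop)
      (by fun_prop) fun x hx => (hpos x hx).2.ne') _))
  have h : ∫ x in (0 : ℝ)..π / 2,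
      (b ^ 2 * (cos x / (sin x + b) - 2 * cos x / (2 * sin x + b) / 2)) ≤
      ∫ x in (0 : ℝ)..π / 2, (sin x - sin x ^ 2 / √(sin x ^ 2 + b ^ 2)) := by
    refine intervalIntegral.integral_mono_on (by positivity) hcont.intervalIntegrable
      ((continuous_sin.intervalIntegrable _ _).sub hi) fun x hx => ?_
    have hs := sin_nonneg_of_mem_quarter hx
    have hk := cos_nonneg_of_mem_quarter hx
    have hk1 := cos_le_one x
    obtain ⟨h1, h2⟩ := hpos x hx
    set s := sin x
    have hq : 0 < √(s ^ 2 + b ^ 2) := sqrt_pos.2 (by positivity)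
    have hq2 := sq_sqrt (show 0 ≤ s ^ 2 + b ^ 2 by positivity)
    have hqs : √(s ^ 2 + b ^ 2) ≤ s + b := by
      rw [sqrt_le_left h1.le]
      nlinarith
    set q := √(s ^ 2 + b ^ 2)
    have e1 : b ^ 2 * (cos x / (s + b) - 2 * cos x / (2 * s + b) / 2) =
        cos x * (s * b ^ 2 / ((s + b) * (2 * s + b))) := by
      field_simp
      ring
    have e2 : s - s ^ 2 / q = s * b ^ 2 / (q * (q + s)) := by
      have : q + s ≠ 0 := by positivity
      field_simp
      linear_combination s * hq2
    rw [e1, e2]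
    calc cos x * (s * b ^ 2 / ((s + b) * (2 * s + b)))
        ≤ 1 * (s * b ^ 2 / ((s + b) * (2 * s + b))) :=
          mul_le_mul_of_nonneg_right hk1 (by positivity)
      _ = s * b ^ 2 / ((s + b) * (2 * s + b)) := one_mul _
      _ ≤ s * b ^ 2 / (q * (q + s)) := by
          refine div_le_div_of_nonneg_left (by positivity) (by positivity) ?_
          exact mul_le_mul hqs (by linarith) (by positivity) h1.le
  rw [intervalIntegral.integral_eq_sub_of_hasDerivAt hd hcont.intervalIntegrable,
    intervalIntegral.integral_sub (continuous_sin.intervalIntegrable _ _) hi,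
    integral_sin_quarter, sin_pi_div_two, sin_zero] at h
  refine le_trans (le_of_eq ?_) h
  ring_nf

lemma integral_sqrt_sub_le {y β : ℝ} (hy : 0 < y) (hβ : 0 < β) :
    (∫ x in (0 : ℝ)..π / 2, √(y ^ 2 * sin x ^ 2 + β)) - y ≤ π / 2 * √β := by
  have h : ∫ x in (0 : ℝ)..π / 2, √(y ^ 2 * sin x ^ 2 + β) ≤
      ∫ x in (0 : ℝ)..π / 2, (y * sin x + √β) := by
    refine intervalIntegral.integral_mono_on (by positivity)
      (Continuous.intervalIntegrable (by fun_prop) _ _)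
      (Continuous.intervalIntegrable (by fun_prop) _ _) fun x hx => ?_
    have hs := sin_nonneg_of_mem_quarter hx
    have hq2 := sq_sqrt hβ.le
    rw [sqrt_le_left (by positivity)]
    nlinarith [mul_nonneg (mul_nonneg hy.le hs) (sqrt_nonneg β)]
  rw [intervalIntegral.integral_add (Continuous.intervalIntegrable (by fun_prop) _ _)
    intervalIntegrable_const, intervalIntegral.integral_const_mul, integral_sin_quarter] at h
  simp only [intervalIntegral.integral_const, smul_eq_mul, sub_zero] at h
  linarith

/-- With q the square root in the integrand, q - y sin x = β / (q + y sin x) ≥ β cos x / (2 y sin x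
+ √β), and the last expression integrates to a logarithm. -/
lemma le_integral_sqrt_sub {y β : ℝ} (hy : 0 < y) (hβ : 0 < β) :
    β / (2 * y) * (log (2 * y + √β) - log √β) ≤
      (∫ x in (0 : ℝ)..π / 2, √(y ^ 2 * sin x ^ 2 + β)) - y := by
  have hr := sqrt_pos.2 hβ
  have hr2 := sq_sqrt hβ.le
  have hpos : ∀ x ∈ Icc 0 (π / 2), 0 < 2 * y * sin x + √β := fun x hx => by
    have := sin_nonneg_of_mem_quarter hx
    positivity
  have hd : ∀ x ∈ uIcc 0 (π / 2), HasDerivAt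
      (fun x => β / (2 * y) * log (2 * y * sin x + √β))
      (β / (2 * y) * (2 * y * cos x / (2 * y * sin x + √β))) x := fun x hx => by
    rw [uIcc_of_le (by positivity)] at hx
    exact ((((hasDerivAt_sin x).const_mul (2 * y)).add_const _).log (hpos x hx).ne').const_mul _
  have hcont : ContinuousOn
      (fun x => β / (2 * y) * (2 * y * cos x / (2 * y * sin x + √β))) (uIcc 0 (π / 2)) := by
    rw [uIcc_of_le (by positivity)]
    exact continuousOn_const.mul (ContinuousOn.div (by fun_prop) (by fun_prop)
      fun x hx => (hpos x hx).ne')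
  have h : ∫ x in (0 : ℝ)..π / 2, (β / (2 * y) * (2 * y * cos x / (2 * y * sin x + √β))) ≤
      ∫ x in (0 : ℝ)..π / 2, (√(y ^ 2 * sin x ^ 2 + β) - y * sin x) := by
    refine intervalIntegral.integral_mono_on (by positivity) hcont.intervalIntegrable
      (Continuous.intervalIntegrable (by fun_prop) _ _) fun x hx => ?_
    have hs := sin_nonneg_of_mem_quarter hx
    have hk1 := cos_le_one x
    have hp := hpos x hx
    set s := sin x
    have hys := mul_nonneg hy.le hs
    have hq : 0 < √(y ^ 2 * s ^ 2 + β) := sqrt_pos.2 (by positivity)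
    have hq2 := sq_sqrt (show 0 ≤ y ^ 2 * s ^ 2 + β by positivity)
    have hqs : √(y ^ 2 * s ^ 2 + β) ≤ y * s + √β := by
      rw [sqrt_le_left (by positivity)]
      nlinarith [mul_nonneg hys hr.le]
    have hqy : y * s ≤ √(y ^ 2 * s ^ 2 + β) := le_sqrt_of_sq_le (by nlinarith)
    set q := √(y ^ 2 * s ^ 2 + β)
    have e1 : β / (2 * y) * (2 * y * cos x / (2 * y * s + √β)) =
        cos x * β / (2 * y * s + √β) := by
      field_simp
    rw [e1, div_le_iff₀ hp]
    calc cos x * β ≤ 1 * β := mul_le_mul_of_nonneg_right hk1 hβ.le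
      _ = (q - y * s) * (q + y * s) := by linear_combination (-1 : ℝ) * hq2
      _ ≤ (q - y * s) * (2 * y * s + √β) :=
          mul_le_mul_of_nonneg_left (by linarith) (by linarith)
  rw [intervalIntegral.integral_eq_sub_of_hasDerivAt hd hcont.intervalIntegrable,
    intervalIntegral.integral_sub (Continuous.intervalIntegrable (by fun_prop) _ _)
      (Continuous.intervalIntegrable (by fun_prop) _ _), intervalIntegral.integral_const_mul,
    integral_sin_quarter, sin_pi_div_two, sin_zero] at h
  refine le_trans (le_of_eq ?_) (h.trans (by rw [mul_one]))
  ring_nf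

end

section

variable {c y : ℝ}

/-- In the limit the quarter integrals become those of sin x and y sin x, that is 1 and y. So 1 - y
is the nodoid's deficit plus the unduloid's excess. -/
lemma one_sub_eq_of_unduloidLength_eq (hc : 1 < c) (h : unduloidLength c y = nodoidLength c) :
    1 - y = (1 - ∫ x in (0 : ℝ)..π / 2, sin x ^ 2 / √(sin x ^ 2 + √(c ^ 2 - 1) ^ 2)) +
      ((∫ x in (0 : ℝ)..π / 2, √(y ^ 2 * sin x ^ 2 + (c - 1) * (2 * y + (c - 1)))) - y) := by
  rw [unduloidLength_eq_four_mul, nodoidLength_eq_four_mul hc] at h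
  rw [sq_sqrt (by nlinarith)]
  linarith

lemma one_sub_le_of_unduloidLength_eq (hc : 1 < c) (hy : 0 < y)
    (h : unduloidLength c y = nodoidLength c) : 1 - y ≤ π * √(c ^ 2 - 1) := by
  have hb : 0 < c ^ 2 - 1 := by nlinarith
  have hy1 := lt_one_of_unduloidLength_eq hc hy h
  have h1 := one_sub_integral_sin_sq_div_le (sqrt_pos.2 hb)
  have hβ : 0 < (c - 1) * (2 * y + (c - 1)) := mul_pos (by linarith) (by linarith)
  have h2 := integral_sqrt_sub_le hy hβ
  have h3 : √((c - 1) * (2 * y + (c - 1))) ≤ √(c ^ 2 - 1) := sqrt_le_sqrt (by nlinarith)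
  have h4 := mul_le_mul_of_nonneg_left h3 (show 0 ≤ π / 2 by positivity)
  rw [one_sub_eq_of_unduloidLength_eq hc h]
  linarith

/-- Deficit and excess each contribute (c - 1)/2 times -log (c - 1) to leading order: both c^2 - 1
and the constant in the unduloid's radicand lie below 3 (c - 1). The condition on the logarithm
keeps the lower brackets nonnegative, so that the prefactors may be bounded below too. -/
lemma le_one_sub_of_unduloidLength_eq (hc : 1 < c) (hy : 1 / 2 ≤ y)
    (h : unduloidLength c y = nodoidLength c) (hc' : c - 1 ≤ 2 / 5)
    (hlog : 3 * log 3 ≤ -log (c - 1)) :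
    (c - 1) * (-log (c - 1) - 2 * log 3) ≤ 1 - y := by
  have hy0 : 0 < y := by linarith
  have hy1 := lt_one_of_unduloidLength_eq hc hy0 h
  set e := c - 1 with he
  have he0 : 0 < e := by simp only [he]; linarith
  have hbe : c ^ 2 - 1 = e * (2 + e) := by simp only [he]; ring
  have hb : 0 < c ^ 2 - 1 := by nlinarith
  have hb2 := sq_sqrt hb.le
  have hb0 := sqrt_pos.2 hb
  have hb1 : √(c ^ 2 - 1) ≤ 1 := by
    rw [sqrt_le_left zero_le_one]
    nlinarith
  have hβ : 0 < e * (2 * y + e) := mul_pos he0 (by linarith)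
  have hr := sqrt_pos.2 hβ
  have h1 := le_one_sub_integral_sin_sq_div (sqrt_pos.2 hb)
  have h2 := le_integral_sqrt_sub hy0 hβ
  have hlog3 : log (3 * e) = log 3 + log e := log_mul (by norm_num) he0.ne'
  have hl1 : log √(c ^ 2 - 1) ≤ (log 3 + log e) / 2 := by
    rw [log_sqrt hb.le, ← hlog3]
    have : log (c ^ 2 - 1) ≤ log (3 * e) := log_le_log hb (by nlinarith)
    linarith
  have hl2 : log √(e * (2 * y + e)) ≤ (log 3 + log e) / 2 := by
    rw [log_sqrt hβ.le, ← hlog3]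
    have : log (e * (2 * y + e)) ≤ log (3 * e) := log_le_log hβ (by nlinarith)
    linarith
  have hl3 : log (2 + √(c ^ 2 - 1)) ≤ log 3 := log_le_log (by positivity) (by linarith)
  have hl4 : 0 ≤ log (1 + √(c ^ 2 - 1)) := log_nonneg (by linarith)
  have hl5 : 0 ≤ log (2 * y + √(e * (2 * y + e))) := log_nonneg (by linarith)
  have hl30 : 0 ≤ log 3 := log_nonneg (by norm_num)
  have h3 : e / 2 * (-log e - 3 * log 3) ≤ √(c ^ 2 - 1) ^ 2 * (log (1 + √(c ^ 2 - 1)) -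
      log √(c ^ 2 - 1) - (log (2 + √(c ^ 2 - 1)) - log √(c ^ 2 - 1)) / 2) := by
    have hA : (-log e - 3 * log 3) / 4 ≤ log (1 + √(c ^ 2 - 1)) -
      log √(c ^ 2 - 1) - (log (2 + √(c ^ 2 - 1)) - log √(c ^ 2 - 1)) / 2 := by linarith
    calc e / 2 * (-log e - 3 * log 3) = 2 * e * ((-log e - 3 * log 3) / 4) := by ring
      _ ≤ √(c ^ 2 - 1) ^ 2 * ((-log e - 3 * log 3) / 4) := by
          refine mul_le_mul_of_nonneg_right ?_ (by linarith)
          rw [hb2, hbe]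
          nlinarith
      _ ≤ _ := mul_le_mul_of_nonneg_left hA (sq_nonneg _)
  have h4 : e / 2 * (-log e - log 3) ≤ e * (2 * y + e) / (2 * y) *
      (log (2 * y + √(e * (2 * y + e))) - log √(e * (2 * y + e))) := by
    have hA : (-log e - log 3) / 2 ≤
      log (2 * y + √(e * (2 * y + e))) - log √(e * (2 * y + e)) := by linarith
    calc e / 2 * (-log e - log 3) = e * ((-log e - log 3) / 2) := by ring
      _ ≤ e * (2 * y + e) / (2 * y) * ((-log e - log 3) / 2) := by
          refine mul_le_mul_of_nonneg_right ?_ (by linarith)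
          rw [le_div_iff₀ (by positivity)]
          nlinarith
      _ ≤ _ := mul_le_mul_of_nonneg_left hA (by positivity)
  rw [one_sub_eq_of_unduloidLength_eq hc h, ← he]
  linarith

end

/-! ### Embeddedness of the profile curve -/

section

variable {a y : ℝ}

lemma unduloidF_pi (hy : 0 < y) (hya : y < a) : unduloidF a y π = a + y := by
  have h1 := sqrt_pos.2 (sq_sub_sq_pos hy hya)
  simp only [unduloidF, cos_pi]
  have : a ^ 2 - y ^ 2 * (-1) ^ 2 = a ^ 2 - y ^ 2 := by ring
  rw [this]
  field_simp
  ring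

lemma strictMonoOn_unduloidF (hy : 0 < y) (hya : y < a) :
    StrictMonoOn (unduloidF a y) (Icc 0 π) := by
  refine strictMonoOn_of_deriv_pos (convex_Icc _ _) (continuous_unduloidF hy hya).continuousOn
    fun x hx => ?_
  rw [interior_Icc] at hx
  rw [(hasDerivAt_unduloidF hy hya x).deriv]
  have h1 := sin_pos_of_mem_Ioo hx
  have h2 := tangentScale_pos hy hya x
  have h3 : 0 < a := hy.trans hya
  positivity

lemma strictMono_unduloidG (hy : 0 < y) (hya : y < a) : StrictMono (unduloidG a y) := by
  refine strictMono_of_deriv_pos fun x => ?_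
  rw [(hasDerivAt_unduloidG hy hya x).deriv]
  have h1 := sqrt_pos.2 (sq_sub_sq_pos hy hya)
  have h2 := tangentScale_pos hy hya x
  have h3 : 0 < a := hy.trans hya
  positivity

lemma tangentScale_two_pi_sub (a y t : ℝ) : tangentScale a y (2 * π - t) = tangentScale a y t := by
  simp [tangentScale, cos_two_pi_sub, unduloidF_two_pi_sub]

/-- A derivative symmetric about π makes the function antisymmetric about its value at π. Together
with the even radius this is the mirror symmetry of both arcs. -/
lemma add_comp_two_pi_sub_eq {G G' : ℝ → ℝ} (hG : ∀ t, HasDerivAt G (G' t) t)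
    (hG' : ∀ t, G' (2 * π - t) = G' t) (t : ℝ) : G t + G (2 * π - t) = G 0 + G (2 * π) := by
  have hd : ∀ t, HasDerivAt (fun t => G t + G (2 * π - t)) 0 t := fun t => by
    refine ((hG t).add ((hG (2 * π - t)).comp_const_sub (2 * π) t)).congr_deriv ?_
    rw [hG']
    ring
  have := is_const_of_deriv_eq_zero (fun t => (hd t).differentiableAt) (fun t => (hd t).deriv) t 0
  simpa using this

lemma unduloidG_two_pi_sub (hy : 0 < y) (hya : y < a) (t : ℝ) :
    unduloidG a y (2 * π - t) = unduloidG a y (2 * π) - unduloidG a y t := by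
  have := add_comp_two_pi_sub_eq (hasDerivAt_unduloidG hy hya)
    (fun t => by rw [tangentScale_two_pi_sub]) t
  rw [unduloidG_zero] at this
  linarith

end

/-! ### Injectivity of the nodoid arc. -/

section

variable {c : ℝ}

lemma nodoidG_two_pi_sub (hc : 1 < c) (t : ℝ) :
    nodoidG 1 c (2 * π - t) = nodoidG 1 c (2 * π) - nodoidG 1 c t := by
  have := add_comp_two_pi_sub_eq (hasDerivAt_nodoidG hc)
    (fun t => by rw [tangentScale_two_pi_sub, cos_two_pi_sub]) t
  rw [nodoidG_zero] at this
  linarith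

lemma nodoidG_pi (hc : 1 < c) : nodoidG 1 c π = -nodoidLength c / 2 := by
  have := nodoidG_two_pi_sub hc π
  rw [nodoidG_two_pi hc, show 2 * π - π = π by ring] at this
  linarith

lemma nodoidG_nonneg (hc : 1 < c) {t : ℝ} (ht : t ∈ Icc 0 (π / 2)) : 0 ≤ nodoidG 1 c t := by
  have hm : MonotoneOn (nodoidG 1 c) (Icc 0 (π / 2)) := by
    refine monotoneOn_of_deriv_nonneg (convex_Icc _ _)
      (fun x _ => (hasDerivAt_nodoidG hc x).continuousAt.continuousWithinAt)
      (fun x _ => (hasDerivAt_nodoidG hc x).differentiableAt.differentiableWithinAt) fun x hx => ?_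
    rw [interior_Icc] at hx
    rw [(hasDerivAt_nodoidG hc x).deriv]
    have := cos_nonneg_of_mem_quarter (Ioo_subset_Icc_self hx)
    have := tangentScale_pos one_pos hc x
    positivity
  rw [← nodoidG_zero 1 c]
  exact hm ⟨le_rfl, by positivity⟩ ht ht.1

/-- On the first quarter the height is nonnegative while its value at π is negative; on the second
quarter it decreases strictly. -/
lemma nodoidG_pi_lt (hc : 1 < c) {t : ℝ} (ht : t ∈ Ico 0 π) : nodoidG 1 c π < nodoidG 1 c t := by
  have hL : 0 < nodoidLength c := lt_of_lt_of_le (by positivity) (pi_div_le_nodoidLength hc)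
  rcases le_total t (π / 2) with h | h
  · have := nodoidG_nonneg hc ⟨ht.1, h⟩
    rw [nodoidG_pi hc]
    linarith
  · have hm : StrictAntiOn (nodoidG 1 c) (Icc (π / 2) π) := by
      refine strictAntiOn_of_deriv_neg (convex_Icc _ _)
        (fun x _ => (hasDerivAt_nodoidG hc x).continuousAt.continuousWithinAt) fun x hx => ?_
      rw [interior_Icc] at hx
      rw [(hasDerivAt_nodoidG hc x).deriv]
      have h1 := cos_neg_of_pi_div_two_lt_of_lt hx.1 (by linarith [hx.2, pi_pos])
      have h2 := tangentScale_pos one_pos hc x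
      have h3 := sqrt_pos.2 (sq_sub_sq_pos one_pos hc)
      exact mul_neg_of_neg_of_pos (mul_neg_of_pos_of_neg h3 h1) h2
    exact hm ⟨h, ht.2.le⟩ ⟨by linarith [pi_pos], le_rfl⟩ ht.2

/-- The radius fixes the parameter up to reflection about π. A coincidence with the reflected point
would lie on the plane of symmetry, which half an arc reaches only at π. -/
lemma nodoid_eq_of_mem_Icc_pi (hc : 1 < c) {s t : ℝ} (hs : s ∈ Icc 0 (2 * π))
    (ht : t ∈ Icc 0 π) (hF : nodoidF 1 c s = nodoidF 1 c t)
    (hG : nodoidG 1 c s = nodoidG 1 c t) : s = t := by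
  simp only [nodoidF_one] at hF
  have hm := strictMonoOn_unduloidF one_pos hc
  rcases le_total s π with h | h
  · exact hm.injOn ⟨hs.1, h⟩ ht hF
  · rw [← unduloidF_two_pi_sub c 1 s] at hF
    have hst := hm.injOn ⟨by linarith [hs.2], by linarith⟩ ht hF
    have h2 := nodoidG_two_pi_sub hc s
    rw [hst, hG, nodoidG_two_pi hc] at h2
    have h3 : t = π := by
      by_contra hne
      have := nodoidG_pi_lt hc ⟨ht.1, lt_of_le_of_ne ht.2 hne⟩
      rw [nodoidG_pi hc] at this
      linarith
    linarith

lemma nodoid_injOn (hc : 1 < c) {s t : ℝ} (hs : s ∈ Icc 0 (2 * π)) (ht : t ∈ Icc 0 (2 * π))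
    (hF : nodoidF 1 c s = nodoidF 1 c t) (hG : nodoidG 1 c s = nodoidG 1 c t) : s = t := by
  rcases le_total t π with h | h
  · exact nodoid_eq_of_mem_Icc_pi hc hs ⟨ht.1, h⟩ hF hG
  · have := nodoid_eq_of_mem_Icc_pi hc (s := 2 * π - s) (t := 2 * π - t)
      ⟨by linarith [hs.2], by linarith [hs.1]⟩ ⟨by linarith [ht.2], by linarith⟩
      (by simpa only [nodoidF_one, unduloidF_two_pi_sub] using hF)
      (by rw [nodoidG_two_pi_sub hc, nodoidG_two_pi_sub hc, hG])
    linarith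

/-- The parameter in `[0, π]` at which the nodoid has radius `ρ`. -/
def nodoidParam (c ρ : ℝ) : ℝ := arccos (c * (c ^ 2 - 1 - ρ ^ 2) / (c ^ 2 - 1 + ρ ^ 2))

lemma nodoidParam_arg_mem (hc : 1 < c) {ρ : ℝ} (hρ : ρ ∈ Ioo (c - 1) (c + 1)) :
    c * (c ^ 2 - 1 - ρ ^ 2) / (c ^ 2 - 1 + ρ ^ 2) ∈ Ioo (-1) 1 := by
  have h1 : 0 < c ^ 2 - 1 + ρ ^ 2 := by nlinarith
  have h2 : 0 < ρ ^ 2 - (c - 1) ^ 2 := by nlinarith [hρ.1]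
  have h3 : 0 < (c + 1) ^ 2 - ρ ^ 2 := by nlinarith [hρ.1, hρ.2]
  constructor
  · rw [lt_div_iff₀ h1]
    nlinarith
  · rw [div_lt_iff₀ h1]
    nlinarith

lemma nodoidParam_mem (hc : 1 < c) {ρ : ℝ} (hρ : ρ ∈ Ioo (c - 1) (c + 1)) :
    nodoidParam c ρ ∈ Ioo 0 π := by
  obtain ⟨h1, h2⟩ := nodoidParam_arg_mem hc hρ
  exact ⟨arccos_pos.2 h2, arccos_lt_pi.2 h1⟩

lemma cos_nodoidParam (hc : 1 < c) {ρ : ℝ} (hρ : ρ ∈ Ioo (c - 1) (c + 1)) :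
    cos (nodoidParam c ρ) = c * (c ^ 2 - 1 - ρ ^ 2) / (c ^ 2 - 1 + ρ ^ 2) := by
  obtain ⟨h1, h2⟩ := nodoidParam_arg_mem hc hρ
  exact cos_arccos h1.le h2.le

lemma nodoidParam_sub_one (hc : 1 < c) : nodoidParam c (c - 1) = 0 := by
  have h : c ^ 2 - 1 + (c - 1) ^ 2 ≠ 0 := by nlinarith
  rw [nodoidParam, arccos_eq_zero, one_le_div (by nlinarith)]
  nlinarith

lemma unduloidF_nodoidParam (hc : 1 < c) {ρ : ℝ} (hρ : ρ ∈ Ioo (c - 1) (c + 1)) :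
    unduloidF c 1 (nodoidParam c ρ) = ρ := by
  have hρ0 : 0 < ρ := by linarith [hρ.1]
  refine (pow_left_inj₀ (unduloidF_pos one_pos hc _).le hρ0.le two_ne_zero).1 ?_
  have hw := add_mul_cos_pos one_pos hc (nodoidParam c ρ)
  have h1 : 0 < c ^ 2 - 1 + ρ ^ 2 := by nlinarith
  rw [unduloidF_sq one_pos hc, div_eq_iff hw.ne', cos_nodoidParam hc hρ]
  field_simp
  ring

lemma differentiableAt_nodoidParam (hc : 1 < c) {ρ : ℝ} (hρ : ρ ∈ Ioo (c - 1) (c + 1)) :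
    DifferentiableAt ℝ (nodoidParam c) ρ := by
  obtain ⟨h1, h2⟩ := nodoidParam_arg_mem hc hρ
  have h3 : c ^ 2 - 1 + ρ ^ 2 ≠ 0 := by nlinarith
  refine DifferentiableAt.comp (g := arccos) ρ (differentiableAt_arccos.2 ⟨h1.ne', h2.ne⟩) ?_
  exact DifferentiableAt.div (by fun_prop) (by fun_prop) h3

lemma continuous_nodoidParam (hc : 1 < c) : Continuous (nodoidParam c) := by
  refine continuous_arccos.comp (Continuous.div (by fun_prop) (by fun_prop) fun ρ => ?_)
  nlinarith

end

/-! ### The two arcs meet only at their ends. -/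

section

variable {c a y : ℝ}

/-- At a common radius ρ the unit tangents have axial components (ρ^2 + p^2)/(2 a ρ) on the unduloid
and (q^2 - ρ^2)/(2 ρ) on the nodoid, where p^2 = a^2 - y^2 and q^2 = c^2 - 1. When the nodoid runs
backwards, a ≤ 1 makes the first larger than the negative of the second. Both radial components are
positive, so the slopes are ordered. -/
lemma slope_compare (hc : 1 < c) (hy : 0 < y) (hya : y < a) (ha : a ≤ 1) {s t : ℝ}
    (hs : s ∈ Ioo 0 π) (ht : t ∈ Ioo 0 π) (hF : unduloidF a y s = unduloidF c 1 t) :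
    0 < √(a ^ 2 - y ^ 2) * (c * sin t) + √(c ^ 2 - 1 ^ 2) * cos t * (y * sin s) := by
  have hss := sin_pos_of_mem_Ioo hs
  have hst := sin_pos_of_mem_Ioo ht
  have hu := sq_sub_sq_pos hy hya
  have hn := sq_sub_sq_pos one_pos hc
  have hbu := sqrt_pos.2 hu
  have hbn := sqrt_pos.2 hn
  rcases le_or_gt 0 (cos t) with h | h
  · have : 0 < √(a ^ 2 - y ^ 2) * (c * sin t) := by positivity
    have : 0 ≤ √(c ^ 2 - 1 ^ 2) * cos t * (y * sin s) := by positivity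
    linarith
  · have hwu := add_mul_cos_pos hy hya s
    have hwn := add_mul_cos_pos one_pos hc t
    have eu := unduloidF_sq hy hya s
    have en := unduloidF_sq one_pos hc t
    rw [hF, eq_div_iff hwu.ne'] at eu
    rw [eq_div_iff hwn.ne'] at en
    have hρ := unduloidF_pos one_pos hc t
    set ρ := unduloidF c 1 t
    rw [← sq_sqrt hu.le] at eu
    rw [← sq_sqrt hn.le] at en
    have hu2 := sq_sqrt hu.le
    have hn2 := sq_sqrt hn.le
    set p := √(a ^ 2 - y ^ 2)
    set q := √(c ^ 2 - 1 ^ 2)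
    have hwu2 : (a + y * cos s) * (ρ ^ 2 + p ^ 2) = 2 * a * p ^ 2 := by linear_combination eu
    have hwn2 : (c + 1 * cos t) * (ρ ^ 2 - q ^ 2) = -2 * q ^ 2 * cos t := by linear_combination en
    have hρq : 0 < ρ ^ 2 - q ^ 2 := by
      have : 0 < (c + 1 * cos t) * (ρ ^ 2 - q ^ 2) := by
        rw [hwn2]
        nlinarith [sq_pos_of_pos hbn]
      exact (mul_pos_iff_of_pos_left hwn).1 this
    -- The comparison of axial components, cleared of denominators.
    have key : q ^ 2 * (-cos t) * (a + y * cos s) < p ^ 2 * (c + 1 * cos t) := by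
      have h1 : 0 < ρ ^ 2 + p ^ 2 := by positivity
      have h2 : a * (ρ ^ 2 - q ^ 2) < ρ ^ 2 + p ^ 2 := by
        nlinarith [sq_pos_of_pos hbu, sq_pos_of_pos hbn]
      refine lt_of_mul_lt_mul_right ?_ h1.le
      calc q ^ 2 * (-cos t) * (a + y * cos s) * (ρ ^ 2 + p ^ 2)
          = p ^ 2 * (c + 1 * cos t) * (a * (ρ ^ 2 - q ^ 2)) := by
            linear_combination q ^ 2 * (-cos t) * hwu2 - a * p ^ 2 * hwn2
        _ < p ^ 2 * (c + 1 * cos t) * (ρ ^ 2 + p ^ 2) :=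
            mul_lt_mul_of_pos_left h2 (by positivity)
    -- The squared lengths of the tangent directions (y sin s, p) and (c sin t, q cos t), needed to
    -- pass from unit tangents to slopes.
    have hDu : (p ^ 2 + y ^ 2 * sin s ^ 2) * p ^ 2 = ρ ^ 2 * (a + y * cos s) ^ 2 := by
      rw [sin_sq]
      linear_combination (-(a + y * cos s)) * eu + p ^ 2 * hu2
    have hDn : (q ^ 2 * cos t ^ 2 + c ^ 2 * sin t ^ 2) * q ^ 2 = ρ ^ 2 * (c + 1 * cos t) ^ 2 := by
      rw [sin_sq]
      linear_combination (-(c + 1 * cos t)) * en + q ^ 2 * cos t ^ 2 * hn2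
    have hsq : (q * (-cos t) * (y * sin s)) ^ 2 < (p * (c * sin t)) ^ 2 := by
      have h3 : (q ^ 2 * (-cos t) * (a + y * cos s)) ^ 2 < (p ^ 2 * (c + 1 * cos t)) ^ 2 :=
        pow_lt_pow_left₀ key (by
          have : 0 < -cos t := by linarith
          positivity) two_ne_zero
      have h4 := mul_lt_mul_of_pos_left h3 (sq_pos_of_pos hρ)
      have e3 : ρ ^ 2 * (q ^ 2 * (-cos t) * (a + y * cos s)) ^ 2 =
          p ^ 2 * q ^ 2 * (q ^ 2 * cos t ^ 2 * (p ^ 2 + y ^ 2 * sin s ^ 2)) := by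
        linear_combination (-(q ^ 4 * cos t ^ 2)) * hDu
      have e4 : ρ ^ 2 * (p ^ 2 * (c + 1 * cos t)) ^ 2 =
          p ^ 2 * q ^ 2 * (p ^ 2 * (q ^ 2 * cos t ^ 2 + c ^ 2 * sin t ^ 2)) := by
        linear_combination (-(p ^ 4)) * hDn
      rw [e3, e4] at h4
      have h5 := lt_of_mul_lt_mul_left h4 (by positivity)
      linarith
    have := lt_of_pow_lt_pow_left₀ 2 (by
      have : 0 < c := by linarith
      positivity) hsq
    linarith

/-- With the nodoid's parameter taken as a function of the common radius, the sum of the heights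
vanishes at the minimum and has positive derivative by `slope_compare`. -/
lemma unduloidG_add_nodoidG_pos (hc : 1 < c) (hy : 0 < y) (hya : y < a) (ha : a ≤ 1)
    (hac : a - y = c - 1) {s t : ℝ} (hs : s ∈ Ioc 0 π) (ht : t ∈ Icc 0 π)
    (hF : unduloidF a y s = unduloidF c 1 t) : 0 < unduloidG a y s + nodoidG 1 c t := by
  have hm := strictMonoOn_unduloidF hy hya
  have hmem : ∀ x ∈ Ioc 0 π, unduloidF a y x ∈ Ioo (c - 1) (c + 1) := fun x hx => by
    constructor
    · rw [← hac, ← unduloidF_zero hy hya]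
      exact hm ⟨le_rfl, pi_pos.le⟩ (Ioc_subset_Icc_self hx) hx.1
    · have := hm.monotoneOn (Ioc_subset_Icc_self hx) ⟨pi_pos.le, le_rfl⟩ hx.2
      rw [unduloidF_pi hy hya] at this
      linarith
  have hts : t = nodoidParam c (unduloidF a y s) := by
    refine (strictMonoOn_unduloidF one_pos hc).injOn ht
      (Ioo_subset_Icc_self (nodoidParam_mem hc (hmem s hs))) ?_
    rw [unduloidF_nodoidParam hc (hmem s hs), hF]
  have hmono : StrictMonoOn
      (fun x => unduloidG a y x + nodoidG 1 c (nodoidParam c (unduloidF a y x))) (Icc 0 π) := by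
    refine strictMonoOn_of_deriv_pos (convex_Icc _ _) ?_ fun x hx => ?_
    · have h1 : Continuous (unduloidG a y) := continuous_iff_continuousAt.2
        fun x => (hasDerivAt_unduloidG hy hya x).continuousAt
      have h2 : Continuous (nodoidG 1 c) := continuous_iff_continuousAt.2
        fun x => (hasDerivAt_nodoidG hc x).continuousAt
      exact (h1.add (h2.comp ((continuous_nodoidParam hc).comp
        (continuous_unduloidF hy hya)))).continuousOn
    · rw [interior_Icc] at hx
      have hx' := hmem x (Ioo_subset_Ioc_self hx)
      have hT := nodoidParam_mem hc hx'
      have hTF := unduloidF_nodoidParam hc hx'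
      have hdF := hasDerivAt_unduloidF hy hya x
      -- The derivative of the arccosine expression is never computed: d is determined by
      -- differentiating the identity of the two radii.
      obtain ⟨d, hd⟩ : ∃ d, HasDerivAt (fun x => nodoidParam c (unduloidF a y x)) d x :=
        ⟨_, ((differentiableAt_nodoidParam hc hx').hasDerivAt.comp x hdF)⟩
      have hcomp := (hasDerivAt_unduloidF one_pos hc
        (nodoidParam c (unduloidF a y x))).comp x hd
      have heq : unduloidF c 1 ∘ (fun x => nodoidParam c (unduloidF a y x)) =ᶠ[𝓝 x]
          unduloidF a y := by
        filter_upwards [isOpen_Ioo.mem_nhds hx] with z hz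
        exact unduloidF_nodoidParam hc (hmem z (Ioo_subset_Ioc_self hz))
      have hd' := hcomp.unique (hdF.congr_of_eventuallyEq heq)
      have hder := (hasDerivAt_unduloidG hy hya x).add ((hasDerivAt_nodoidG hc
        (nodoidParam c (unduloidF a y x))).comp x hd)
      have hslope := slope_compare hc hy hya ha hx hT hTF.symm
      refine lt_of_lt_of_eq ?_ hder.deriv.symm
      have hsT := sin_pos_of_mem_Ioo hT
      set T := nodoidParam c (unduloidF a y x)
      have hh := tangentScale_pos hy hya x
      have hpos : 0 < c * sin T := by
        have : 0 < c := by linarith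
        positivity
      refine (mul_pos_iff_of_pos_left hpos).1 ?_
      have ha0 : 0 < a := hy.trans hya
      have e : c * sin T * (a * √(a ^ 2 - y ^ 2) * tangentScale a y x +
          √(c ^ 2 - 1 ^ 2) * cos T * tangentScale c 1 T * d) = a * tangentScale a y x *
          (√(a ^ 2 - y ^ 2) * (c * sin T) + √(c ^ 2 - 1 ^ 2) * cos T * (y * sin x)) := by
        linear_combination √(c ^ 2 - 1 ^ 2) * cos T * hd'
      rw [e]
      positivity
  have h0 := hmono ⟨le_rfl, pi_pos.le⟩ (Ioc_subset_Icc_self hs) hs.1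
  simp only [unduloidF_zero hy hya, hac, nodoidParam_sub_one hc, unduloidG_zero, nodoidG_zero,
    ← hts] at h0
  linarith

lemma unduloidG_add_nodoidG_pos' (hc : 1 < c) (hy : 0 < y) (hya : y < a) (ha : a ≤ 1)
    (hac : a - y = c - 1) {s t : ℝ} (hs : s ∈ Icc 0 (2 * π)) (ht : t ∈ Ioc 0 π)
    (hF : unduloidF a y s = unduloidF c 1 t) : 0 < unduloidG a y s + nodoidG 1 c t := by
  have hpos : ∀ r ∈ Icc 0 π, unduloidF a y r = unduloidF c 1 t →
      0 < unduloidG a y r + nodoidG 1 c t := fun r hr hr' => by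
    refine unduloidG_add_nodoidG_pos hc hy hya ha hac ⟨lt_of_le_of_ne hr.1 ?_, hr.2⟩
      (Ioc_subset_Icc_self ht) hr'
    rintro rfl
    rw [unduloidF_zero hy hya, hac, ← unduloidF_zero one_pos hc] at hr'
    exact ht.1.ne ((strictMonoOn_unduloidF one_pos hc).injOn ⟨le_rfl, pi_pos.le⟩
      (Ioc_subset_Icc_self ht) hr')
  rcases le_total s π with h | h
  · exact hpos s ⟨hs.1, h⟩ hF
  · have h1 := hpos (2 * π - s) ⟨by linarith [hs.2], by linarith⟩
      (by rw [unduloidF_two_pi_sub, hF])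
    have h2 := (strictMono_unduloidG hy hya).monotone (show 2 * π - s ≤ s by linarith)
    linarith

/-- Reflecting the unduloid arc, or the nodoid arc when t ≥ π, turns a crossing into a zero of a sum
of heights shown to be positive. -/
lemma unduloid_ne_nodoid (hc : 1 < c) (hfit : Fits c a y) (ha : a ≤ 1) {s t : ℝ}
    (hs : s ∈ Icc 0 (2 * π)) (ht : t ∈ Ioo 0 (2 * π)) (hF : unduloidF a y s = unduloidF c 1 t) :
    unduloidG a y s ≠ unduloidG a y (2 * π) + nodoidG 1 c t := by
  intro hG
  obtain ⟨hy, hay, -⟩ := (fits_iff hc).1 hfit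
  have hya := hfit.y_lt
  have hac : a - y = c - 1 := by linarith
  have hlen := hfit.length_eq
  rw [unduloidG_zero, nodoidG_zero] at hlen
  rcases le_total t π with h | h
  · have := unduloidG_add_nodoidG_pos' hc hy hya ha hac (s := 2 * π - s) (t := t)
      ⟨by linarith [hs.2], by linarith [hs.1]⟩ ⟨ht.1, h⟩ (by rw [unduloidF_two_pi_sub, hF])
    rw [unduloidG_two_pi_sub hy hya] at this
    linarith
  · have := unduloidG_add_nodoidG_pos' hc hy hya ha hac (s := s) (t := 2 * π - t)
      hs ⟨by linarith [ht.2], by linarith⟩ (by rw [unduloidF_two_pi_sub, hF])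
    rw [nodoidG_two_pi_sub hc] at this
    linarith

end

/-! ### The profile curve of the Delaunay torus -/

lemma patch_map₃ (A B : ℝ) (Φ : ℝ → ℝ → ℝ → ℝ) (u₁ u₂ u₃ v₁ v₂ v₃ : ℝ → ℝ) (t : ℝ) :
    Φ (patch A B u₁ v₁ t) (patch A B u₂ v₂ t) (patch A B u₃ v₃ t) =
      patch A B (fun t => Φ (u₁ t) (u₂ t) (u₃ t)) (fun t => Φ (v₁ t) (v₂ t) (v₃ t)) t := by
  unfold patch
  split_ifs <;> rfl

lemma patch_eq_left {A B : ℝ} {u v : ℝ → ℝ} (hA : 0 < A) (hB : 0 < B) {t : ℝ}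
    (ht : t ∈ Icc 0 A) : patch A B u v t = u t := by
  simpa using patch_eq_fst hA hB (u := u) (v := v) 0 (x := t) (by simpa using ht)

lemma patch_eq_right {A B : ℝ} {u v : ℝ → ℝ} (hA : 0 < A) (hB : 0 < B) {t : ℝ}
    (ht : t ∈ Ioo A (A + B)) : patch A B u v t = v (t - A) := by
  have := mul_fract_div (add_pos hA hB) (x := t) (n := 0)
    ⟨by simpa using (hA.trans ht.1).le, by simpa using ht.2⟩
  simp only [Int.cast_zero, zero_mul, sub_zero] at this
  simp only [patch, this, if_neg (not_le.2 ht.1)]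

lemma intervalIntegrable_patch {A B : ℝ} {u v : ℝ → ℝ} (hA : 0 < A) (hB : 0 < B)
    (hu : Continuous u) (hv : Continuous v) :
    IntervalIntegrable (patch A B u v) volume 0 A ∧
      IntervalIntegrable (patch A B u v) volume A (A + B) := by
  constructor
  · refine (hu.intervalIntegrable 0 A).congr_uIoo fun t ht => ?_
    rw [uIoo_of_le hA.le] at ht
    exact (patch_eq_left hA hB (Ioo_subset_Icc_self ht)).symm
  · refine ((show Continuous fun t => v (t - A) by fun_prop).intervalIntegrable
      (μ := volume) A (A + B)).congr_uIoo fun t ht => ?_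
    rw [uIoo_of_le (by linarith)] at ht
    exact (patch_eq_right hA hB ht).symm

lemma integral_patch {A B : ℝ} {u v : ℝ → ℝ} (hA : 0 < A) (hB : 0 < B)
    (hu : Continuous u) (hv : Continuous v) :
    ∫ t in (0 : ℝ)..A + B, patch A B u v t = (∫ t in (0 : ℝ)..A, u t) + ∫ t in (0 : ℝ)..B, v t := by
  obtain ⟨h1, h2⟩ := intervalIntegrable_patch hA hB hu hv
  rw [← intervalIntegral.integral_add_adjacent_intervals h1 h2]
  congr 1
  · refine intervalIntegral.integral_congr fun t ht => ?_
    rw [uIcc_of_le hA.le] at ht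
    exact patch_eq_left hA hB ht
  · have : ∫ t in A..A + B, v (t - A) = ∫ t in (0 : ℝ)..B, v t := by simp
    rw [← this]
    refine intervalIntegral.integral_congr_uIoo fun t ht => ?_
    rw [uIoo_of_le (by linarith)] at ht
    exact patch_eq_right hA hB ht

/-! ### Matching at the seams, regularity and injectivity of the profile. -/

section

variable {c a y : ℝ}

lemma speedFactor_pos (hc : 1 < c) (hy : 0 < y) (hya : y < a) : 0 < speedFactor c a y := by
  have h1 : 0 < a := hy.trans hya
  have h2 : 0 < c + 1 := by linarith
  unfold speedFactor
  positivity

lemma two_pi_div_speedFactor_pos (hc : 1 < c) (hy : 0 < y) (hya : y < a) :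
    0 < 2 * π / speedFactor c a y := div_pos two_pi_pos (speedFactor_pos hc hy hya)

lemma tangentScale_zero (hy : 0 < y) (hya : y < a) : tangentScale a y 0 = 1 / (a + y) := by
  have h1 : a - y ≠ 0 := by linarith
  have h2 : a + y ≠ 0 := by linarith
  rw [tangentScale, unduloidF_zero hy hya, cos_zero]
  field_simp
  ring

lemma tangentScale_two_pi (a y : ℝ) : tangentScale a y (2 * π) = tangentScale a y 0 := by
  simpa using tangentScale_two_pi_sub a y 0

/-- At the minima both velocities are purely axial, so agreement of speeds gives agreement of
velocity vectors. -/
lemma speedFactor_match (hc : 1 < c) (hy : 0 < y) (hya : y < a) (hac : a - y = c - 1) :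
    √(c ^ 2 - 1 ^ 2) * tangentScale c 1 0 * speedFactor c a y =
      a * √(a ^ 2 - y ^ 2) * tangentScale a y 0 := by
  have h2 : 0 < a + y := by linarith
  have h3 : 0 < c + 1 := by linarith
  have h2' := sqrt_pos.2 h2
  have h3' := sqrt_pos.2 h3
  have e2 := sq_sqrt h2.le
  have e3 := sq_sqrt h3.le
  rw [tangentScale_zero one_pos hc, tangentScale_zero hy hya, sqrt_sq_sub_sq hc,
    sqrt_sq_sub_sq hya, hac, speedFactor, sqrt_div h3.le]
  field_simp
  rw [e2, e3]

/-- The derivative of `profileF`. -/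
def profileFDeriv (c a y : ℝ) : ℝ → ℝ :=
  patch (2 * π) (2 * π / speedFactor c a y) (fun t => a * y * sin t * tangentScale a y t)
    fun t => c * 1 * sin (speedFactor c a y * t) * tangentScale c 1 (speedFactor c a y * t) *
      speedFactor c a y

/-- The derivative of `profileG`. -/
def profileGDeriv (c a y : ℝ) : ℝ → ℝ :=
  patch (2 * π) (2 * π / speedFactor c a y) (fun t => a * √(a ^ 2 - y ^ 2) * tangentScale a y t)
    fun t => √(c ^ 2 - 1 ^ 2) * cos (speedFactor c a y * t) *
      tangentScale c 1 (speedFactor c a y * t) * speedFactor c a y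

lemma profileF_eq_patch (c a y : ℝ) : profileF c a y =
    patch (2 * π) (2 * π / speedFactor c a y) (unduloidF a y)
      fun t => unduloidF c 1 (speedFactor c a y * t) := by
  funext t
  simp only [profileF, nodoidF_one]
  rfl

lemma profileG_eq_patch (c a y : ℝ) : profileG c a y =
    patch (2 * π) (2 * π / speedFactor c a y) (unduloidG a y)
      fun t => unduloidG a y (2 * π) + nodoidG 1 c (speedFactor c a y * t) := rfl

lemma hasDerivAt_comp_const_mul {u : ℝ → ℝ} {u' k t : ℝ} (hu : HasDerivAt u u' (k * t)) :
    HasDerivAt (fun t => u (k * t)) (u' * k) t := by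
  exact (hu.comp t ((hasDerivAt_id t).const_mul k)).congr_deriv (by rw [mul_one])

lemma fits_sub_eq (hc : 1 < c) (h : Fits c a y) : a - y = c - 1 := by
  obtain ⟨-, ha, -⟩ := (fits_iff hc).1 h
  linarith

lemma mul_two_pi_div {k : ℝ} (hk : 0 < k) : k * (2 * π / k) = 2 * π := by
  field_simp

lemma patchF_match (hc : 1 < c) (h : Fits c a y) :
    unduloidF a y (2 * π) = unduloidF c 1 (speedFactor c a y * 0) ∧
      unduloidF c 1 (speedFactor c a y * (2 * π / speedFactor c a y)) = unduloidF a y 0 := by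
  rw [mul_two_pi_div (speedFactor_pos hc h.y_pos h.y_lt), mul_zero,
    unduloidF_two_pi h.y_pos h.y_lt, unduloidF_two_pi one_pos hc, unduloidF_zero h.y_pos h.y_lt,
    unduloidF_zero one_pos hc, fits_sub_eq hc h]
  exact ⟨rfl, rfl⟩

lemma patchG_match (hc : 1 < c) (h : Fits c a y) :
    unduloidG a y (2 * π) = unduloidG a y (2 * π) + nodoidG 1 c (speedFactor c a y * 0) ∧
      unduloidG a y (2 * π) + nodoidG 1 c (speedFactor c a y * (2 * π / speedFactor c a y)) =
        unduloidG a y 0 := by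
  have := h.length_eq
  rw [unduloidG_zero, nodoidG_zero] at this
  rw [mul_two_pi_div (speedFactor_pos hc h.y_pos h.y_lt), mul_zero, unduloidG_zero, nodoidG_zero]
  constructor <;> linarith

lemma patchFDeriv_match (hc : 1 < c) (h : Fits c a y) :
    a * y * sin (2 * π) * tangentScale a y (2 * π) = c * 1 * sin (speedFactor c a y * 0) *
      tangentScale c 1 (speedFactor c a y * 0) * speedFactor c a y ∧
    c * 1 * sin (speedFactor c a y * (2 * π / speedFactor c a y)) *
      tangentScale c 1 (speedFactor c a y * (2 * π / speedFactor c a y)) * speedFactor c a y =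
      a * y * sin 0 * tangentScale a y 0 := by
  rw [mul_two_pi_div (speedFactor_pos hc h.y_pos h.y_lt)]
  simp

lemma patchGDeriv_match (hc : 1 < c) (h : Fits c a y) :
    a * √(a ^ 2 - y ^ 2) * tangentScale a y (2 * π) = √(c ^ 2 - 1 ^ 2) *
      cos (speedFactor c a y * 0) * tangentScale c 1 (speedFactor c a y * 0) *
      speedFactor c a y ∧
    √(c ^ 2 - 1 ^ 2) * cos (speedFactor c a y * (2 * π / speedFactor c a y)) *
      tangentScale c 1 (speedFactor c a y * (2 * π / speedFactor c a y)) * speedFactor c a y =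
      a * √(a ^ 2 - y ^ 2) * tangentScale a y 0 := by
  have := speedFactor_match hc h.y_pos h.y_lt (fits_sub_eq hc h)
  rw [mul_two_pi_div (speedFactor_pos hc h.y_pos h.y_lt), tangentScale_two_pi,
    tangentScale_two_pi, mul_zero, cos_zero, cos_two_pi, mul_one, this]
  exact ⟨rfl, rfl⟩

lemma hasDerivAt_nodoid_arcF (hc : 1 < c) (k t : ℝ) :
    HasDerivAt (fun t => unduloidF c 1 (k * t))
      (c * 1 * sin (k * t) * tangentScale c 1 (k * t) * k) t :=
  hasDerivAt_comp_const_mul (hasDerivAt_unduloidF one_pos hc _)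

lemma hasDerivAt_nodoid_arcG (hc : 1 < c) (r k t : ℝ) :
    HasDerivAt (fun t => r + nodoidG 1 c (k * t))
      (√(c ^ 2 - 1 ^ 2) * cos (k * t) * tangentScale c 1 (k * t) * k) t :=
  (hasDerivAt_comp_const_mul (hasDerivAt_nodoidG hc _)).const_add _

lemma hasDerivAt_profileF (hc : 1 < c) (h : Fits c a y) (t : ℝ) :
    HasDerivAt (profileF c a y) (profileFDeriv c a y t) t := by
  rw [profileF_eq_patch]
  exact hasDerivAt_patch two_pi_pos (two_pi_div_speedFactor_pos hc h.y_pos h.y_lt)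
    (patchF_match hc h).1 (patchF_match hc h).2 (hasDerivAt_unduloidF h.y_pos h.y_lt)
    (hasDerivAt_nodoid_arcF hc _) (patchFDeriv_match hc h).1 (patchFDeriv_match hc h).2 t

lemma hasDerivAt_profileG (hc : 1 < c) (h : Fits c a y) (t : ℝ) :
    HasDerivAt (profileG c a y) (profileGDeriv c a y t) t := by
  rw [profileG_eq_patch]
  exact hasDerivAt_patch two_pi_pos (two_pi_div_speedFactor_pos hc h.y_pos h.y_lt)
    (patchG_match hc h).1 (patchG_match hc h).2 (hasDerivAt_unduloidG h.y_pos h.y_lt)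
    (hasDerivAt_nodoid_arcG hc _ _) (patchGDeriv_match hc h).1 (patchGDeriv_match hc h).2 t

lemma profileF_pos (hc : 1 < c) (h : Fits c a y) (t : ℝ) : 0 < profileF c a y t := by
  rw [profileF_eq_patch, patch]
  split_ifs
  · exact unduloidF_pos h.y_pos h.y_lt _
  · exact unduloidF_pos one_pos hc _

lemma unduloid_speed_sq (hy : 0 < y) (hya : y < a) (t : ℝ) :
    (a * y * sin t * tangentScale a y t) ^ 2 +
      (a * √(a ^ 2 - y ^ 2) * tangentScale a y t) ^ 2 = (a * angleRate a y t) ^ 2 := by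
  rw [mul_pow a (angleRate a y t), angleRate_sq hy hya]
  linear_combination a ^ 2 * tangentScale a y t ^ 2 * sq_sqrt (sq_sub_sq_pos hy hya).le

lemma nodoid_speed_sq (hc : 1 < c) (k t : ℝ) :
    (c * 1 * sin t * tangentScale c 1 t * k) ^ 2 +
      (√(c ^ 2 - 1 ^ 2) * cos t * tangentScale c 1 t * k) ^ 2 = (angleRate c 1 t * k) ^ 2 := by
  rw [mul_pow (angleRate c 1 t), angleRate_sq one_pos hc]
  have h := sq_sqrt (sq_sub_sq_pos one_pos hc).le
  linear_combination k ^ 2 * tangentScale c 1 t ^ 2 * cos t ^ 2 * h +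
    k ^ 2 * tangentScale c 1 t ^ 2 * (c ^ 2 - 1) * sin_sq_add_cos_sq t

lemma sqrt_profile_speed (hc : 1 < c) (h : Fits c a y) (t : ℝ) :
    √(profileFDeriv c a y t ^ 2 + profileGDeriv c a y t ^ 2) =
      patch (2 * π) (2 * π / speedFactor c a y) (fun t => a * angleRate a y t)
        (fun t => angleRate c 1 (speedFactor c a y * t) * speedFactor c a y) t := by
  have ha : 0 < a := h.y_pos.trans h.y_lt
  have hk := speedFactor_pos hc h.y_pos h.y_lt
  simp only [profileFDeriv, profileGDeriv, patch]
  split_ifs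
  · rw [unduloid_speed_sq h.y_pos h.y_lt, sqrt_sq]
    have := angleRate_pos h.y_pos h.y_lt (((2 * π + 2 * π / speedFactor c a y) *
      Int.fract (t / (2 * π + 2 * π / speedFactor c a y))))
    positivity
  · rw [nodoid_speed_sq hc, sqrt_sq]
    exact mul_nonneg (angleRate_pos one_pos hc _).le hk.le

lemma profile_speed_pos (hc : 1 < c) (h : Fits c a y) (t : ℝ) :
    0 < profileFDeriv c a y t ^ 2 + profileGDeriv c a y t ^ 2 := by
  rw [← sqrt_pos, sqrt_profile_speed hc h, patch]
  split_ifs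
  · exact mul_pos (h.y_pos.trans h.y_lt) (angleRate_pos h.y_pos h.y_lt _)
  · exact mul_pos (angleRate_pos one_pos hc _) (speedFactor_pos hc h.y_pos h.y_lt)

lemma exists_deriv_of_contDiff {u : ℝ → ℝ} (hu : ContDiff ℝ 1 u) :
    ∃ u', (∀ t, HasDerivAt u (u' t) t) ∧ Continuous u' :=
  ⟨deriv u, fun _ => (hu.differentiable one_ne_zero _).hasDerivAt, hu.continuous_deriv le_rfl⟩

lemma contDiff_unduloid_arcF_deriv (hy : 0 < y) (hya : y < a) :
    ContDiff ℝ 1 fun t => a * y * sin t * tangentScale a y t :=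
  (contDiff_const.mul contDiff_sin).mul (contDiff_tangentScale hy hya)

lemma contDiff_unduloid_arcG_deriv (hy : 0 < y) (hya : y < a) :
    ContDiff ℝ 1 fun t => a * √(a ^ 2 - y ^ 2) * tangentScale a y t :=
  contDiff_const.mul (contDiff_tangentScale hy hya)

lemma contDiff_nodoid_arcF_deriv (hc : 1 < c) (k : ℝ) :
    ContDiff ℝ 1 fun t => c * 1 * sin (k * t) * tangentScale c 1 (k * t) * k :=
  ((contDiff_const.mul (by fun_prop)).mul
    ((contDiff_tangentScale one_pos hc).comp (by fun_prop))).mul contDiff_const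

lemma contDiff_nodoid_arcG_deriv (hc : 1 < c) (k : ℝ) :
    ContDiff ℝ 1 fun t => √(c ^ 2 - 1 ^ 2) * cos (k * t) * tangentScale c 1 (k * t) * k :=
  ((contDiff_const.mul (by fun_prop)).mul
    ((contDiff_tangentScale one_pos hc).comp (by fun_prop))).mul contDiff_const

lemma exists_lipschitzWith_profileFDeriv (hc : 1 < c) (h : Fits c a y) :
    ∃ K, LipschitzWith K (profileFDeriv c a y) := by
  obtain ⟨u', hu, hu'⟩ := exists_deriv_of_contDiff (contDiff_unduloid_arcF_deriv h.y_pos h.y_lt)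
  obtain ⟨v', hv, hv'⟩ := exists_deriv_of_contDiff
    (contDiff_nodoid_arcF_deriv hc (speedFactor c a y))
  exact exists_lipschitzWith_patch two_pi_pos (two_pi_div_speedFactor_pos hc h.y_pos h.y_lt)
    (patchFDeriv_match hc h).1 (patchFDeriv_match hc h).2 hu hv hu' hv'

lemma exists_lipschitzWith_profileGDeriv (hc : 1 < c) (h : Fits c a y) :
    ∃ K, LipschitzWith K (profileGDeriv c a y) := by
  obtain ⟨u', hu, hu'⟩ := exists_deriv_of_contDiff (contDiff_unduloid_arcG_deriv h.y_pos h.y_lt)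
  obtain ⟨v', hv, hv'⟩ := exists_deriv_of_contDiff
    (contDiff_nodoid_arcG_deriv hc (speedFactor c a y))
  exact exists_lipschitzWith_patch two_pi_pos (two_pi_div_speedFactor_pos hc h.y_pos h.y_lt)
    (patchGDeriv_match hc h).1 (patchGDeriv_match hc h).2 hu hv hu' hv'

lemma exists_lipschitzWith_profileF (hc : 1 < c) (h : Fits c a y) :
    ∃ K, LipschitzWith K (profileF c a y) := by
  rw [profileF_eq_patch]
  exact exists_lipschitzWith_patch two_pi_pos (two_pi_div_speedFactor_pos hc h.y_pos h.y_lt)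
    (patchF_match hc h).1 (patchF_match hc h).2 (hasDerivAt_unduloidF h.y_pos h.y_lt)
    (hasDerivAt_nodoid_arcF hc _) (contDiff_unduloid_arcF_deriv h.y_pos h.y_lt).continuous
    (contDiff_nodoid_arcF_deriv hc _).continuous

lemma exists_abs_profileF_le (hc : 1 < c) (h : Fits c a y) : ∃ M, ∀ t, |profileF c a y t| ≤ M := by
  rw [profileF_eq_patch]
  obtain ⟨M, -, hM⟩ := exists_abs_patch_le two_pi_pos
    (two_pi_div_speedFactor_pos hc h.y_pos h.y_lt) (patchF_match hc h).1 (patchF_match hc h).2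
    (continuous_unduloidF h.y_pos h.y_lt)
    ((continuous_unduloidF one_pos hc).comp (continuous_const.mul continuous_id))
  exact ⟨M, hM⟩

lemma exists_abs_profileFDeriv_le (hc : 1 < c) (h : Fits c a y) :
    ∃ M, ∀ t, |profileFDeriv c a y t| ≤ M := by
  obtain ⟨M, -, hM⟩ := exists_abs_patch_le two_pi_pos
    (two_pi_div_speedFactor_pos hc h.y_pos h.y_lt) (patchFDeriv_match hc h).1
    (patchFDeriv_match hc h).2 (contDiff_unduloid_arcF_deriv h.y_pos h.y_lt).continuous
    (contDiff_nodoid_arcF_deriv hc _).continuous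
  exact ⟨M, hM⟩

lemma profile_injOn (hc : 1 < c) (h : Fits c a y) (ha : a ≤ 1) {s t : ℝ}
    (hF : profileF c a y s = profileF c a y t) (hG : profileG c a y s = profileG c a y t) :
    ∃ m : ℤ, t = s + m * period c a y := by
  have hy := h.y_pos
  have hya := h.y_lt
  have hk := speedFactor_pos hc hy hya
  have hB := two_pi_div_speedFactor_pos hc hy hya
  have hF₁ : ∀ (n : ℤ) (x : ℝ), x - n * period c a y ∈ Ico 0 (2 * π) →
      profileF c a y x = unduloidF a y (x - n * period c a y) ∧
      profileG c a y x = unduloidG a y (x - n * period c a y) := fun n x hx => by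
    rw [profileF_eq_patch, profileG_eq_patch]
    exact ⟨patch_eq_fst two_pi_pos hB n (Ico_subset_Icc_self hx),
      patch_eq_fst two_pi_pos hB n (Ico_subset_Icc_self hx)⟩
  have hF₂ : ∀ (n : ℤ) (x : ℝ), x - (n * period c a y + 2 * π) ∈ Ico 0 (2 * π / speedFactor c a y) →
      profileF c a y x =
        unduloidF c 1 (speedFactor c a y * (x - (n * period c a y + 2 * π))) ∧
      profileG c a y x = unduloidG a y (2 * π) +
        nodoidG 1 c (speedFactor c a y * (x - (n * period c a y + 2 * π))) := fun n x hx => by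
    rw [profileF_eq_patch, profileG_eq_patch]
    exact ⟨patch_eq_snd two_pi_pos hB (patchF_match hc h).1 (patchF_match hc h).2 n
      (Ico_subset_Icc_self hx), patch_eq_snd two_pi_pos hB (patchG_match hc h).1
      (patchG_match hc h).2 n (Ico_subset_Icc_self hx)⟩
  have hmem : ∀ x ∈ Ico 0 (2 * π / speedFactor c a y),
      speedFactor c a y * x ∈ Ico 0 (2 * π) := fun x hx => by
    refine ⟨mul_nonneg hk.le hx.1, ?_⟩
    rw [← mul_two_pi_div hk]
    exact mul_lt_mul_of_pos_left hx.2 hk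
  have hmixed : ∀ r ∈ Ico 0 (2 * π), ∀ q ∈ Ico 0 (2 * π), unduloidF a y r = unduloidF c 1 q →
      unduloidG a y r ≠ unduloidG a y (2 * π) + nodoidG 1 c q := fun r hr q hq hrq => by
    -- The start of the nodoid is the end of the unduloid; it is not counted twice because r < 2π
    -- and the unduloid height is strictly increasing.
    rcases hq.1.eq_or_lt with h0 | h0
    · rw [← h0, nodoidG_zero, add_zero]
      exact (strictMono_unduloidG hy hya hr.2).ne
    · exact unduloid_ne_nodoid hc h ha (Ico_subset_Icc_self hr) ⟨h0, hq.2⟩ hrq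
  obtain ⟨n, hn⟩ := exists_mem_patch_Ico two_pi_pos hB s
  obtain ⟨m, hm⟩ := exists_mem_patch_Ico two_pi_pos hB t
  rw [← period] at hn hm
  rcases hn with hn | hn <;> rcases hm with hm | hm
  · obtain ⟨-, e2⟩ := hF₁ n s hn
    obtain ⟨-, e4⟩ := hF₁ m t hm
    rw [e2, e4] at hG
    have := (strictMono_unduloidG hy hya).injective hG
    refine ⟨m - n, ?_⟩
    push_cast
    linarith
  · obtain ⟨e1, e2⟩ := hF₁ n s hn
    obtain ⟨e3, e4⟩ := hF₂ m t hm
    rw [e1, e3] at hF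
    rw [e2, e4] at hG
    exact absurd hG (hmixed _ hn _ (hmem _ hm) hF)
  · obtain ⟨e1, e2⟩ := hF₂ n s hn
    obtain ⟨e3, e4⟩ := hF₁ m t hm
    rw [e1, e3] at hF
    rw [e2, e4] at hG
    exact absurd hG.symm (hmixed _ hm _ (hmem _ hn) hF.symm)
  · obtain ⟨e1, e2⟩ := hF₂ n s hn
    obtain ⟨e3, e4⟩ := hF₂ m t hm
    rw [e1, e3, ← nodoidF_one, ← nodoidF_one] at hF
    rw [e2, e4] at hG
    have := nodoid_injOn hc (Ico_subset_Icc_self (hmem _ hn)) (Ico_subset_Icc_self (hmem _ hm)) hF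
      (add_left_cancel hG)
    have := mul_left_cancel₀ hk.ne' this
    refine ⟨m - n, ?_⟩
    push_cast
    linarith

lemma period_pos (hc : 1 < c) (h : Fits c a y) : 0 < period c a y :=
  add_pos two_pi_pos (two_pi_div_speedFactor_pos hc h.y_pos h.y_lt)

lemma profileF_add_period (hc : 1 < c) (h : Fits c a y) (t : ℝ) :
    profileF c a y (t + period c a y) = profileF c a y t := by
  rw [profileF_eq_patch]
  exact patch_add_period two_pi_pos (two_pi_div_speedFactor_pos hc h.y_pos h.y_lt) t

lemma profileG_add_period (hc : 1 < c) (h : Fits c a y) (t : ℝ) :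
    profileG c a y (t + period c a y) = profileG c a y t := by
  rw [profileG_eq_patch]
  exact patch_add_period two_pi_pos (two_pi_div_speedFactor_pos hc h.y_pos h.y_lt) t

lemma isEmbeddedC11Torus_torus (hc : 1 < c) (h : Fits c a y) (ha : a ≤ 1) :
    IsEmbeddedC11Torus (torus c a y) (period c a y) (2 * π) := by
  obtain ⟨_, h0⟩ := exists_lipschitzWith_profileF hc h
  obtain ⟨_, h1⟩ := exists_lipschitzWith_profileFDeriv hc h
  obtain ⟨_, h2⟩ := exists_lipschitzWith_profileGDeriv hc h
  obtain ⟨_, h3⟩ := exists_abs_profileF_le hc h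
  obtain ⟨_, h4⟩ := exists_abs_profileFDeriv_le hc h
  exact isEmbeddedC11Torus_revolution (period_pos hc h) (hasDerivAt_profileF hc h)
    (hasDerivAt_profileG hc h) h0 h1 h2 h3 h4 (profileF_pos hc h) (profile_speed_pos hc h)
    (profileF_add_period hc h) (profileG_add_period hc h) fun s t => profile_injOn hc h ha

/-! ### Mean curvature of the Delaunay torus -/

lemma meanCurvature_torus_unduloid (hc : 1 < c) (h : Fits c a y) {t : ℝ} (ht : t ∈ Ioo 0 (2 * π))
    (θ : ℝ) : meanCurvature (torus c a y) (t, θ) = 1 / (2 * a) := by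
  have hy := h.y_pos
  have hya := h.y_lt
  have hB := two_pi_div_speedFactor_pos hc hy hya
  have ha : 0 < a := hy.trans hya
  have hb := sqrt_pos.2 (sq_sub_sq_pos hy hya)
  have hF : ∀ᶠ s in 𝓝 t, HasDerivAt (profileF c a y) (a * y * sin s * tangentScale a y s) s := by
    filter_upwards [isOpen_Ioo.mem_nhds ht] with s hs
    exact (hasDerivAt_profileF hc h s).congr_deriv
      (patch_eq_left two_pi_pos hB (Ioo_subset_Icc_self hs))
  have hG : ∀ᶠ s in 𝓝 t, HasDerivAt (profileG c a y)
      (a * √(a ^ 2 - y ^ 2) * tangentScale a y s) s := by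
    filter_upwards [isOpen_Ioo.mem_nhds ht] with s hs
    exact (hasDerivAt_profileG hc h s).congr_deriv
      (patch_eq_left two_pi_pos hB (Ioo_subset_Icc_self hs))
  have hFt : profileF c a y t = unduloidF a y t := by
    rw [profileF_eq_patch]
    exact patch_eq_left two_pi_pos hB (Ioo_subset_Icc_self ht)
  have hr := angleRate_pos hy hya t
  have hspeed : ((a * y * sin t) ^ 2 + (a * √(a ^ 2 - y ^ 2)) ^ 2) * tangentScale a y t ^ 2 =
      (a * angleRate a y t) ^ 2 := by
    rw [← unduloid_speed_sq hy hya]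
    ring
  rw [torus, meanCurvature_revolution hF hG ((hasDerivAt_sin t).const_mul (a * y))
    (hasDerivAt_const t _) ((contDiff_tangentScale hy hya (n := 1)).differentiable
      one_ne_zero t).hasDerivAt (profileF_pos hc h t) (mul_pos ha hr) hspeed, hFt]
  have h2 := add_mul_cos_pos hy hya t
  have h3 := sub_mul_cos_pos hy hya t
  have h4 := unduloidF_pos hy hya t
  have h5 := unduloidF_sq hy hya t
  have hb2 := sq_sqrt (sq_sub_sq_pos hy hya).le
  rw [tangentScale, angleRate]
  rw [← hb2] at h5 ⊢
  set b := √(a ^ 2 - y ^ 2)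
  set F := unduloidF a y t
  rw [eq_div_iff h2.ne'] at h5
  rw [sqrt_sq hb.le]
  field_simp
  linear_combination (-a) * h5

lemma meanCurvature_torus_nodoid (hc : 1 < c) (h : Fits c a y) {t : ℝ}
    (ht : t ∈ Ioo (2 * π) (period c a y)) (θ : ℝ) :
    meanCurvature (torus c a y) (t, θ) = -1 / 2 := by
  have hy := h.y_pos
  have hya := h.y_lt
  have hB := two_pi_div_speedFactor_pos hc hy hya
  have hk := speedFactor_pos hc hy hya
  have hb := sqrt_pos.2 (sq_sub_sq_pos one_pos hc)
  set k := speedFactor c a y with hkdef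
  have hF : ∀ᶠ s in 𝓝 t, HasDerivAt (profileF c a y)
      (c * sin (k * (s - 2 * π)) * (tangentScale c 1 (k * (s - 2 * π)) * k)) s := by
    filter_upwards [isOpen_Ioo.mem_nhds ht] with s hs
    refine (hasDerivAt_profileF hc h s).congr_deriv
      ((patch_eq_right two_pi_pos hB hs).trans ?_)
    ring
  have hG : ∀ᶠ s in 𝓝 t, HasDerivAt (profileG c a y) (√(c ^ 2 - 1 ^ 2) *
      cos (k * (s - 2 * π)) * (tangentScale c 1 (k * (s - 2 * π)) * k)) s := by
    filter_upwards [isOpen_Ioo.mem_nhds ht] with s hs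
    refine (hasDerivAt_profileG hc h s).congr_deriv
      ((patch_eq_right two_pi_pos hB hs).trans ?_)
    ring
  have hFt : profileF c a y t = unduloidF c 1 (k * (t - 2 * π)) := by
    rw [profileF_eq_patch]
    exact patch_eq_right two_pi_pos hB ht
  have hlin : HasDerivAt (fun s => k * (s - 2 * π)) k t := by
    simpa using ((hasDerivAt_id t).sub_const (2 * π)).const_mul k
  have hp : DifferentiableAt ℝ (fun s => tangentScale c 1 (k * (s - 2 * π)) * k) t :=
    ((((contDiff_tangentScale one_pos hc (n := 1)).differentiable one_ne_zero _).comp t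
      hlin.differentiableAt)).mul_const k
  have hspeed : ((c * sin (k * (t - 2 * π))) ^ 2 +
      (√(c ^ 2 - 1 ^ 2) * cos (k * (t - 2 * π))) ^ 2) *
      (tangentScale c 1 (k * (t - 2 * π)) * k) ^ 2 = (angleRate c 1 (k * (t - 2 * π)) * k) ^ 2 := by
    rw [← nodoid_speed_sq hc]
    ring
  rw [torus, meanCurvature_revolution hF hG (hlin.sin.const_mul c) (hlin.cos.const_mul _)
    hp.hasDerivAt (profileF_pos hc h t) (mul_pos (angleRate_pos one_pos hc _) hk) hspeed, hFt]
  generalize k * (t - 2 * π) = x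
  have h2 := add_mul_cos_pos one_pos hc x
  have h4 := unduloidF_pos one_pos hc x
  have h5 := unduloidF_sq one_pos hc x
  have hb2 := sq_sqrt (sq_sub_sq_pos one_pos hc).le
  rw [tangentScale, angleRate]
  rw [← hb2] at h5 ⊢
  set b := √(c ^ 2 - 1 ^ 2)
  set F := unduloidF c 1 x
  rw [eq_div_iff h2.ne'] at h5
  rw [sqrt_sq hb.le]
  obtain ⟨w, hw⟩ : ∃ w, w = c + 1 * cos x := ⟨_, rfl⟩
  rw [← hw] at h2 h5 ⊢
  field_simp
  linear_combination h5 - b ^ 2 * c * sin_sq_add_cos_sq x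

end

/-! ### Area, Willmore energy and volume of the Delaunay torus -/

lemma integral_fundDomain_fst (P Q : ℝ) (hP : 0 ≤ P) (hQ : 0 ≤ Q) (φ : ℝ → ℝ) :
    ∫ p in fundDomain P Q, φ p.1 = Q * ∫ t in (0 : ℝ)..P, φ t := by
  have := setIntegral_prod_mul (μ := (volume : Measure ℝ)) (ν := (volume : Measure ℝ)) φ
    (fun _ => (1 : ℝ)) (Ioc 0 P) (Ioc 0 Q)
  simp only [mul_one] at this
  rw [fundDomain, Measure.volume_eq_prod, this, intervalIntegral.integral_of_le hP]
  simp [hQ, mul_comm]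

lemma integrableOn_fundDomain_fst {P : ℝ} (Q : ℝ) (hP : 0 ≤ P) {φ : ℝ → ℝ}
    (hφ : IntervalIntegrable φ volume 0 P) :
    IntegrableOn (fun p : ℝ × ℝ => φ p.1) (fundDomain P Q) := by
  rw [intervalIntegrable_iff_integrableOn_Ioc_of_le hP] at hφ
  have h1 : Integrable (fun _ : ℝ => (1 : ℝ)) (volume.restrict (Ioc 0 Q)) := by
    simp
  have := hφ.integrable.mul_prod h1
  simp only [mul_one] at this
  rwa [IntegrableOn, fundDomain, Measure.volume_eq_prod, ← Measure.prod_restrict]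

lemma ae_fst_ne (x : ℝ) : ∀ᵐ p : ℝ × ℝ, p.1 ≠ x := by
  have h : {p : ℝ × ℝ | ¬p.1 ≠ x} = {x} ×ˢ univ := by
    ext p
    simp
  rw [ae_iff, h, Measure.volume_eq_prod, Measure.prod_prod]
  simp

section

variable {c a y : ℝ}

lemma areaDensity_torus (hc : 1 < c) (h : Fits c a y) (p : ℝ × ℝ) :
    areaDensity (torus c a y) p = patch (2 * π) (2 * π / speedFactor c a y)
      (fun t => a * (unduloidF a y t * angleRate a y t))
      (fun t => unduloidF c 1 (speedFactor c a y * t) * angleRate c 1 (speedFactor c a y * t) *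
        speedFactor c a y) p.1 := by
  obtain ⟨t, θ⟩ := p
  rw [torus, areaDensity_revolution (hasDerivAt_profileF hc h t) (hasDerivAt_profileG hc h t)
    (profileF_pos hc h t).le, sqrt_profile_speed hc h, profileF_eq_patch]
  refine (patch_map₃ _ _ (fun x z _ => x * z) _ _ 0 _ _ 0 t).trans ?_
  congr 1
  · funext s
    ring
  · funext s
    ring

lemma continuous_unduloidF_mul_angleRate (hy : 0 < y) (hya : y < a) :
    Continuous fun t => unduloidF a y t * angleRate a y t :=
  (continuous_unduloidF hy hya).mul (continuous_angleRate hy hya)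

lemma continuous_unduloid_area (hy : 0 < y) (hya : y < a) (r : ℝ) :
    Continuous fun t => r * (unduloidF a y t * angleRate a y t) :=
  continuous_const.mul (continuous_unduloidF_mul_angleRate hy hya)

lemma continuous_nodoid_area (hc : 1 < c) (r k : ℝ) :
    Continuous fun t => r * (unduloidF c 1 (k * t) * angleRate c 1 (k * t) * k) :=
  continuous_const.mul ((((continuous_unduloidF_mul_angleRate one_pos hc).comp
    (continuous_const.mul continuous_id))).mul continuous_const)

lemma integral_comp_speedFactor {k : ℝ} (hk : 0 < k) (v : ℝ → ℝ) :
    ∫ t in (0 : ℝ)..2 * π / k, v (k * t) * k = ∫ t in (0 : ℝ)..2 * π, v t := by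
  have := intervalIntegral.mul_integral_comp_mul_left (a := 0) (b := 2 * π / k) (f := v) k
  rw [mul_two_pi_div hk, mul_zero] at this
  rw [intervalIntegral.integral_mul_const, mul_comm, this]

lemma area_torus (hc : 1 < c) (h : Fits c a y) :
    area (torus c a y) (period c a y) (2 * π) =
      2 * π * (a * radiusIntegral a y + radiusIntegral c 1) := by
  have hk := speedFactor_pos hc h.y_pos h.y_lt
  have hB := two_pi_div_speedFactor_pos hc h.y_pos h.y_lt
  have hv := continuous_nodoid_area hc 1 (speedFactor c a y)
  simp only [one_mul] at hv
  simp only [area, areaDensity_torus hc h]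
  rw [integral_fundDomain_fst _ _ (period_pos hc h).le two_pi_pos.le, period,
    integral_patch two_pi_pos hB (continuous_unduloid_area h.y_pos h.y_lt a) hv,
    intervalIntegral.integral_const_mul]
  have := integral_comp_speedFactor hk fun t => unduloidF c 1 t * angleRate c 1 t
  rw [this]
  rfl

/-- The two seam circles, where the curvature formulas do not apply, form a null set. -/
lemma willmoreDensity_torus_ae (hc : 1 < c) (h : Fits c a y) :
    ∀ᵐ p ∂volume.restrict (fundDomain (period c a y) (2 * π)),
      willmoreDensity (torus c a y) p = patch (2 * π) (2 * π / speedFactor c a y)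
      (fun t => 1 / (4 * a) * (unduloidF a y t * angleRate a y t))
      (fun t => 1 / 4 * (unduloidF c 1 (speedFactor c a y * t) *
        angleRate c 1 (speedFactor c a y * t) * speedFactor c a y)) p.1 := by
  have hB := two_pi_div_speedFactor_pos hc h.y_pos h.y_lt
  have ha : 0 < a := h.y_pos.trans h.y_lt
  have hmeas : MeasurableSet (fundDomain (period c a y) (2 * π)) :=
    measurableSet_Ioc.prod measurableSet_Ioc
  filter_upwards [ae_restrict_mem hmeas, ae_restrict_of_ae (ae_fst_ne (2 * π)),
    ae_restrict_of_ae (ae_fst_ne (period c a y))] with p hp h1 h2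
  rw [willmoreDensity, areaDensity_torus hc h]
  obtain ⟨t, θ⟩ := p
  have ht : t ∈ Ioc 0 (period c a y) := hp.1
  simp only at h1 h2
  rcases lt_or_gt_of_ne h1 with h3 | h3
  · rw [meanCurvature_torus_unduloid hc h ⟨ht.1, h3⟩,
      patch_eq_left two_pi_pos hB ⟨ht.1.le, h3.le⟩, patch_eq_left two_pi_pos hB ⟨ht.1.le, h3.le⟩]
    field_simp
    ring
  · have ht' : t ∈ Ioo (2 * π) (period c a y) := ⟨h3, lt_of_le_of_ne ht.2 h2⟩
    rw [meanCurvature_torus_nodoid hc h ht', patch_eq_right two_pi_pos hB ht',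
      patch_eq_right two_pi_pos hB ht']
    ring

lemma integrableOn_willmoreDensity_torus (hc : 1 < c) (h : Fits c a y) :
    IntegrableOn (willmoreDensity (torus c a y)) (fundDomain (period c a y) (2 * π)) := by
  have hB := two_pi_div_speedFactor_pos hc h.y_pos h.y_lt
  obtain ⟨h1, h2⟩ := intervalIntegrable_patch two_pi_pos hB
    (continuous_unduloid_area h.y_pos h.y_lt (1 / (4 * a)))
    (continuous_nodoid_area hc (1 / 4) (speedFactor c a y))
  have := integrableOn_fundDomain_fst (2 * π) (period_pos hc h).le (h1.trans h2)
  refine Integrable.congr this ?_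
  filter_upwards [willmoreDensity_torus_ae hc h] with p hp using hp.symm

lemma willmore_torus (hc : 1 < c) (h : Fits c a y) :
    willmore (torus c a y) (period c a y) (2 * π) =
      π / 2 * (radiusIntegral a y / a + radiusIntegral c 1) := by
  have hk := speedFactor_pos hc h.y_pos h.y_lt
  have hB := two_pi_div_speedFactor_pos hc h.y_pos h.y_lt
  have ha : 0 < a := h.y_pos.trans h.y_lt
  rw [willmore, integral_congr_ae (willmoreDensity_torus_ae hc h),
    integral_fundDomain_fst _ _ (period_pos hc h).le two_pi_pos.le, period,
    integral_patch two_pi_pos hB (continuous_unduloid_area h.y_pos h.y_lt _)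
      (continuous_nodoid_area hc _ _),
    intervalIntegral.integral_const_mul, intervalIntegral.integral_const_mul]
  have := integral_comp_speedFactor hk fun t => unduloidF c 1 t * angleRate c 1 t
  rw [this, ← radiusIntegral, ← radiusIntegral]
  field_simp
  ring

lemma continuous_profileF (hc : 1 < c) (h : Fits c a y) : Continuous (profileF c a y) :=
  continuous_iff_continuousAt.2 fun t => (hasDerivAt_profileF hc h t).continuousAt

lemma continuous_profileG (hc : 1 < c) (h : Fits c a y) : Continuous (profileG c a y) :=
  continuous_iff_continuousAt.2 fun t => (hasDerivAt_profileG hc h t).continuousAt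

lemma continuous_profileFDeriv (hc : 1 < c) (h : Fits c a y) : Continuous (profileFDeriv c a y) :=
  (exists_lipschitzWith_profileFDeriv hc h).choose_spec.continuous

lemma continuous_profileGDeriv (hc : 1 < c) (h : Fits c a y) : Continuous (profileGDeriv c a y) :=
  (exists_lipschitzWith_profileGDeriv hc h).choose_spec.continuous

/-- The function f^2 g is periodic, so its derivative integrates to zero. This trades the f f' g
term of the flux for f^2 g' and gives the volume by discs. -/
lemma enclosedVolume_torus_eq_integral (hc : 1 < c) (h : Fits c a y) :
    enclosedVolume (torus c a y) (period c a y) (2 * π) =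
      -(π * ∫ t in (0 : ℝ)..period c a y, profileF c a y t ^ 2 * profileGDeriv c a y t) := by
  have hdens : ∀ p : ℝ × ℝ, inner ℝ (gaussMap (torus c a y) p) (torus c a y p) *
      areaDensity (torus c a y) p = profileF c a y p.1 * (profileFDeriv c a y p.1 *
        profileG c a y p.1 - profileF c a y p.1 * profileGDeriv c a y p.1) := fun p =>
    volumeDensity_revolution (hasDerivAt_profileF hc h p.1) (hasDerivAt_profileG hc h p.1)
      (profileF_pos hc h p.1) (profile_speed_pos hc h p.1) p.2
  have hF := continuous_profileF hc h
  have hG := continuous_profileG hc h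
  have hF' := continuous_profileFDeriv hc h
  have hG' := continuous_profileGDeriv hc h
  simp only [enclosedVolume, hdens]
  rw [integral_fundDomain_fst _ _ (period_pos hc h).le two_pi_pos.le (fun t => profileF c a y t *
    (profileFDeriv c a y t * profileG c a y t - profileF c a y t * profileGDeriv c a y t))]
  have hd : ∀ t ∈ uIcc 0 (period c a y),
      HasDerivAt (fun t => profileF c a y t ^ 2 * profileG c a y t)
      (2 * (profileF c a y t * (profileFDeriv c a y t * profileG c a y t - profileF c a y t *
        profileGDeriv c a y t)) + 3 * (profileF c a y t ^ 2 * profileGDeriv c a y t)) t :=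
    fun t _ => by
      refine (((hasDerivAt_profileF hc h t).pow 2).mul (hasDerivAt_profileG hc h t)).congr_deriv ?_
      simp only [Nat.cast_ofNat, Nat.add_one_sub_one, pow_one, Pi.pow_apply]
      ring
  have hzero := intervalIntegral.integral_eq_sub_of_hasDerivAt hd
    (Continuous.intervalIntegrable (by fun_prop) _ _)
  have e1 := profileF_add_period hc h 0
  have e2 := profileG_add_period hc h 0
  rw [zero_add] at e1 e2
  rw [e1, e2, sub_self, intervalIntegral.integral_add
    (Continuous.intervalIntegrable (by fun_prop) _ _)
    (Continuous.intervalIntegrable (by fun_prop) _ _), intervalIntegral.integral_const_mul,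
    intervalIntegral.integral_const_mul] at hzero
  linear_combination π / 3 * hzero

/-- The radius law gives F^2 + b^2 = 2 a b^2 / (a + y cos t) with b^2 = a^2 - y^2. For the nodoid
the analogue is q^2 - F^2 = 2 q^2 cos t / (c + cos t), whence the opposite sign of its cubic term.
-/
lemma unduloid_volume_integrand (hy : 0 < y) (hya : y < a) (t : ℝ) :
    unduloidF a y t ^ 2 * (a * √(a ^ 2 - y ^ 2) * tangentScale a y t) =
      1 / 2 * (unduloidF a y t ^ 3 * angleRate a y t) +
        1 / 2 * (a ^ 2 - y ^ 2) * (unduloidF a y t * angleRate a y t) := by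
  have h2 := add_mul_cos_pos hy hya t
  have h4 := unduloidF_pos hy hya t
  have h5 := unduloidF_sq hy hya t
  rw [eq_div_iff h2.ne'] at h5
  rw [tangentScale, angleRate]
  field_simp
  linear_combination (-√(a ^ 2 - y ^ 2)) * h5

lemma nodoid_volume_integrand (hc : 1 < c) (t : ℝ) :
    unduloidF c 1 t ^ 2 * (√(c ^ 2 - 1 ^ 2) * cos t * tangentScale c 1 t) =
      -(1 / 2) * (unduloidF c 1 t ^ 3 * angleRate c 1 t) +
        1 / 2 * (c ^ 2 - 1) * (unduloidF c 1 t * angleRate c 1 t) := by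
  have h2 := add_mul_cos_pos one_pos hc t
  have h4 := unduloidF_pos one_pos hc t
  have h5 := unduloidF_sq one_pos hc t
  rw [eq_div_iff h2.ne'] at h5
  rw [tangentScale, angleRate]
  obtain ⟨w, hw⟩ : ∃ w, w = c + 1 * cos t := ⟨_, rfl⟩
  rw [← hw] at h2 h5 ⊢
  field_simp
  rw [hw] at h5 ⊢
  linear_combination √(c ^ 2 - 1) * h5

lemma enclosedVolume_torus (hc : 1 < c) (h : Fits c a y) :
    enclosedVolume (torus c a y) (period c a y) (2 * π) =
      π / 2 * (radiusCubeIntegral c 1 - (c ^ 2 - 1) * radiusIntegral c 1 -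
        radiusCubeIntegral a y - (a ^ 2 - y ^ 2) * radiusIntegral a y) := by
  have hy := h.y_pos
  have hya := h.y_lt
  have hk := speedFactor_pos hc hy hya
  have hB := two_pi_div_speedFactor_pos hc hy hya
  have hpatch : ∀ t, profileF c a y t ^ 2 * profileGDeriv c a y t =
      patch (2 * π) (2 * π / speedFactor c a y)
      (fun t => unduloidF a y t ^ 2 * (a * √(a ^ 2 - y ^ 2) * tangentScale a y t))
      (fun t => unduloidF c 1 (speedFactor c a y * t) ^ 2 * (√(c ^ 2 - 1 ^ 2) *
        cos (speedFactor c a y * t) * tangentScale c 1 (speedFactor c a y * t)) *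
        speedFactor c a y) t := fun t => by
    rw [profileF_eq_patch]
    refine (patch_map₃ _ _ (fun x z _ => x ^ 2 * z) _ _ 0 _ _ 0 t).trans ?_
    congr 1
    funext s
    ring
  have hu : Continuous fun t =>
      unduloidF a y t ^ 2 * (a * √(a ^ 2 - y ^ 2) * tangentScale a y t) :=
    ((continuous_unduloidF hy hya).pow 2).mul
      (continuous_const.mul (contDiff_tangentScale hy hya (n := 0)).continuous)
  have hv : Continuous fun t =>
      unduloidF c 1 t ^ 2 * (√(c ^ 2 - 1 ^ 2) * cos t * tangentScale c 1 t) :=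
    ((continuous_unduloidF one_pos hc).pow 2).mul
      ((continuous_const.mul continuous_cos).mul
        (contDiff_tangentScale one_pos hc (n := 0)).continuous)
  have hv' : Continuous fun t => unduloidF c 1 (speedFactor c a y * t) ^ 2 * (√(c ^ 2 - 1 ^ 2) *
      cos (speedFactor c a y * t) * tangentScale c 1 (speedFactor c a y * t)) *
      speedFactor c a y :=
    (hv.comp (continuous_const.mul continuous_id)).mul continuous_const
  have hint := integral_comp_speedFactor hk fun t =>
    unduloidF c 1 t ^ 2 * (√(c ^ 2 - 1 ^ 2) * cos t * tangentScale c 1 t)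
  rw [enclosedVolume_torus_eq_integral hc h]
  simp only [hpatch]
  rw [period, integral_patch two_pi_pos hB hu hv', hint]
  simp only [unduloid_volume_integrand hy hya, nodoid_volume_integrand hc]
  rw [intervalIntegral.integral_add ((intervalIntegrable_unduloidF_cube_mul hy hya _ _).const_mul _)
    ((intervalIntegrable_unduloidF_mul hy hya _ _).const_mul _),
    intervalIntegral.integral_add
    ((intervalIntegrable_unduloidF_cube_mul one_pos hc _ _).const_mul _)
    ((intervalIntegrable_unduloidF_mul one_pos hc _ _).const_mul _)]
  simp only [intervalIntegral.integral_const_mul]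
  rw [radiusIntegral, radiusIntegral, radiusCubeIntegral, radiusCubeIntegral]
  ring

end

/-! ### Asymptotics for nearly spherical Delaunay tori -/

section

variable {c a y : ℝ}

/-- The threshold c - 1 < exp (-40) serves twice: -log (c - 1) > 40 absorbs the additive constants
in the logarithmic estimates, and c - 1 ≤ 10^(-12) makes polynomial errors negligible. -/
lemma exp_neg_forty_le : exp (-40) ≤ 1 / 10 ^ 12 := by
  have h1 : (2 : ℝ) ≤ exp 1 := by linarith [add_one_le_exp (1 : ℝ)]
  have h2 : exp 40 = exp 1 ^ 40 := by rw [← exp_nat_mul]; norm_num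
  have h3 : (2 : ℝ) ^ 40 ≤ exp 1 ^ 40 := pow_le_pow_left₀ (by norm_num) h1 40
  rw [exp_neg, h2, inv_eq_one_div]
  exact one_div_le_one_div_of_le (by norm_num) (le_trans (by norm_num) h3)

lemma sub_one_le_of_mem (hc : c ∈ Ioo 1 (1 + exp (-40))) : c - 1 ≤ 1 / 10 ^ 12 := by
  linarith [hc.2, exp_neg_forty_le]

lemma forty_lt_neg_log (hc : c ∈ Ioo 1 (1 + exp (-40))) : 40 < -log (c - 1) := by
  have := log_lt_log (sub_pos.2 hc.1) (show c - 1 < exp (-40) by linarith [hc.2])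
  rw [log_exp] at this
  linarith

lemma sub_one_mul_neg_log_le (hc : 1 < c) : (c - 1) * -log (c - 1) ≤ 1 := by
  have h0 : 0 < c - 1 := by linarith
  have h := log_le_sub_one_of_pos (inv_pos.2 h0)
  rw [log_inv] at h
  have := mul_le_mul_of_nonneg_left h h0.le
  rw [mul_sub, mul_inv_cancel₀ h0.ne'] at this
  linarith

lemma one_sub_y_le (hc : 1 < c) (h : Fits c a y) : 1 - y ≤ π * √(c ^ 2 - 1) := by
  obtain ⟨hy, -, hlen⟩ := (fits_iff hc).1 h
  exact one_sub_le_of_unduloidLength_eq hc hy hlen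

lemma le_y_of_fits (hc : c ∈ Ioo 1 (1 + exp (-40))) (h : Fits c a y) : 999 / 1000 ≤ y := by
  have h1 := one_sub_y_le hc.1 h
  have h2 := sub_one_le_of_mem hc
  have h3 : √(c ^ 2 - 1) ≤ 1 / 10 ^ 5 := by
    rw [sqrt_le_left (by positivity)]
    nlinarith [hc.1]
  have := mul_le_mul_of_nonneg_left h3 pi_pos.le
  linarith [pi_lt_four]

lemma le_one_sub_y (hc : c ∈ Ioo 1 (1 + exp (-40))) (h : Fits c a y) :
    (c - 1) * (-log (c - 1) - 4) ≤ 1 - y := by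
  obtain ⟨hy, -, hlen⟩ := (fits_iff hc.1).1 h
  have h1 := le_y_of_fits hc h
  have h2 := sub_one_le_of_mem hc
  have h3 := forty_lt_neg_log hc
  have hlog : log 3 ≤ 2 := by linarith [log_le_sub_one_of_pos (show (0 : ℝ) < 3 by norm_num)]
  refine le_trans ?_ (le_one_sub_of_unduloidLength_eq hc.1 (by linarith) hlen (by linarith)
    (by linarith))
  exact mul_le_mul_of_nonneg_left (by linarith) (by linarith [hc.1])

lemma a_eq_of_fits (hc : 1 < c) (h : Fits c a y) : a = y + (c - 1) :=
  ((fits_iff hc).1 h).2.1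

/-- The logarithm makes 1 - y larger than a - y = c - 1; this is the input for embeddedness. -/
lemma a_le_one (hc : c ∈ Ioo 1 (1 + exp (-40))) (h : Fits c a y) : a ≤ 1 := by
  have h1 := le_one_sub_y hc h
  have h3 := forty_lt_neg_log hc
  have h4 := a_eq_of_fits hc.1 h
  have : (c - 1) * 1 ≤ (c - 1) * (-log (c - 1) - 4) :=
    mul_le_mul_of_nonneg_left (by linarith) (by linarith [hc.1])
  linarith

lemma log_seven_le : log 7 ≤ 6 := by
  linarith [log_le_sub_one_of_pos (show (0 : ℝ) < 7 by norm_num)]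

/-- The arithmetic–geometric mean inequality replaces 8 √(a y) by 4 (a + y), a main term linear in
the parameters. -/
lemma radiusIntegral_unduloid_le (hc : c ∈ Ioo 1 (1 + exp (-40))) (h : Fits c a y) :
    radiusIntegral a y ≤ 4 * (a + y) + 4 / 3 * (c - 1) ^ 2 * (-log (c - 1) + 7) := by
  have h1 := le_y_of_fits hc h
  have h2 := sub_one_le_of_mem hc
  have h3 := h.y_lt
  have h4 := fits_sub_eq hc.1 h
  have h5 : 5 / 6 ≤ √(a * y) := le_sqrt_of_sq_le (by nlinarith)
  have h6 := radiusIntegral_le h.y_pos h.y_lt (by linarith) (by linarith)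
  have h7 : √(a * y) ≤ (a + y) / 2 := by
    rw [sqrt_le_left (by linarith)]
    nlinarith [sq_nonneg (a - y)]
  rw [h4] at h6
  have h8 := mul_le_mul_of_nonneg_left (show log 7 - log (c - 1) + 1 ≤ -log (c - 1) + 7 by
    linarith [log_seven_le]) (show 0 ≤ 4 / 3 * (c - 1) ^ 2 by positivity)
  linarith

lemma radiusIntegral_nodoid_le (hc : c ∈ Ioo 1 (1 + exp (-40))) :
    radiusIntegral c 1 ≤ 4 * (c + 1) + 4 / 3 * (c - 1) ^ 2 * (-log (c - 1) + 7) := by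
  have h2 := sub_one_le_of_mem hc
  have h3 := hc.1
  have h5 : 1 ≤ √(c * 1) := le_sqrt_of_sq_le (by linarith)
  have h6 := radiusIntegral_le one_pos hc.1 (by linarith) (by linarith)
  have h7 : √(c * 1) ≤ (c + 1) / 2 := by
    rw [sqrt_le_left (by linarith)]
    nlinarith [sq_nonneg (c - 1)]
  have h8 := mul_le_mul_of_nonneg_left (show log 7 - log (c - 1) + 1 ≤ -log (c - 1) + 7 by
    linarith [log_seven_le]) (show 0 ≤ 4 / 3 * (c - 1) ^ 2 by positivity)
  linarith

lemma willmore_torus_lt (hc : c ∈ Ioo 1 (1 + exp (-40))) (h : Fits c a y) :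
    willmore (torus c a y) (period c a y) (2 * π) < 8 * π := by
  rw [willmore_torus hc.1 h]
  have hu := radiusIntegral_unduloid_le hc h
  have hn := radiusIntegral_nodoid_le hc
  have hL := forty_lt_neg_log hc
  have h1 := le_one_sub_y hc h
  have h2 := a_eq_of_fits hc.1 h
  have h3 := le_y_of_fits hc h
  have h4 := a_le_one hc h
  have he : 0 < c - 1 := by linarith [hc.1]
  obtain ⟨e, rfl⟩ : ∃ e, c = 1 + e := ⟨c - 1, by ring⟩
  rw [add_sub_cancel_left] at *
  set l := -log e
  have ha : 0 < a := by linarith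
  have hT : 0 ≤ 4 / 3 * e ^ 2 * (l + 7) := mul_nonneg (by positivity) (by linarith)
  set T := 4 / 3 * e ^ 2 * (l + 7) with hTdef
  have hua : radiusIntegral a y / a ≤ 8 - 4 * e * (2 - a) + 101 / 100 * T := by
    rw [div_le_iff₀ ha]
    -- This is 1/a ≥ 2 - a. Since 4 (a + y)/a = 8 - 4 e/a and the nodoid contributes 8 + 4 e, a gain
    -- of 4 e (1 - a) survives.
    have e1 : a * (2 - a) ≤ 1 := by nlinarith [sq_nonneg (a - 1)]
    have e2 := mul_le_mul_of_nonneg_left e1 (show 0 ≤ 4 * e by positivity)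
    have e3 := mul_le_mul_of_nonneg_left (show 1 ≤ 101 / 100 * a by linarith) hT
    linarith
  have h5 : e * (e * (l - 4) - e) ≤ e * (1 - a) := mul_le_mul_of_nonneg_left (by linarith) he.le
  have h6 : radiusIntegral a y / a + radiusIntegral (1 + e) 1 < 16 := by
    -- The gain 4 e^2 (l - 5) against the errors T and (101/100) T: the coefficient of l is
    -- positive, and l > 40 overcomes the constants.
    have : 0 < e ^ 2 * (4 * (l - 5) - 201 / 100 * (4 / 3) * (l + 7)) :=
      mul_pos (by positivity) (by linarith)
    linarith
  nlinarith [pi_pos]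

/-! ### Volume, area and the isoperimetric ratio. -/

lemma radiusIntegral_le_nine (hc : c ∈ Ioo 1 (1 + exp (-40))) (h : Fits c a y) :
    radiusIntegral a y ≤ 9 ∧ radiusIntegral c 1 ≤ 9 := by
  have hu := radiusIntegral_unduloid_le hc h
  have hn := radiusIntegral_nodoid_le hc
  have h1 := sub_one_le_of_mem hc
  have h2 := sub_one_mul_neg_log_le hc.1
  have h3 := a_le_one hc h
  have h4 := h.y_lt
  have he : 0 < c - 1 := by linarith [hc.1]
  have hT : 4 / 3 * (c - 1) ^ 2 * (-log (c - 1) + 7) ≤ 1 / 10 := by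
    have e1 := mul_le_mul_of_nonneg_left h2 he.le
    nlinarith
  constructor <;> linarith

lemma sqrt_cube (x : ℝ) (hx : 0 ≤ x) : (2 * √x) ^ 3 = 8 * (x * √x) := by
  linear_combination 8 * √x * sq_sqrt hx

/-- The difference of the cubic main terms is at least (64/3) (1 - y) ≥ (64/3) · 36 (c - 1), by the
logarithmic bound; all corrections together are at most 62 (c - 1). -/
lemma enclosedVolume_torus_pos (hc : c ∈ Ioo 1 (1 + exp (-40))) (h : Fits c a y) :
    0 < enclosedVolume (torus c a y) (period c a y) (2 * π) := by
  rw [enclosedVolume_torus hc.1 h]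
  have hy := h.y_pos
  have hya := h.y_lt
  have ha := a_le_one hc h
  have hn := le_radiusCubeIntegral one_pos hc.1
  have hu := radiusCubeIntegral_le hy hya
  obtain ⟨hu9, hn9⟩ := radiusIntegral_le_nine hc h
  have h1 := le_one_sub_y hc h
  have hL := forty_lt_neg_log hc
  have h2 := sub_one_le_of_mem hc
  have hc1 := hc.1
  have ha0 : 0 < a := hy.trans hya
  rw [sqrt_cube _ (by nlinarith)] at hn
  rw [sqrt_cube _ (by nlinarith)] at hu
  have e1 : 1 ≤ √(c * 1) := le_sqrt_of_sq_le (by linarith)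
  have e2 : √(a * y) ≤ 1 := by
    rw [sqrt_le_left zero_le_one]
    nlinarith
  have e3 : a * y * √(a * y) ≤ y := by
    have : a * y * √(a * y) ≤ a * y * 1 := mul_le_mul_of_nonneg_left e2 (by positivity)
    nlinarith
  have e4 : 1 ≤ c * 1 * √(c * 1) := by nlinarith
  have h4 := fits_sub_eq hc1 h
  have e6 : a ^ 2 - y ^ 2 ≤ 2 * (c - 1) := by
    have : a ^ 2 - y ^ 2 = (c - 1) * (a + y) := by rw [← h4]; ring
    rw [this]
    nlinarith
  have e7 : c ^ 2 - 1 ≤ 3 * (c - 1) := by nlinarith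
  have e8 : (c ^ 2 - 1) * radiusIntegral c 1 ≤ 27 * (c - 1) := by
    have := mul_le_mul_of_nonneg_left hn9 (show 0 ≤ c ^ 2 - 1 by nlinarith)
    linarith
  have e9 : (a ^ 2 - y ^ 2) * radiusIntegral a y ≤ 18 * (c - 1) := by
    have := mul_le_mul_of_nonneg_left hu9 (sq_sub_sq_pos hy hya).le
    linarith
  rw [h4] at hu
  have e10 : (c - 1) ^ 2 * radiusIntegral a y ≤ 9 * (c - 1) := by
    have := mul_le_mul_of_nonneg_left hu9 (sq_nonneg (c - 1))
    nlinarith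
  have e11 : 4 * (2 * √(a * y)) * (c - 1) ^ 2 ≤ 8 * (c - 1) := by
    have := mul_le_mul_of_nonneg_right e2 (sq_nonneg (c - 1))
    nlinarith
  have e12 : 36 * (c - 1) ≤ (c - 1) * (-log (c - 1) - 4) := by
    rw [mul_comm]
    exact mul_le_mul_of_nonneg_left (by linarith) (by linarith)
  refine mul_pos (by positivity) ?_
  linarith

/-- The subtracted radius integrals are dropped, and √(c · 1) ≤ c and y^2 ≤ √(a y) leave c^2 - y^4.
The result is an explicit function of c, continuous and zero at c = 1. -/
lemma enclosedVolume_torus_le (hc : c ∈ Ioo 1 (1 + exp (-40))) (h : Fits c a y) :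
    enclosedVolume (torus c a y) (period c a y) (2 * π) ≤
      π / 2 * (64 / 3 * (c ^ 2 - (1 - π * √(c ^ 2 - 1)) ^ 4) + 25 * (c - 1) ^ 2) := by
  rw [enclosedVolume_torus hc.1 h]
  have hy := h.y_pos
  have hya := h.y_lt
  have ha := a_le_one hc h
  have hn := radiusCubeIntegral_le one_pos hc.1
  have hu := le_radiusCubeIntegral hy hya
  obtain ⟨-, hn9⟩ := radiusIntegral_le_nine hc h
  have h2 := sub_one_le_of_mem hc
  have hc1 := hc.1
  have ha0 : 0 < a := hy.trans hya
  have hy1 := one_sub_y_le hc1 h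
  have hpos : 0 ≤ 1 - π * √(c ^ 2 - 1) := by
    have h3 : √(c ^ 2 - 1) ≤ 1 / 10 ^ 5 := by
      rw [sqrt_le_left (by positivity)]
      nlinarith
    have := mul_le_mul_of_nonneg_left h3 pi_pos.le
    linarith [pi_lt_four]
  have hQu : 0 ≤ radiusIntegral a y := le_trans (by positivity) (le_radiusIntegral hy hya)
  have hQn : 0 ≤ radiusIntegral c 1 := le_trans (by positivity) (le_radiusIntegral one_pos hc1)
  rw [sqrt_cube _ (by nlinarith)] at hn
  rw [sqrt_cube _ (by nlinarith)] at hu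
  have e1 : √(c * 1) ≤ c := by
    rw [sqrt_le_left (by linarith)]
    nlinarith
  have e2 : y ^ 2 ≤ √(a * y) := le_sqrt_of_sq_le (by
    have e3 : y ^ 2 ≤ 1 := by nlinarith
    nlinarith [mul_le_mul_of_nonneg_left e3 (sq_nonneg y)])
  have e3 : y ^ 4 ≤ a * y * √(a * y) := by
    calc y ^ 4 = y ^ 2 * y ^ 2 := by ring
      _ ≤ a * y * √(a * y) := mul_le_mul (by nlinarith) e2 (sq_nonneg y) (by positivity)
  have e4 : (1 - π * √(c ^ 2 - 1)) ^ 4 ≤ y ^ 4 := pow_le_pow_left₀ hpos (by linarith) 4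
  have e5 : c * 1 * √(c * 1) ≤ c ^ 2 := by nlinarith
  have e6 : 0 ≤ (c ^ 2 - 1) * radiusIntegral c 1 := mul_nonneg (by nlinarith) hQn
  have e7 : 0 ≤ (a ^ 2 - y ^ 2) * radiusIntegral a y :=
    mul_nonneg (sq_sub_sq_pos hy hya).le hQu
  have e8 := mul_le_mul_of_nonneg_left hn9 (sq_nonneg (c - 1))
  have e9 := mul_le_mul_of_nonneg_right (e1.trans (show c ≤ 2 by linarith)) (sq_nonneg (c - 1))
  refine mul_le_mul_of_nonneg_left ?_ (by positivity)
  linarith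

lemma one_le_area_torus (hc : 1 < c) (h : Fits c a y) :
    1 ≤ area (torus c a y) (period c a y) (2 * π) := by
  rw [area_torus hc h]
  have h1 := le_radiusIntegral h.y_pos h.y_lt
  have h2 := le_radiusIntegral one_pos hc
  have h3 : 1 ≤ √(c * 1) := le_sqrt_of_sq_le (by linarith)
  have h4 : 0 ≤ a * radiusIntegral a y :=
    mul_nonneg (h.y_pos.trans h.y_lt).le (le_trans (by positivity) h1)
  nlinarith [pi_gt_three]

lemma tendsto_isoRatio {a y : ℝ → ℝ} (h : ∀ c ∈ Ioo 1 (1 + exp (-40)), Fits c (a c) (y c)) :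
    Tendsto (fun c => isoRatio (torus c (a c) (y c)) (period c (a c) (y c)) (2 * π)) (𝓝[>] 1)
      atTop := by
  have hev : ∀ᶠ c in 𝓝[>] (1 : ℝ), c ∈ Ioo 1 (1 + exp (-40)) :=
    Ioo_mem_nhdsGT (by linarith [exp_pos (-40)])
  set V := fun c => enclosedVolume (torus c (a c) (y c)) (period c (a c) (y c)) (2 * π) with hV
  have hlim : Tendsto (fun c => π / 2 * (64 / 3 * (c ^ 2 - (1 - π * √(c ^ 2 - 1)) ^ 4) +
      25 * (c - 1) ^ 2)) (𝓝[>] 1) (𝓝 0) := by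
    have hcont : Continuous fun c : ℝ => π / 2 * (64 / 3 * (c ^ 2 -
      (1 - π * √(c ^ 2 - 1)) ^ 4) + 25 * (c - 1) ^ 2) := by fun_prop
    have := hcont.tendsto 1
    norm_num at this
    exact this.mono_left nhdsWithin_le_nhds
  have hV0 : Tendsto V (𝓝[>] 1) (𝓝 0) := by
    refine tendsto_of_tendsto_of_tendsto_of_le_of_le' tendsto_const_nhds hlim ?_ ?_
    · filter_upwards [hev] with c hc using (enclosedVolume_torus_pos hc (h c hc)).le
    · filter_upwards [hev] with c hc using enclosedVolume_torus_le hc (h c hc)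
  have hpow : Tendsto (fun c => V c ^ (2 / 3 : ℝ)) (𝓝[>] 1) (𝓝[>] 0) := by
    refine tendsto_nhdsWithin_iff.2 ⟨?_, ?_⟩
    · have := hV0.rpow_const (p := 2 / 3) (Or.inr (by norm_num))
      rwa [zero_rpow (by norm_num)] at this
    · filter_upwards [hev] with c hc
      exact rpow_pos_of_pos (enclosedVolume_torus_pos hc (h c hc)) _
  refine tendsto_atTop_mono' _ ?_ (tendsto_inv_nhdsGT_zero.comp hpow)
  filter_upwards [hev] with c hc
  rw [isoRatio, Function.comp_apply, inv_eq_one_div]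
  exact div_le_div_of_nonneg_right (one_le_area_torus hc.1 (h c hc))
    (rpow_pos_of_pos (enclosedVolume_torus_pos hc (h c hc)) _).le

lemma fits_unique {a' y' : ℝ} (hc : 1 < c) (h : Fits c a y) (h' : Fits c a' y') :
    a' = a ∧ y' = y := by
  obtain ⟨hy, ha, hlen⟩ := (fits_iff hc).1 h
  obtain ⟨hy', ha', hlen'⟩ := (fits_iff hc).1 h'
  have : y' = y := (strictMonoOn_unduloidLength hc).injOn (mem_Ici.2 hy'.le) (mem_Ici.2 hy.le)
    (hlen'.trans hlen.symm)
  exact ⟨by rw [ha, ha', this], this⟩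

lemma exists_fits (hc : 1 < c) (hc' : c ≤ 13 / 10) : ∃ a y, Fits c a y := by
  obtain ⟨y, hy, -, hlen⟩ := exists_unduloidLength_eq hc hc'
  exact ⟨y + (c - 1), y, (fits_iff hc).2 ⟨hy, rfl, hlen⟩⟩

end

end DelaunayTori

end

theorem theorem1p1 :
    ∃ c₀ : ℝ, 1 < c₀ ∧ ∃ a y : ℝ → ℝ,
      -- existence of the tori for all `1 < c < c₀`: the parameters `a`, `y` of the fitting unduloid
      -- exist and are unique, and patching gives an embedded torus of class `C^{1,1}`, with constant
      -- positive mean curvature on the unduloid and constant negative one on the nodoid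
      (∀ c ∈ Ioo 1 c₀,
        DelaunayTori.Fits c (a c) (y c) ∧
        (∀ a' y' : ℝ, DelaunayTori.Fits c a' y' → a' = a c ∧ y' = y c) ∧
        DelaunayTori.IsEmbeddedC11Torus (DelaunayTori.torus c (a c) (y c))
          (DelaunayTori.period c (a c) (y c)) (2 * π) ∧
        (∀ t ∈ Ioo 0 (2 * π), ∀ θ : ℝ,
          DelaunayTori.meanCurvature (DelaunayTori.torus c (a c) (y c)) (t, θ) = 1 / (2 * a c)) ∧
        (∀ t ∈ Ioo (2 * π) (DelaunayTori.period c (a c) (y c)), ∀ θ : ℝ,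
          DelaunayTori.meanCurvature (DelaunayTori.torus c (a c) (y c)) (t, θ) = -1 / 2)) ∧
      -- the Willmore energy
      (∃ δ : ℝ, 0 < δ ∧ 1 + δ ≤ c₀ ∧ ∀ c ∈ Ioo 1 (1 + δ),
        IntegrableOn (DelaunayTori.willmoreDensity (DelaunayTori.torus c (a c) (y c)))
          (DelaunayTori.fundDomain (DelaunayTori.period c (a c) (y c)) (2 * π)) ∧
        DelaunayTori.willmore (DelaunayTori.torus c (a c) (y c))
          (DelaunayTori.period c (a c) (y c)) (2 * π) < 8 * π) ∧
      -- the isoperimetric ratio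
      Tendsto (fun c => DelaunayTori.isoRatio (DelaunayTori.torus c (a c) (y c))
          (DelaunayTori.period c (a c) (y c)) (2 * π)) (𝓝[>] 1) atTop := by
  have hex : ∀ c, ∃ a y, c ∈ Ioo 1 (1 + exp (-40)) → DelaunayTori.Fits c a y := fun c => by
    by_cases hc : c ∈ Ioo 1 (1 + exp (-40))
    · obtain ⟨a, y, h⟩ := DelaunayTori.exists_fits hc.1
        (by linarith [DelaunayTori.sub_one_le_of_mem hc])
      exact ⟨a, y, fun _ => h⟩
    -- Outside the interval the values are arbitrary; they only make the parameter functions total.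
    · exact ⟨0, 0, fun h => absurd h hc⟩
  choose a y h using hex
  refine ⟨1 + exp (-40), by linarith [exp_pos (-40)], a, y, fun c hc => ⟨h c hc, ?_, ?_, ?_, ?_⟩,
    ⟨exp (-40), exp_pos _, le_rfl, fun c hc => ⟨?_, ?_⟩⟩, ?_⟩
  · exact fun a' y' h' => DelaunayTori.fits_unique hc.1 (h c hc) h'
  · exact DelaunayTori.isEmbeddedC11Torus_torus hc.1 (h c hc) (DelaunayTori.a_le_one hc (h c hc))
  · exact fun t ht θ => DelaunayTori.meanCurvature_torus_unduloid hc.1 (h c hc) ht θ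
  · exact fun t ht θ => DelaunayTori.meanCurvature_torus_nodoid hc.1 (h c hc) ht θ
  · exact DelaunayTori.integrableOn_willmoreDensity_torus hc.1 (h c hc)
  · exact DelaunayTori.willmore_torus_lt hc (h c hc)
  · exact DelaunayTori.tendsto_isoRatio h
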